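/- Let $m\ge 2$ be an integer and $N_S>0$. Let $L_m$ be the $m$-point Gauss--Hermite random variable, whose values are the zeros $l$ of the (probabilists') Hermite polynomial $H_m$, taken with probabilities $\frac{(m-1)!}{m\,H_{m-1}(l)^2}$. In the discrete modulation, $Q_A$ and $P_A$ are independent, each distributed as $\sqrt{N_S}\,L_m$; in the Gaussian modulation, $Q_A$ and $P_A$ are independent centred normal variables of variance $N_S$. In both cases Alice prepares the coherent state $|\alpha\rangle$ with $\alpha=(Q_A+iP_A)/\sqrt2$. Let $\overline\rho=\mathbb E\,|\alpha\rangle\langle\alpha|$ be the average state of the discrete modulation, $\theta(N_S)=\frac1{N_S+1}\sum_{n\ge0}\big(\frac{N_S}{N_S+1}\big)^n|n\rangle\langle n|$ the thermal state of mean photon number $N_S$, and $\chi^2(\rho,\sigma)=\operatorname{Tr}[(\rho\sigma^{-1/2})^2]-1$. Let $\mathcal U(\rho)=U\rho U^\dagger$, with $U$ an isometry from a single bosonic mode $A$ to $B\otimes E$, where $B$ is a single bosonic mode and $E$ a separable Hilbert space, and let $\mathcal N=\operatorname{Tr}_E\circ\,\mathcal U$. Assume for every density operator $\rho$ of $A$,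 with $\hat n$ the photon-number operator, that: if $\operatorname{Tr}[\hat n\rho]<\infty$ then $\operatorname{Tr}[\hat n\,\mathcal N(\rho)]<\infty$; if $\operatorname{Tr}[\hat n^2\rho]<\infty$ then $\operatorname{Tr}[\hat n^2\mathcal N(\rho)]<\infty$; and if $\operatorname{Tr}[\hat n\rho]<\infty$ then $\operatorname{Tr}[H_E\operatorname{Tr}_B\mathcal U(\rho)]<\infty$, for some fixed Hamiltonian $H_E$ on $E$ (not depending on $\rho$) with ground-state energy $0$ and $\operatorname{Tr}[e^{-\beta H_E}]<\infty$ for all $\beta>0$. Let $\overline{\mathcal N}(\rho)=\frac14\sum_{k=0}^3U(k)^\dagger\mathcal N(U(k)\rho U(k)^\dagger)U(k)$ with $U(k)=e^{-i\hat n\pi k/2}$, and let $Q_B$ be the outcome of homodyne detection of the position quadrature $\hat q=(\hat a+\hat a^\dagger)/\sqrt2$ on $\overline{\mathcal N}(|\alpha\rangle\langle\alpha|)$. Write $\gamma_{11}=\mathbb E[(Q_A-\mathbb EQ_A)^2]$, $\gamma_{12}=\mathbb E[(Q_A-\mathbb EQ_A)(Q_B-\mathbb EQ_B)]$, $\gamma_{22}=\mathbb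 E[(Q_B-\mathbb EQ_B)^2]$ for the discrete modulation, and $\gamma^G_{11},\gamma^G_{12},\gamma^G_{22}$ for the same quantities under the Gaussian modulation; denote the expectations by $\mathbb E$ and $\mathbb E_G$, respectively. Then under both modulations $Q_A$ and $Q_B$ have finite fourth moments, $\gamma_{11}=\gamma_{11}^G$, and there are constants $c_1,c_2>0$ (which may depend on $m$, $N_S$ and $U$, but not on $\varepsilon$) such that $$\sqrt{\mathbb E_G[(Q_B-\mathbb E_GQ_B)^4]}\le c_1\sqrt{\mathbb E[(Q_B-\mathbb EQ_B)^4]},$$ $$\sqrt{\mathbb E_G[(Q_A-\mathbb E_GQ_A)^2(Q_B-\mathbb E_GQ_B)^2]}\le c_2\sqrt{\mathbb E[(Q_A-\mathbb EQ_A)^2(Q_B-\mathbb EQ_B)^2]},$$ and, for every $\varepsilon\ge0$ with $\sqrt{\chi^2(\overline\rho,\theta(N_S))}\le\varepsilon^2$, $$|\gamma_{22}-\gamma_{22}^G|\le\varepsilon(1+c_1)\sqrt{\mathbb E[(Q_B-\mathbb EQ_B)^4]},$$ $$|\gamma_{12}-\gamma_{12}^G|\le\varepsilon(1+c_2)\sqrt{\mathbb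 E[(Q_A-\mathbb EQ_A)^2(Q_B-\mathbb EQ_B)^2]}.$$ -/

import Mathlib

open MeasureTheory ProbabilityTheory
open scoped ENNReal NNReal InnerProductSpace

noncomputable section

namespace CVQKD

/-! ## A bosonic mode -/

/-- The Hilbert space of a single bosonic mode in the number (Fock) representation. -/
abbrev Mode : Type := lp (fun _ : ℕ => ℂ) 2

/-- The Hilbert space tensor product of a single bosonic mode with a Hilbert space `E`, realized as
`ℓ²(ℕ; E)`: the `n`-th entry is the component along the number state `|n⟩` of the mode. -/
abbrev ModeTensor (E : Type*) [NormedAddCommGroup E] : Type _ := lp (fun _ : ℕ => E) 2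

/-- The number state `|n⟩`. -/
def fock (n : ℕ) : Mode := lp.single 2 n (1 : ℂ)

/-- The product vector `|n⟩ ⊗ v`. -/
def fockTensor {E : Type*} [NormedAddCommGroup E] (n : ℕ) (v : E) : ModeTensor E :=
  lp.single 2 n v

/-- The amplitude `⟨n|α⟩ = exp(-|α|²/2) αⁿ / √n!` of the coherent state `|α⟩`. -/
def coherentAmp (α : ℂ) (n : ℕ) : ℂ :=
  (Real.exp (-‖α‖ ^ 2 / 2) : ℂ) * α ^ n / (Real.sqrt (n.factorial) : ℂ)

theorem memℓp_coherentAmp (α : ℂ) : Memℓp (coherentAmp α) 2 := by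
  apply memℓp_gen
  have h : ∀ n : ℕ, ‖coherentAmp α n‖ ^ (2 : ℝ≥0∞).toReal
      = Real.exp (-‖α‖ ^ 2 / 2) ^ 2 * ((‖α‖ ^ 2) ^ n / (n.factorial : ℝ)) := by
    intro n
    have h0 : (0 : ℝ) ≤ (n.factorial : ℝ) := by positivity
    simp only [coherentAmp, ENNReal.toReal_ofNat, Real.rpow_ofNat, norm_div, norm_mul, norm_pow,
      Complex.norm_real, Real.norm_eq_abs, div_pow, mul_pow, sq_abs, Real.sq_sqrt h0]
    ring
  simp_rw [h]
  exact (Real.summable_pow_div_factorial _).mul_left _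

/-- The coherent state `|α⟩`. -/
def coherent (α : ℂ) : Mode := ⟨coherentAmp α, memℓp_coherentAmp α⟩

/-! ## Homodyne detection of the position quadrature `q̂ = (â + â†)/√2` -/

/-- The position wave function of the number state `|n⟩`: the `n`-th normalized Hermite function
`π^(-1/4) (n!)^(-1/2) Heₙ(√2 x) exp(-x²/2)`, with `Heₙ` the probabilists' Hermite polynomial. -/
def hermiteFun (n : ℕ) (x : ℝ) : ℝ :=
  (Polynomial.aeval (Real.sqrt 2 * x) (Polynomial.hermite n)) * Real.exp (-x ^ 2 / 2)
    / Real.sqrt (n.factorial * Real.sqrt Real.pi)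

theorem integrable_poly_mul_gaussian (Q : Polynomial ℝ) :
    Integrable (fun x : ℝ => Q.eval x * Real.exp (-1 * x ^ 2)) := by
  simp_rw [Polynomial.eval_eq_sum_range, Finset.sum_mul, mul_assoc]
  refine integrable_finsetSum _ fun i _ => ?_
  refine Integrable.const_mul ?_ _
  have h := integrable_rpow_mul_exp_neg_mul_sq (b := 1) one_pos (s := (i : ℝ))
    (by have : (0 : ℝ) ≤ i := by positivity
        linarith)
  simpa [Real.rpow_natCast] using h

theorem memLp_hermiteFun (n : ℕ) : MemLp (hermiteFun n) 2 (volume : Measure ℝ) := by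
  have hc : Continuous (hermiteFun n) := by
    unfold hermiteFun
    fun_prop
  rw [memLp_two_iff_integrable_sq hc.aestronglyMeasurable]
  let P : Polynomial ℝ := ((Polynomial.hermite n).map (Int.castRingHom ℝ)).comp
    (Polynomial.C (Real.sqrt 2) * Polynomial.X)
  have hP : ∀ x : ℝ, Polynomial.aeval (Real.sqrt 2 * x) (Polynomial.hermite n) = P.eval x := by
    intro x
    simp [P, Polynomial.aeval_def, Polynomial.eval_map]
  have h := (integrable_poly_mul_gaussian (P ^ 2)).const_mul
    ((Real.sqrt (n.factorial * Real.sqrt Real.pi)) ^ 2)⁻¹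
  refine h.congr (Filter.Eventually.of_forall fun x => ?_)
  simp only [hermiteFun, hP, Polynomial.eval_pow]
  have he : Real.exp (-1 * x ^ 2) = Real.exp (-x ^ 2 / 2) ^ 2 := by
    rw [← Real.exp_nat_mul]
    congr 1
    push_cast
    ring
  rw [he]
  ring

section Homodyne

variable {E : Type*} [NormedAddCommGroup E] [InnerProductSpace ℂ E]

theorem memLp_hermiteFun_smul (n : ℕ) (v : E) :
    MemLp (fun x : ℝ => ((hermiteFun n x : ℝ) : ℂ) • v) 2 (volume : Measure ℝ) := by
  have hc : Continuous (hermiteFun n) := by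
    unfold hermiteFun
    fun_prop
  refine (memLp_hermiteFun n).of_le_mul (c := ‖v‖)
    (by fun_prop) (Filter.Eventually.of_forall fun x => ?_)
  rw [norm_smul, Complex.norm_real, mul_comm]

/-- The position representation `x ↦ ∑ₙ hₙ(x) Φₙ` in `L²(ℝ; E)` of the vector `∑ₙ |n⟩ ⊗ Φₙ`;
the series converges in `L²(ℝ; E)` whenever `∑ₙ ‖Φₙ‖² < ∞`. -/
def wave (Φ : ℕ → E) : Lp E 2 (volume : Measure ℝ) :=
  ∑' n, (memLp_hermiteFun_smul n (Φ n)).toLp _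

/-- The law of the outcome of a position-quadrature homodyne measurement on the mode in the pure
joint state `∑ₙ |n⟩ ⊗ Φₙ`: it has the density `x ↦ ‖Φ(x)‖²`. -/
def homodyneLaw (Φ : ℕ → E) : Measure ℝ :=
  (volume : Measure ℝ).withDensity fun x => ENNReal.ofReal (‖wave Φ x‖ ^ 2)

end Homodyne

/-! ## States and photon-number moments -/

/-- Density operators of a mode: positive operators of trace one. -/
def IsDensity (ρ : Mode →L[ℂ] Mode) : Prop :=
  ρ.IsPositive ∧ ∑' n, ENNReal.ofReal (⟪fock n, ρ (fock n)⟫_ℂ).re = 1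

/-- `Tr[n̂ᵏ ρ]`. -/
def photonMoment (ρ : Mode →L[ℂ] Mode) (k : ℕ) : ℝ≥0∞ :=
  ∑' n : ℕ, (n : ℝ≥0∞) ^ k * ENNReal.ofReal (⟪fock n, ρ (fock n)⟫_ℂ).re

section Channel

variable {E : Type*} [NormedAddCommGroup E] [InnerProductSpace ℂ E] [CompleteSpace E]

/-- The diagonal element `(⟨n| ⊗ ⟨v|) U ρ U† (|n⟩ ⊗ |v⟩)` of the joint output on `B` and `E`. -/
def jointDiag (U : Mode →ₗᵢ[ℂ] ModeTensor E) (ρ : Mode →L[ℂ] Mode) (n : ℕ) (v : E) : ℝ≥0∞ :=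
  ENNReal.ofReal (⟪fockTensor n v, U.toContinuousLinearMap
    (ρ (ContinuousLinearMap.adjoint U.toContinuousLinearMap (fockTensor n v)))⟫_ℂ).re

/-- An orthonormal basis of `E` (to take traces over `E`). -/
def traceBasis (E : Type*) [NormedAddCommGroup E] [InnerProductSpace ℂ E] [CompleteSpace E] :
    HilbertBasis (exists_hilbertBasis ℂ E).choose ℂ E :=
  (exists_hilbertBasis ℂ E).choose_spec.choose

/-- `Tr[n̂ᵏ 𝒩(ρ)]` for the reduced channel `𝒩(ρ) = Tr_E[U ρ U†]`. -/
def outputPhotonMoment (U : Mode →ₗᵢ[ℂ] ModeTensor E) (ρ : Mode →L[ℂ] Mode) (k : ℕ) : ℝ≥0∞ :=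
  ∑' n : ℕ, (n : ℝ≥0∞) ^ k * ∑' j, jointDiag U ρ n (traceBasis E j)

/-- `Tr[H_E Tr_B[U ρ U†]]` for the Hamiltonian `H_E = ∑ⱼ h j |f j⟩⟨f j|` on `E`. -/
def eveEnergy {ι : Type} (f : HilbertBasis ι ℂ E) (h : ι → ℝ)
    (U : Mode →ₗᵢ[ℂ] ModeTensor E) (ρ : Mode →L[ℂ] Mode) : ℝ≥0∞ :=
  ∑' j, ENNReal.ofReal (h j) * ∑' n : ℕ, jointDiag U ρ n (f j)

/-- The assumptions on the isometric channel `ρ ↦ U ρ U†` from `A` to `B ⊗ E`. -/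
structure IsAdmissible (U : Mode →ₗᵢ[ℂ] ModeTensor E) : Prop where
  /-- finite mean photon number is mapped to finite mean photon number -/
  mean : ∀ ρ, IsDensity ρ → photonMoment ρ 1 < ∞ → outputPhotonMoment U ρ 1 < ∞
  /-- finite second moment (equivalently, finite variance) of the photon number is mapped to
  finite second moment of the photon number -/
  second : ∀ ρ, IsDensity ρ → photonMoment ρ 2 < ∞ → outputPhotonMoment U ρ 2 < ∞
  /-- finite mean photon number is mapped to finite mean energy of `E`, for a Hamiltonian with
  ground-state energy zero that satisfies the Gibbs hypothesis `Tr[exp(-β H_E)] < ∞` for all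
  `β > 0` (which forces a purely discrete spectrum) -/
  energy : ∃ (ι : Type) (f : HilbertBasis ι ℂ E) (h : ι → ℝ),
    (∀ j, 0 ≤ h j) ∧ (∃ j, h j = 0) ∧ (∀ β : ℝ, 0 < β → Summable fun j => Real.exp (-β * h j)) ∧
    ∀ ρ, IsDensity ρ → photonMoment ρ 1 < ∞ → eveEnergy f h U ρ < ∞

/-- The law of Bob's homodyne outcome when Alice sends the coherent state `|α⟩` through the
phase-symmetrized channel `ρ ↦ (1/4) ∑ₖ U(k)† 𝒩(U(k) ρ U(k)†) U(k)` with
`U(k) = exp(-i n̂ π k / 2)`: one has `U(k)|α⟩ = |α (-i)ᵏ⟩`, and `U(k)†` multiplies the component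
along `|n⟩` by `i^(k n)`. -/
def bobLaw (U : Mode →ₗᵢ[ℂ] ModeTensor E) (α : ℂ) : Measure ℝ :=
  ∑ k ∈ Finset.range 4, (1 / 4 : ℝ≥0∞) • homodyneLaw
    fun n => (Complex.I ^ (k * n)) • (U (coherent (α * (-Complex.I) ^ k)) : ModeTensor E) n

/-! ## Modulations -/

/-- The coherent amplitude `(q + i p)/√2`. -/
def amplitude (z : ℝ × ℝ) : ℂ := ((z.1 : ℂ) + Complex.I * (z.2 : ℂ)) / (Real.sqrt 2 : ℂ)

/-- The law of `√N · L_m`, with `L_m` the `m`-point Gauss–Hermite approximation of the standard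
normal: its values are the zeros `l` of the Hermite polynomial `He_m`, taken with probabilities
`(m-1)! / (m He_{m-1}(l)²)`. -/
def gaussHermiteLaw (m : ℕ) (N : ℝ≥0) : Measure ℝ :=
  ∑ l ∈ ((Polynomial.hermite m).map (Int.castRingHom ℝ)).roots.toFinset,
    ENNReal.ofReal ((m - 1).factorial /
      (m * (Polynomial.aeval l (Polynomial.hermite (m - 1))) ^ 2)) •
    Measure.dirac (Real.sqrt N * l)

/-- The discrete modulation: the law of `(Q_A, P_A)` for the `m²`-point constellation. -/
def discreteModulation (m : ℕ) (N : ℝ≥0) : Measure (ℝ × ℝ) :=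
  (gaussHermiteLaw m N).prod (gaussHermiteLaw m N)

/-- The Gaussian modulation: the law of `(Q_A, P_A)` with independent centred normal components
of variance `N` (so that `(Q_A + i P_A)/√2` has as its law the `P`-function of the thermal state
of mean photon number `N`). -/
def gaussianModulation (N : ℝ≥0) : Measure (ℝ × ℝ) :=
  (gaussianReal 0 N).prod (gaussianReal 0 N)

/-- The joint law of `(Q_A, Q_B)` when `(Q_A, P_A)` has the law `μ`, Alice sends the coherent state
`|(Q_A + i P_A)/√2⟩`, and Bob measures the position quadrature. -/
def jointLaw (μ : Measure (ℝ × ℝ)) (U : Mode →ₗᵢ[ℂ] ModeTensor E) : Measure (ℝ × ℝ) :=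
  μ.bind fun z => (bobLaw U (amplitude z)).map fun y => (z.1, y)

end Channel

/-- The matrix elements `⟨i|ρ̄|j⟩` of the average state `ρ̄ = ∫ |α⟩⟨α| dμ`. -/
def averageState (μ : Measure (ℝ × ℝ)) (i j : ℕ) : ℂ :=
  ∫ z, coherentAmp (amplitude z) i * star (coherentAmp (amplitude z) j) ∂μ

/-- The eigenvalues of the thermal state `θ(N)` (which is diagonal in the number basis). -/
def thermal (N : ℝ≥0) (n : ℕ) : ℝ := 1 / (N + 1) * (N / (N + 1)) ^ n

/-- The divergence `χ²(ρ, σ) = Tr[(ρ σ^(-1/2))²] - 1` for a state `ρ` with the matrix elements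
`ρ i j` and a state `σ` that is diagonal in the same basis with eigenvalues `t i > 0`. As `ρ` is
Hermitian, the trace is `∑ᵢⱼ ρᵢⱼ tⱼ^(-1/2) ρⱼᵢ tᵢ^(-1/2) = ∑ᵢⱼ |ρᵢⱼ|² (tᵢ tⱼ)^(-1/2)`, which may
be infinite and is at least one. -/
def chiSq (ρ : ℕ → ℕ → ℂ) (t : ℕ → ℝ) : ℝ≥0∞ :=
  (∑' i, ∑' j, ENNReal.ofReal (‖ρ i j‖ ^ 2 / (Real.sqrt (t i) * Real.sqrt (t j)))) - 1

/-! ## Parameters of a joint law of `(Q_A, Q_B)` -/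

/-- `E[(Q_A - E Q_A)^a (Q_B - E Q_B)^b]`. -/
def centralMoment₂ (P : Measure (ℝ × ℝ)) (a b : ℕ) : ℝ :=
  ∫ w, (w.1 - ∫ w', w'.1 ∂P) ^ a * (w.2 - ∫ w', w'.2 ∂P) ^ b ∂P

/-- `γ₁₁ = E[(Q_A - E Q_A)²]`. -/
def γ₁₁ (P : Measure (ℝ × ℝ)) : ℝ := centralMoment₂ P 2 0

/-- `γ₁₂ = E[(Q_A - E Q_A)(Q_B - E Q_B)]`. -/
def γ₁₂ (P : Measure (ℝ × ℝ)) : ℝ := centralMoment₂ P 1 1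

/-- `γ₂₂ = E[(Q_B - E Q_B)²]`. -/
def γ₂₂ (P : Measure (ℝ × ℝ)) : ℝ := centralMoment₂ P 0 2

end CVQKD

end

noncomputable section

namespace CVQKD

/-! ## Hermite polynomials and Gauss–Hermite quadrature -/

section Hermite

open Polynomial

/-! Given the amplitude `α`, every moment of `Q_B` up to order four has the form `⟨α|X|α⟩`, where
`X` is a power of the position observable pulled back through the symmetrized channel. It is thus a
quadratic form `∑ conj(cᵢ) Gᵢⱼ cⱼ` in the amplitudes `cᵢ = ⟨i|α⟩` (`integral_pow_bobLaw`). The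
factor `Q_A = √2 Re α` can be absorbed into the matrix, because coherent states are eigenvectors of
the annihilation operator (`form_crossGram`). Averaging over a modulation gives `Tr(ρ̄ X)`, linear
in the average state (`hasSum_integral_form`), and for the Gaussian modulation that state is `θ(N)`
(`averageState_gaussianModulation`).

Hence `γ₂₂` and `γ₁₂` differ between the modulations by `Tr((ρ̄ - θ) X)`. Cauchy–Schwarz with the
weights `√(tᵢ tⱼ)`, `t` being the thermal eigenvalues, bounds this by `√χ² · D ≤ ε² D`, where `D` is
a weighted Hilbert–Schmidt norm of `X` (`norm_integral_form_sub_le`). For finite `D` the matrix of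
`X` must grow subexponentially. Admissibility, applied to the geometric states `(1 - s) ∑ sⁱ |i⟩⟨i|`
for every `s < 1`, gives this: output second photon moments for number inputs are summable against
every `sⁱ`, and they control fourth position moments through the recurrence of the Hermite functions
(`lintegral_sq_smul_wave_le`).

Let `S` and `T` be the square roots of the fourth-order moments for the discrete and the Gaussian
modulation. Jensen's inequality bounds the two covariances by `S` and `T`, so their difference is at
most `S + T`. For `ε ≤ 1` use `ε² D ≤ ε D`, for `ε ≥ 1` use `S + T`; both are at most `ε (S + T + D)
= ε (1 + c) S` with `c = (T + D) / S`, and `c S ≥ T` is the required moment comparison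
(`abs_sub_le_of_quadratic_bound`).

Three facts complete the argument. The means vanish because both modulations are even and the
symmetrized channel turns `α ↦ -α` into `Q_B ↦ -Q_B` (`bobLaw_neg`). Equality of `γ₁₁` is exactness
of Gauss–Hermite quadrature on `x²`, read off from the eigenvectors of the Jacobi matrix
(`exists_spectral_ghNodes`). And `S > 0` because the homodyne law has a density, so `Q_B ≠ 0` almost
surely. -/

theorem derivative_hermite_succ (n : ℕ) :
    derivative (hermite (n + 1)) = ((n : ℤ[X]) + 1) * hermite n := by
  induction n with
  | zero => simp
  | succ n ih =>
    rw [hermite_succ (n + 1), derivative_sub, derivative_mul, derivative_X, one_mul, ih,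
      derivative_mul]
    simp only [derivative_add, derivative_natCast, derivative_one, add_zero, zero_mul, zero_add]
    rw [hermite_succ n]
    push_cast
    ring

/-- The value of the probabilists' Hermite polynomial at a real point. -/
def he (n : ℕ) (x : ℝ) : ℝ := aeval x (hermite n)

theorem he_zero (x : ℝ) : he 0 x = 1 := by simp [he]

theorem he_one (x : ℝ) : he 1 x = x := by simp [he]

theorem he_succ_succ (n : ℕ) (x : ℝ) :
    he (n + 2) x = x * he (n + 1) x - (n + 1) * he n x := by
  unfold he
  rw [hermite_succ (n + 1), derivative_hermite_succ]
  simp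

theorem he_neg (n : ℕ) (x : ℝ) : he n (-x) = (-1) ^ n * he n x := by
  induction n using Nat.twoStepInduction with
  | zero => simp [he_zero]
  | one => simp [he_one]
  | more n h0 h1 =>
    rw [he_succ_succ, he_succ_succ, h0, h1]
    ring

theorem hasDerivAt_he (n : ℕ) (x : ℝ) : HasDerivAt (he n) (x * he n x - he (n + 1) x) x := by
  have h := (hermite n).hasDerivAt_aeval x
  have e : aeval x (derivative (hermite n)) = x * he n x - he (n + 1) x := by
    unfold he
    rw [hermite_succ n]
    simp
  rw [e] at h
  exact h

/-- The confluent Christoffel–Darboux identity. -/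
theorem sum_he_sq (n : ℕ) (x : ℝ) :
    ∑ k ∈ Finset.range (n + 1), he k x ^ 2 / (k.factorial : ℝ) =
      ((n + 1) * he n x ^ 2 - he (n + 1) x * (x * he n x - he (n + 1) x)) / n.factorial := by
  induction n with
  | zero => simp [he_zero, he_one]
  | succ n ih =>
    rw [Finset.sum_range_succ, ih, he_succ_succ, Nat.factorial_succ]
    have : (n.factorial : ℝ) ≠ 0 := by positivity
    push_cast
    field_simp
    ring

/-- The Jacobi matrix of the Hermite polynomials. -/
def jacobi (m : ℕ) : Matrix (Fin m) (Fin m) ℝ := fun i j =>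
  (if (i : ℕ) + 1 = j then Real.sqrt ((i : ℝ) + 1) else 0) +
    (if (j : ℕ) + 1 = i then Real.sqrt i else 0)

theorem jacobi_isHermitian (m : ℕ) : (jacobi m).IsHermitian := by
  ext i j
  simp only [Matrix.conjTranspose_apply, jacobi, star_trivial]
  rw [add_comm]
  congr 1
  · split_ifs with h
    · rw [← h]; push_cast; rfl
    · rfl
  · split_ifs with h
    · rw [← h]; push_cast; rfl
    · rfl

/-- The rows of the eigenvalue equation are the three-term recurrence of `Heᵢ/√i!`, so the first
entry determines the vector. The last row has no entry of index `m`, which forces `b₀ He_m(r) = 0`.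
-/
theorem jacobi_eigenvector {m : ℕ} (b : Fin m → ℝ) (r : ℝ)
    (h : (jacobi m).mulVec b = r • b) (hm : 0 < m) :
    b ⟨0, hm⟩ * he m r = 0 ∧
      ∀ i : Fin m, b i = b ⟨0, hm⟩ * (he i r / Real.sqrt ((i : ℕ).factorial)) := by
  -- Extension by zero gives the last row the same shape as the others. In row `0` the truncated
  -- index `i - 1` is harmless, since its coefficient is `√0`.
  set b' : ℕ → ℝ := fun i => if h : i < m then b ⟨i, h⟩ else 0 with hb'
  have hrec : ∀ i, i < m → Real.sqrt ((i : ℝ) + 1) * b' (i + 1) + Real.sqrt i * b' (i - 1)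
      = r * b' i := by
    intro i hi
    have h1 := congrFun h ⟨i, hi⟩
    simp only [Matrix.mulVec, dotProduct, jacobi, Pi.smul_apply, smul_eq_mul, add_mul,
      Finset.sum_add_distrib] at h1
    have e1 : ∑ j : Fin m, (if i + 1 = (j : ℕ) then Real.sqrt ((i : ℝ) + 1) else 0) * b j
        = Real.sqrt ((i : ℝ) + 1) * b' (i + 1) := by
      by_cases hi1 : i + 1 < m
      · rw [Finset.sum_eq_single ⟨i + 1, hi1⟩]
        · simp [hb', hi1]
        · intro j _ hj
          rw [if_neg, zero_mul]
          intro h2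
          exact hj (Fin.ext h2.symm)
        · simp
      · simp only [hb', hi1, dite_false, mul_zero]
        refine Finset.sum_eq_zero fun j _ => ?_
        rw [if_neg, zero_mul]
        have := j.2
        omega
    have e2 : ∑ j : Fin m, (if (j : ℕ) + 1 = i then Real.sqrt (i : ℝ) else 0) * b j
        = Real.sqrt i * b' (i - 1) := by
      rcases Nat.eq_zero_or_pos i with hi0 | hi0
      · subst hi0
        simp
      · have hi1 : i - 1 < m := by omega
        rw [Finset.sum_eq_single ⟨i - 1, hi1⟩]
        · have : i - 1 + 1 = i := by omega
          simp [hb', hi1, this]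
        · intro j _ hj
          rw [if_neg, zero_mul]
          intro h2
          exact hj (Fin.ext (by simp; omega))
        · simp
    rw [e1, e2] at h1
    rw [h1]
    simp [hb', hi]
  have key : ∀ i, i ≤ m → b' i = b' 0 * (he i r / Real.sqrt (i.factorial)) := by
    intro i
    induction i using Nat.twoStepInduction with
    | zero => simp [he_zero]
    | one =>
      intro _
      have := hrec 0 hm
      simp at this
      simp [he_one, this]
      ring
    | more n h0 h1 =>
      intro hn
      have h2 := hrec (n + 1) (by omega)
      rw [h1 (by omega), Nat.add_sub_cancel, h0 (by omega)] at h2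
      have hs : Real.sqrt ((n : ℝ) + 1) ≠ 0 := by positivity
      have hs2 : Real.sqrt ((n : ℝ) + 1 + 1) ≠ 0 := by positivity
      have hf : Real.sqrt (n.factorial : ℝ) ≠ 0 := by positivity
      have hsq : Real.sqrt ((n : ℝ) + 1) ^ 2 = (n : ℝ) + 1 := Real.sq_sqrt (by positivity)
      rw [he_succ_succ, Nat.factorial_succ, Nat.factorial_succ]
      rw [Nat.factorial_succ] at h2
      push_cast at h2 ⊢
      rw [Real.sqrt_mul (by positivity)] at h2 ⊢
      rw [Real.sqrt_mul (by positivity)]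
      refine mul_left_cancel₀ hs2 (eq_sub_of_add_eq h2 |>.trans ?_)
      field_simp
      rw [hsq]
  constructor
  · have h1 := key m le_rfl
    simp only [hb', lt_irrefl, dite_false, hm, dite_true] at h1
    have hf : Real.sqrt (m.factorial : ℝ) ≠ 0 := by positivity
    field_simp at h1
    linarith
  · intro i
    have := key i i.2.le
    simpa [hb', hm] using this

/-- The Gauss–Hermite weight of a node. -/
def ghWeight (m : ℕ) (l : ℝ) : ℝ := (m - 1).factorial / (m * he (m - 1) l ^ 2)

/-- The nodes of the Gauss–Hermite quadrature. -/
def ghNodes (m : ℕ) : Finset ℝ := ((hermite m).map (Int.castRingHom ℝ)).roots.toFinset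

theorem hermite_map_ne_zero (m : ℕ) : (hermite m).map (Int.castRingHom ℝ) ≠ 0 :=
  ((hermite_monic m).map _).ne_zero

theorem mem_ghNodes {m : ℕ} {l : ℝ} : l ∈ ghNodes m ↔ he m l = 0 := by
  rw [ghNodes, Multiset.mem_toFinset, mem_roots (hermite_map_ne_zero m), IsRoot.def,
    eval_map, he, aeval_def]
  rfl

/-- The Gauss–Hermite nodes as the spectrum of the Jacobi matrix, the weights being the squares of
the first components of the normalized eigenvectors. -/
theorem exists_spectral_ghNodes (m : ℕ) (hm : 0 < m) :
    ∃ (r : Fin m → ℝ) (b : Fin m → Fin m → ℝ),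
      (∀ f : ℝ → ℝ, ∑ l ∈ ghNodes m, f l = ∑ k, f (r k)) ∧
      (∀ k, ghWeight m (r k) = b k ⟨0, hm⟩ ^ 2) ∧
      (∀ k i, b k i = b k ⟨0, hm⟩ * (he i (r k) / Real.sqrt ((i : ℕ).factorial))) ∧
      (∀ i j, ∑ k, b k i * b k j = if i = j then 1 else 0) := by
  set hA := jacobi_isHermitian m
  set r := hA.eigenvalues
  set b : Fin m → Fin m → ℝ := fun k => ⇑(hA.eigenvectorBasis k) with hb
  have hev : ∀ k, (jacobi m).mulVec (b k) = r k • b k := fun k => hA.mulVec_eigenvectorBasis k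
  have hon : ∀ k l, ∑ i, b k i * b l i = if k = l then 1 else 0 := by
    intro k l
    have h := orthonormal_iff_ite.mp hA.eigenvectorBasis.orthonormal k l
    rw [← h, PiLp.inner_apply]
    simp [hb, mul_comm]
  -- The eigenvector matrix is orthogonal, so its rows are orthonormal as well as its columns; all
  -- quadrature identities below are instances of this.
  have hcomp : ∀ i j, ∑ k, b k i * b k j = if i = j then 1 else 0 := by
    intro i j
    have hU := (Matrix.mem_unitaryGroup_iff).mp (hA.eigenvectorUnitary).2
    have h := congrFun (congrFun hU i) j
    rw [Matrix.mul_apply, Matrix.one_apply] at h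
    rw [← h]
    refine Finset.sum_congr rfl fun k _ => ?_
    rw [Matrix.star_apply]
    erw [hA.eigenvectorUnitary_apply, hA.eigenvectorUnitary_apply]
    simp [hb]
  have hvec : ∀ k i, b k i = b k ⟨0, hm⟩ * (he i (r k) / Real.sqrt ((i : ℕ).factorial)) :=
    fun k => (jacobi_eigenvector (b k) (r k) (hev k) hm).2
  have hb0 : ∀ k, b k ⟨0, hm⟩ ≠ 0 := by
    intro k h0
    have h1 := hon k k
    rw [if_pos rfl, Finset.sum_eq_zero] at h1
    · exact zero_ne_one h1
    · intro i _
      rw [hvec k i, h0]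
      simp
  have hroot : ∀ k, he m (r k) = 0 := fun k =>
    (mul_eq_zero.mp (jacobi_eigenvector (b k) (r k) (hev k) hm).1).resolve_left (hb0 k)
  -- Eigenvectors with the same eigenvalue are proportional, which contradicts their orthogonality.
  have hinj : Function.Injective r := by
    intro k l hkl
    by_contra hne
    have h1 := hon k k
    have h2 := hon k l
    rw [if_pos rfl] at h1
    rw [if_neg hne] at h2
    have e : ∀ i, b k i * b l i = (b l ⟨0, hm⟩ / b k ⟨0, hm⟩) * (b k i * b k i) := by
      intro i
      rw [hvec l i, hvec k i, hkl]
      have := hb0 k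
      field_simp
    simp_rw [e] at h2
    rw [← Finset.mul_sum, h1, mul_one] at h2
    exact (div_ne_zero (hb0 l) (hb0 k)) h2
  -- `m` distinct eigenvalues are roots of a polynomial of degree `m`, so they exhaust its roots.
  have himg : Finset.univ.image r = ghNodes m := by
    refine Finset.eq_of_subset_of_card_le ?_ ?_
    · intro x hx
      obtain ⟨k, _, rfl⟩ := Finset.mem_image.mp hx
      exact mem_ghNodes.mpr (hroot k)
    · rw [Finset.card_image_of_injective _ hinj, Finset.card_univ, Fintype.card_fin, ghNodes]
      refine (Multiset.toFinset_card_le _).trans ((card_roots' _).trans ?_)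
      exact natDegree_map_le.trans natDegree_hermite.le
  refine ⟨r, b, ?_, ?_, hvec, hcomp⟩
  · intro f
    rw [← himg, Finset.sum_image fun _ _ _ _ h => hinj h]
  · intro k
    -- Normalization reads `1 = b₀² ∑ Heᵢ(r)²/i!`; as `He_m(r) = 0`, Christoffel–Darboux reduces the
    -- sum to `(n + 1) Heₙ(r)²/n!`, the inverse of the weight.
    obtain ⟨n, rfl⟩ : ∃ n, m = n + 1 := ⟨m - 1, by omega⟩
    have h1 := hon k k
    rw [if_pos rfl] at h1
    have e : ∀ i, b k i * b k i
        = b k ⟨0, hm⟩ ^ 2 * (he i (r k) ^ 2 / ((i : ℕ).factorial : ℝ)) := by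
      intro i
      rw [hvec k i, ← sq, mul_pow, div_pow, Real.sq_sqrt (by positivity)]
    simp_rw [e] at h1
    rw [← Finset.mul_sum, Fin.sum_univ_eq_sum_range
      (fun i => he i (r k) ^ 2 / (i.factorial : ℝ)) (n + 1), sum_he_sq, hroot k] at h1
    have hf : (n.factorial : ℝ) ≠ 0 := by positivity
    simp only [zero_mul, sub_zero] at h1
    have hne : he n (r k) ≠ 0 := by
      intro h0
      simp [h0] at h1
    simp only [ghWeight, Nat.add_sub_cancel]
    push_cast
    have hn : ((n : ℝ) + 1) ≠ 0 := by positivity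
    field_simp at h1 ⊢
    linarith

theorem ghWeight_nonneg (m : ℕ) (l : ℝ) : 0 ≤ ghWeight m l := by
  unfold ghWeight
  positivity

/-! ### Moments and symmetry of the Gauss–Hermite law -/

theorem sum_ghWeight (m : ℕ) (hm : 0 < m) : ∑ l ∈ ghNodes m, ghWeight m l = 1 := by
  obtain ⟨r, b, hsum, hw, -, hcomp⟩ := exists_spectral_ghNodes m hm
  rw [hsum]
  simp_rw [hw, sq]
  rw [hcomp, if_pos rfl]

/-- Since `He₁(l) = l`, each summand is the square of a second eigenvector component, and the second
row of the eigenvector matrix has norm one. That row exists only if `m ≥ 2`. -/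
theorem sum_ghWeight_mul_sq (m : ℕ) (hm : 2 ≤ m) :
    ∑ l ∈ ghNodes m, ghWeight m l * l ^ 2 = 1 := by
  obtain ⟨r, b, hsum, hw, hvec, hcomp⟩ := exists_spectral_ghNodes m (by omega)
  rw [hsum]
  have e : ∀ k, ghWeight m (r k) * r k ^ 2 = b k ⟨1, hm⟩ * b k ⟨1, hm⟩ := by
    intro k
    rw [hw, hvec k ⟨1, hm⟩]
    simp [he_one]
    ring
  simp_rw [e]
  rw [hcomp, if_pos rfl]

theorem neg_mem_ghNodes {m : ℕ} {l : ℝ} : -l ∈ ghNodes m ↔ l ∈ ghNodes m := by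
  simp [mem_ghNodes, he_neg]

theorem ghWeight_neg (m : ℕ) (l : ℝ) : ghWeight m (-l) = ghWeight m l := by
  simp [ghWeight, he_neg, mul_pow, ← pow_mul, mul_comm _ 2]

theorem gaussHermiteLaw_eq (m : ℕ) (N : ℝ≥0) : gaussHermiteLaw m N =
    ∑ l ∈ ghNodes m, ENNReal.ofReal (ghWeight m l) • Measure.dirac (Real.sqrt N * l) := rfl

theorem lintegral_gaussHermiteLaw (m : ℕ) (N : ℝ≥0) (f : ℝ → ℝ≥0∞) (hf : Measurable f) :
    ∫⁻ x, f x ∂gaussHermiteLaw m N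
      = ∑ l ∈ ghNodes m, ENNReal.ofReal (ghWeight m l) * f (Real.sqrt N * l) := by
  rw [gaussHermiteLaw_eq, lintegral_finsetSum_measure]
  simp [lintegral_smul_measure, lintegral_dirac' _ hf]

theorem isProbabilityMeasure_gaussHermiteLaw (m : ℕ) (hm : 0 < m) (N : ℝ≥0) :
    IsProbabilityMeasure (gaussHermiteLaw m N) := by
  constructor
  rw [← lintegral_one, lintegral_gaussHermiteLaw m N _ measurable_const]
  simp_rw [mul_one]
  rw [← ENNReal.ofReal_sum_of_nonneg fun l _ => ghWeight_nonneg m l, sum_ghWeight m hm,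
    ENNReal.ofReal_one]

theorem lintegral_sq_gaussHermiteLaw (m : ℕ) (hm : 2 ≤ m) (N : ℝ≥0) :
    ∫⁻ x, ENNReal.ofReal (x ^ 2) ∂gaussHermiteLaw m N = N := by
  rw [lintegral_gaussHermiteLaw m N _ (by fun_prop)]
  have e : ∀ l, ENNReal.ofReal (ghWeight m l) * ENNReal.ofReal ((Real.sqrt N * l) ^ 2)
      = ENNReal.ofReal (N * (ghWeight m l * l ^ 2)) := by
    intro l
    rw [← ENNReal.ofReal_mul (ghWeight_nonneg m l), mul_pow, Real.sq_sqrt N.coe_nonneg]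
    congr 1
    ring
  simp_rw [e]
  rw [← ENNReal.ofReal_sum_of_nonneg, ← Finset.mul_sum, sum_ghWeight_mul_sq m hm, mul_one]
  · simp
  · intro l _
    have := ghWeight_nonneg m l
    positivity

theorem map_neg_gaussHermiteLaw (m : ℕ) (N : ℝ≥0) :
    (gaussHermiteLaw m N).map (fun x => -x) = gaussHermiteLaw m N := by
  refine Measure.ext_of_lintegral _ fun f hf => ?_
  rw [lintegral_map hf measurable_neg, lintegral_gaussHermiteLaw m N _ hf,
    lintegral_gaussHermiteLaw m N (fun x => f (-x)) (hf.comp measurable_neg)]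
  refine Finset.sum_bij' (fun l _ => -l) (fun l _ => -l) ?_ ?_ ?_ ?_ ?_
  · exact fun l hl => neg_mem_ghNodes.mpr hl
  · exact fun l hl => neg_mem_ghNodes.mpr hl
  · simp
  · simp
  · intro l _
    simp [ghWeight_neg]

end Hermite

/-! ## Hermite functions and the position representation -/

section HermiteFunctions

theorem hermiteFun_eq (n : ℕ) (x : ℝ) : hermiteFun n x =
    he n (Real.sqrt 2 * x) * Real.exp (-x ^ 2 / 2) / Real.sqrt (n.factorial * Real.sqrt Real.pi) :=
  rfl

theorem continuous_hermiteFun (n : ℕ) : Continuous (hermiteFun n) := by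
  unfold hermiteFun
  fun_prop

/-! ### Orthonormality of the Hermite functions -/

theorem integrable_eval_he_mul_gaussian (Q : Polynomial ℝ) (m n : ℕ) :
    Integrable fun x : ℝ => Q.eval x * he m (Real.sqrt 2 * x) * he n (Real.sqrt 2 * x) *
      Real.exp (-1 * x ^ 2) := by
  have hP : ∀ (k : ℕ) (x : ℝ), he k (Real.sqrt 2 * x) =
      (((Polynomial.hermite k).map (Int.castRingHom ℝ)).comp
        (Polynomial.C (Real.sqrt 2) * Polynomial.X)).eval x := by
    intro k x
    simp [he, Polynomial.aeval_def, Polynomial.eval_map]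
  simp_rw [hP, ← Polynomial.eval_mul]
  exact integrable_poly_mul_gaussian _

theorem integrable_he_mul_gaussian (m n : ℕ) :
    Integrable fun x : ℝ => he m (Real.sqrt 2 * x) * he n (Real.sqrt 2 * x) *
      Real.exp (-1 * x ^ 2) := by
  simpa using integrable_eval_he_mul_gaussian 1 m n

/-- Integration by parts: differentiating `He_m(√2 x) Heₙ(√2 x) exp(-x²)` with `He_k'(y) = y He_k(y)
- He_{k+1}(y)`, the derivative of the Gaussian cancels one of the two terms containing `y`. -/
theorem integral_he_succ_mul_gaussian (m n : ℕ) :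
    ∫ x : ℝ, he m (Real.sqrt 2 * x) * he (n + 1) (Real.sqrt 2 * x) * Real.exp (-1 * x ^ 2) =
      ∫ x : ℝ, (Real.sqrt 2 * x * he m (Real.sqrt 2 * x) - he (m + 1) (Real.sqrt 2 * x)) *
        he n (Real.sqrt 2 * x) * Real.exp (-1 * x ^ 2) := by
  have h2 : Real.sqrt 2 * Real.sqrt 2 = 2 := Real.mul_self_sqrt (by norm_num)
  have hint1 := integrable_he_mul_gaussian m (n + 1)
  have hint2 : Integrable fun x : ℝ => (Real.sqrt 2 * x * he m (Real.sqrt 2 * x)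
      - he (m + 1) (Real.sqrt 2 * x)) * he n (Real.sqrt 2 * x) * Real.exp (-1 * x ^ 2) := by
    have h := (integrable_eval_he_mul_gaussian
      (Polynomial.C (Real.sqrt 2) * Polynomial.X) m n).sub (integrable_he_mul_gaussian (m + 1) n)
    refine h.congr (Filter.Eventually.of_forall fun x => ?_)
    simp
    ring
  have hz := integral_eq_zero_of_hasDerivAt_of_integrable
    (f := fun x : ℝ => he m (Real.sqrt 2 * x) * he n (Real.sqrt 2 * x) * Real.exp (-1 * x ^ 2))
    (f' := fun x : ℝ => Real.sqrt 2 * ((Real.sqrt 2 * x * he m (Real.sqrt 2 * x)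
      - he (m + 1) (Real.sqrt 2 * x)) * he n (Real.sqrt 2 * x) * Real.exp (-1 * x ^ 2)
      - he m (Real.sqrt 2 * x) * he (n + 1) (Real.sqrt 2 * x) * Real.exp (-1 * x ^ 2)))
    ?_ ((hint2.sub hint1).const_mul _) (integrable_he_mul_gaussian m n)
  · rw [integral_const_mul, integral_sub hint2 hint1] at hz
    have := (mul_eq_zero.mp hz).resolve_left (by positivity)
    linarith
  · intro x
    have hl : HasDerivAt (fun x : ℝ => Real.sqrt 2 * x) (Real.sqrt 2) x := by
      simpa using (hasDerivAt_id x).const_mul (Real.sqrt 2)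
    have hm := (hasDerivAt_he m (Real.sqrt 2 * x)).comp x hl
    have hn := (hasDerivAt_he n (Real.sqrt 2 * x)).comp x hl
    have hg : HasDerivAt (fun x : ℝ => Real.exp (-1 * x ^ 2))
        (Real.exp (-1 * x ^ 2) * (-1 * (2 * x))) x := by
      have h := ((hasDerivAt_pow 2 x).const_mul (-1 : ℝ)).exp
      simpa using h
    have := (hm.mul hn).mul hg
    refine this.congr_deriv ?_
    simp only [Function.comp, Pi.mul_apply]
    linear_combination (x * he m (Real.sqrt 2 * x) * he n (Real.sqrt 2 * x)
      * Real.exp (-1 * x ^ 2)) * h2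

/-- Induction on `n`: integration by parts moves the raising step to the other factor, where `y
He_{m+1} - He_{m+2} = (m + 1) He_m` lowers both indices. -/
theorem integral_he_mul_he (m n : ℕ) :
    ∫ x : ℝ, he m (Real.sqrt 2 * x) * he n (Real.sqrt 2 * x) * Real.exp (-1 * x ^ 2) =
      if m = n then n.factorial * Real.sqrt Real.pi else 0 := by
  induction n generalizing m with
  | zero =>
    cases m with
    | zero =>
      simp only [he_zero, mul_one, one_mul, if_true, Nat.factorial_zero, Nat.cast_one]
      rw [integral_gaussian]
      simp
    | succ m =>
      have h := integral_he_succ_mul_gaussian 0 m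
      simp only [he_zero, he_one, zero_add, mul_one, one_mul, sub_self, zero_mul,
        integral_zero] at h
      simp only [he_zero, mul_one]
      rw [h]
      simp
  | succ n ih =>
    rw [integral_he_succ_mul_gaussian]
    cases m with
    | zero => simp [he_zero, he_one]
    | succ m =>
      have e : ∀ x : ℝ, (x * he (m + 1) x - he (m + 1 + 1) x) * he n x *
          Real.exp (-1 * (x / Real.sqrt 2) ^ 2) =
          (m + 1) * (he m x * he n x * Real.exp (-1 * (x / Real.sqrt 2) ^ 2)) := by
        intro x
        rw [he_succ_succ]
        ring
      have e' : ∀ x : ℝ, Real.sqrt 2 * x / Real.sqrt 2 = x := fun x => by field_simp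
      have e2 := fun x : ℝ => e (Real.sqrt 2 * x)
      simp only [e'] at e2
      simp_rw [e2]
      rw [integral_const_mul, ih]
      by_cases hmn : m = n
      · subst hmn
        simp [Nat.factorial_succ]
        ring
      · simp [hmn]

theorem integral_hermiteFun_mul (m n : ℕ) :
    ∫ x : ℝ, hermiteFun m x * hermiteFun n x = if m = n then 1 else 0 := by
  have e : ∀ x : ℝ, hermiteFun m x * hermiteFun n x =
      (he m (Real.sqrt 2 * x) * he n (Real.sqrt 2 * x) * Real.exp (-1 * x ^ 2)) *
      (Real.sqrt (m.factorial * Real.sqrt Real.pi) *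
        Real.sqrt (n.factorial * Real.sqrt Real.pi))⁻¹ := by
    intro x
    have he2 : Real.exp (-1 * x ^ 2) = Real.exp (-x ^ 2 / 2) * Real.exp (-x ^ 2 / 2) := by
      rw [← Real.exp_add]
      congr 1
      ring
    rw [hermiteFun_eq, hermiteFun_eq, he2, div_mul_div_comm, div_eq_mul_inv]
    ring
  simp_rw [e]
  rw [integral_mul_const, integral_he_mul_he]
  split_ifs with h
  · subst h
    rw [Real.mul_self_sqrt (by positivity)]
    exact mul_inv_cancel₀ (by positivity)
  · simp

theorem hermiteFun_neg (n : ℕ) (x : ℝ) : hermiteFun n (-x) = (-1) ^ n * hermiteFun n x := by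
  rw [hermiteFun_eq, hermiteFun_eq, mul_neg, he_neg, neg_sq]
  ring

theorem mul_hermiteFun_zero (x : ℝ) :
    x * hermiteFun 0 x = Real.sqrt (((0 : ℕ) + 1 : ℝ) / 2) * hermiteFun 1 x := by
  rw [hermiteFun_eq, hermiteFun_eq, he_zero, he_one]
  have h2 : Real.sqrt 2 ≠ 0 := by positivity
  simp
  field_simp

/-- The normalized three-term recurrence: the position operator is tridiagonal in the number basis.
This turns powers of `x` into photon-number weights. -/
theorem mul_hermiteFun_succ (n : ℕ) (x : ℝ) :
    x * hermiteFun (n + 1) x = Real.sqrt (((n + 1 : ℕ) + 1 : ℝ) / 2) * hermiteFun (n + 2) x +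
      Real.sqrt ((n + 1 : ℕ) / 2) * hermiteFun n x := by
  rw [hermiteFun_eq, hermiteFun_eq, hermiteFun_eq, he_succ_succ, Nat.factorial_succ (n + 1),
    Nat.factorial_succ n]
  push_cast
  have hp : 0 < Real.sqrt Real.pi := by positivity
  have h1 : (0 : ℝ) ≤ (n : ℝ) + 1 := by positivity
  have h3 : (0 : ℝ) ≤ (n : ℝ) + 1 + 1 := by positivity
  rw [mul_assoc ((n : ℝ) + 1 + 1), mul_assoc ((n : ℝ) + 1), Real.sqrt_mul h3, Real.sqrt_mul h1,
    Real.sqrt_div h3, Real.sqrt_div h1]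
  have hf : Real.sqrt ((n.factorial : ℝ) * Real.sqrt Real.pi) ≠ 0 := by positivity
  have hs1 : Real.sqrt ((n : ℝ) + 1) ≠ 0 := by positivity
  have hs3 : Real.sqrt ((n : ℝ) + 1 + 1) ≠ 0 := by positivity
  have h2 : Real.sqrt 2 ≠ 0 := by positivity
  have hq : Real.sqrt ((n : ℝ) + 1) ^ 2 = (n : ℝ) + 1 := Real.sq_sqrt h1
  field_simp
  rw [hq]
  ring

end HermiteFunctions

/-! ## The wave function as a linear isometry -/

section Wave

theorem lintegral_enorm_sq_Lp {X : Type*} [MeasurableSpace X] {μ : Measure X} {E : Type*}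
    [NormedAddCommGroup E] (u : Lp E 2 μ) :
    ∫⁻ x, ‖u x‖ₑ ^ 2 ∂μ = ‖u‖ₑ ^ 2 := by
  rw [Lp.enorm_def, eLpNorm_eq_lintegral_rpow_enorm_toReal (by simp) (by simp)]
  simp only [ENNReal.toReal_ofNat, one_div]
  rw [← ENNReal.rpow_natCast, ← ENNReal.rpow_mul]
  simp

variable {E : Type*} [NormedAddCommGroup E] [InnerProductSpace ℂ E]

/-- The map `v ↦ (x ↦ hₙ(x) v)`. -/
def hermiteEmbed (E : Type*) [NormedAddCommGroup E] [InnerProductSpace ℂ E] (n : ℕ) :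
    E →ₗᵢ[ℂ] Lp E 2 (volume : Measure ℝ) where
  toFun v := (memLp_hermiteFun_smul n v).toLp _
  map_add' v w := by
    rw [← MemLp.toLp_add]
    exact MemLp.toLp_congr _ _ (Filter.Eventually.of_forall fun x => by simp)
  map_smul' c v := by
    rw [RingHom.id_apply, ← MemLp.toLp_const_smul]
    exact MemLp.toLp_congr _ _ (Filter.Eventually.of_forall fun x => by simp [smul_comm c])
  norm_map' v := by
    have h : ‖(memLp_hermiteFun_smul n v).toLp _‖ₑ ^ 2 = ‖v‖ₑ ^ 2 := by
      rw [← lintegral_enorm_sq_Lp]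
      have e : ∀ᵐ x : ℝ, ‖(memLp_hermiteFun_smul n v).toLp _ x‖ₑ ^ 2
          = ENNReal.ofReal (hermiteFun n x * hermiteFun n x) * ‖v‖ₑ ^ 2 := by
        filter_upwards [(memLp_hermiteFun_smul n v).coeFn_toLp] with x hx
        rw [hx, enorm_smul, mul_pow]
        congr 1
        rw [← sq, ← sq_abs, ENNReal.ofReal_pow (abs_nonneg _), ← Real.norm_eq_abs,
          ofReal_norm, ← enorm_norm, Complex.norm_real, enorm_norm]
      have hi : Integrable fun x => hermiteFun n x * hermiteFun n x := by
        simpa [sq] using (memLp_hermiteFun n).integrable_sq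
      rw [lintegral_congr_ae e, lintegral_mul_const' _ _ (by simp),
        ← ofReal_integral_eq_lintegral_ofReal hi
        (Filter.Eventually.of_forall fun x => mul_self_nonneg _), integral_hermiteFun_mul]
      simp
    have h2 := congrArg ENNReal.toReal h
    simp only [ENNReal.toReal_pow, toReal_enorm] at h2
    exact (pow_left_inj₀ (norm_nonneg _) (norm_nonneg _) two_ne_zero).mp h2

theorem hermiteEmbed_apply (n : ℕ) (v : E) :
    hermiteEmbed E n v = (memLp_hermiteFun_smul n v).toLp _ := rfl

theorem coeFn_hermiteEmbed (n : ℕ) (v : E) :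
    hermiteEmbed E n v =ᵐ[volume] fun x => ((hermiteFun n x : ℝ) : ℂ) • v :=
  (memLp_hermiteFun_smul n v).coeFn_toLp

theorem orthogonalFamily_hermiteEmbed : OrthogonalFamily ℂ (fun _ : ℕ => E) (hermiteEmbed E) := by
  intro m n hmn v w
  rw [L2.inner_def]
  have e : ∀ᵐ x : ℝ, ⟪hermiteEmbed E m v x, hermiteEmbed E n w x⟫_ℂ
      = ((hermiteFun m x * hermiteFun n x : ℝ) : ℂ) * ⟪v, w⟫_ℂ := by
    filter_upwards [coeFn_hermiteEmbed m v, coeFn_hermiteEmbed n w] with x h1 h2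
    rw [h1, h2, inner_smul_left, inner_smul_right, Complex.conj_ofReal]
    push_cast
    ring
  rw [integral_congr_ae e, integral_mul_const, integral_complex_ofReal, integral_hermiteFun_mul,
    if_neg hmn]
  simp

/-- Multiplication by a function is a closed operator on `L²`. -/
theorem ae_eq_smul_of_tendsto {X : Type*} [MeasurableSpace X] {μ : Measure X}
    {u v : ℕ → Lp E 2 μ} {u' v' : Lp E 2 μ} (g : X → ℂ)
    (hu : Filter.Tendsto u Filter.atTop (nhds u')) (hv : Filter.Tendsto v Filter.atTop (nhds v'))
    (h : ∀ n, v n =ᵐ[μ] fun x => g x • u n x) : v' =ᵐ[μ] fun x => g x • u' x := by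
  -- Convergence in `L²` yields almost everywhere convergence only along a subsequence; extracting
  -- twice gives one subsequence for both limits.
  obtain ⟨φ, hφ, h1⟩ := (tendstoInMeasure_of_tendsto_Lp hu).exists_seq_tendsto_ae
  obtain ⟨ψ, hψ, h2⟩ :=
    (tendstoInMeasure_of_tendsto_Lp (hv.comp hφ.tendsto_atTop)).exists_seq_tendsto_ae
  filter_upwards [h1, h2, ae_all_iff.mpr h] with x hx1 hx2 hx
  have h3 := (hx1.comp hψ.tendsto_atTop).const_smul (g x)
  refine tendsto_nhds_unique hx2 (h3.congr fun n => ?_)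
  simp [hx]

/-- The action of the position operator on the components in the number basis. -/
def positionCoeff (Φ : ℕ → E) (n : ℕ) : E :=
  ((Real.sqrt (n / 2) : ℝ) : ℂ) • Φ (n - 1) + ((Real.sqrt ((n + 1) / 2) : ℝ) : ℂ) • Φ (n + 1)

/-- The recurrence summed by parts. Finite support removes the boundary term and the result reaches
one level higher; at `n = 0` the term in `Φ (n - 1)` has coefficient `√0`. -/
theorem smul_sum_hermiteFun (Φ : ℕ → E) (N : ℕ) (hΦ : ∀ n, N ≤ n → Φ n = 0) (x : ℝ) :
    ∑ n ∈ Finset.range (N + 1), ((hermiteFun n x : ℝ) : ℂ) • positionCoeff Φ n =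
      (x : ℂ) • ∑ n ∈ Finset.range N, ((hermiteFun n x : ℝ) : ℂ) • Φ n := by
  simp only [positionCoeff, smul_add, Finset.sum_add_distrib]
  rw [Finset.sum_range_succ' (fun n => ((hermiteFun n x : ℝ) : ℂ) •
    ((Real.sqrt (n / 2) : ℝ) : ℂ) • Φ (n - 1))]
  rw [Finset.sum_range_succ (fun n => ((hermiteFun n x : ℝ) : ℂ) •
    ((Real.sqrt ((n + 1) / 2) : ℝ) : ℂ) • Φ (n + 1)), hΦ (N + 1) (by omega)]
  simp only [Nat.cast_zero, zero_div, Real.sqrt_zero, Complex.ofReal_zero, zero_smul, smul_zero,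
    add_zero, Nat.add_sub_cancel]
  rw [Finset.smul_sum]
  cases N with
  | zero => simp
  | succ N =>
    rw [Finset.sum_range_succ (fun n => ((hermiteFun n x : ℝ) : ℂ) •
      ((Real.sqrt ((n + 1) / 2) : ℝ) : ℂ) • Φ (n + 1)), hΦ (N + 1) le_rfl, smul_zero, smul_zero,
      add_zero, Finset.sum_range_succ', Finset.sum_range_succ' (fun n => (x : ℂ) • _),
      add_right_comm, ← Finset.sum_add_distrib]
    congr 1
    · refine Finset.sum_congr rfl fun n _ => ?_
      simp only [smul_smul, ← add_smul]
      congr 1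
      have h := mul_hermiteFun_succ n x
      rw [← Complex.ofReal_mul x, h]
      push_cast
      ring_nf
    · simp only [smul_smul]
      congr 1
      have h := mul_hermiteFun_zero x
      rw [← Complex.ofReal_mul x, h]
      push_cast
      ring_nf

theorem enorm_positionCoeff_sq_le (Φ : ℕ → E) (n : ℕ) :
    ‖positionCoeff Φ n‖ₑ ^ 2 ≤ n * ‖Φ (n - 1)‖ₑ ^ 2 + (n + 1) * ‖Φ (n + 1)‖ₑ ^ 2 := by
  have h : ‖positionCoeff Φ n‖ ^ 2 ≤ n * ‖Φ (n - 1)‖ ^ 2 + (n + 1) * ‖Φ (n + 1)‖ ^ 2 := by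
    have h1 : ‖positionCoeff Φ n‖ ≤ Real.sqrt (n / 2) * ‖Φ (n - 1)‖ +
        Real.sqrt ((n + 1) / 2) * ‖Φ (n + 1)‖ := by
      refine (norm_add_le _ _).trans (le_of_eq ?_)
      rw [norm_smul, norm_smul, Complex.norm_real, Complex.norm_real, Real.norm_eq_abs,
        Real.norm_eq_abs, abs_of_nonneg (Real.sqrt_nonneg _), abs_of_nonneg (Real.sqrt_nonneg _)]
    refine (pow_le_pow_left₀ (norm_nonneg _) h1 2).trans ((add_sq_le).trans (le_of_eq ?_))
    rw [mul_pow, mul_pow, Real.sq_sqrt (by positivity), Real.sq_sqrt (by positivity)]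
    ring
  have h' := ENNReal.ofReal_le_ofReal h
  rw [ENNReal.ofReal_add (by positivity) (by positivity), ENNReal.ofReal_mul (by positivity),
    ENNReal.ofReal_mul (by positivity), ENNReal.ofReal_pow (norm_nonneg _),
    ENNReal.ofReal_pow (norm_nonneg _), ENNReal.ofReal_pow (norm_nonneg _),
    ENNReal.ofReal_add (by positivity) zero_le_one] at h'
  simpa [ofReal_norm] using h'

/-- A general weight `a` lets the estimate be iterated: the weight produced by one application of
the position operator is the input for the next. -/
theorem tsum_weight_positionCoeff_le (a : ℕ → ℝ≥0∞) (Φ : ℕ → E) :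
    ∑' n, a n * ‖positionCoeff Φ n‖ₑ ^ 2 ≤
      ∑' n, (a (n + 1) * (n + 1) + a (n - 1) * n) * ‖Φ n‖ₑ ^ 2 := by
  calc ∑' n, a n * ‖positionCoeff Φ n‖ₑ ^ 2
      ≤ ∑' n, (a n * (n * ‖Φ (n - 1)‖ₑ ^ 2) + a n * ((n + 1) * ‖Φ (n + 1)‖ₑ ^ 2)) := by
        refine ENNReal.tsum_le_tsum fun n => ?_
        rw [← mul_add]
        gcongr
        exact enorm_positionCoeff_sq_le Φ n
    _ = ∑' n, a (n + 1) * ((n + 1) * ‖Φ n‖ₑ ^ 2) + ∑' n, a (n - 1) * (n * ‖Φ n‖ₑ ^ 2) := by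
        rw [ENNReal.tsum_add]
        congr 1
        · rw [tsum_eq_zero_add' ENNReal.summable]
          simp
        · conv_rhs => rw [tsum_eq_zero_add' ENNReal.summable]
          simp
    _ = _ := by
        rw [← ENNReal.tsum_add]
        refine tsum_congr fun n => ?_
        ring

theorem tsum_positionCoeff_positionCoeff_le (Φ : ℕ → E) :
    ∑' n, ‖positionCoeff (positionCoeff Φ) n‖ₑ ^ 2 ≤
      4 * ∑' n : ℕ, ((n : ℝ≥0∞) + 1) ^ 2 * ‖Φ n‖ₑ ^ 2 := by
  have h1 := tsum_weight_positionCoeff_le (fun _ => 1) (positionCoeff Φ)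
  have h2 := tsum_weight_positionCoeff_le (fun n => 1 * ((n : ℝ≥0∞) + 1) + 1 * n) Φ
  simp only [one_mul] at h1 h2
  refine h1.trans (h2.trans ?_)
  rw [← ENNReal.tsum_mul_left]
  refine ENNReal.tsum_le_tsum fun n => ?_
  rw [← mul_assoc]
  gcongr
  have : (((n + 1 : ℕ) : ℝ≥0∞) + 1 + (n + 1 : ℕ)) * (n + 1) +
      (((n - 1 : ℕ) : ℝ≥0∞) + 1 + (n - 1 : ℕ)) * n
      = ((((n + 1) + 1 + (n + 1)) * (n + 1) + ((n - 1) + 1 + (n - 1)) * n : ℕ) : ℝ≥0∞) := by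
    push_cast
    ring
  rw [this]
  have h4 : (4 : ℝ≥0∞) * ((n : ℝ≥0∞) + 1) ^ 2 = ((4 * (n + 1) ^ 2 : ℕ) : ℝ≥0∞) := by push_cast; rfl
  rw [h4, Nat.cast_le]
  rcases n with _ | n
  · norm_num
  · simp only [Nat.add_sub_cancel]
    nlinarith

theorem lintegral_sum_hermiteFun (Φ : ℕ → E) (N : ℕ) :
    ∫⁻ x : ℝ, ‖∑ n ∈ Finset.range N, ((hermiteFun n x : ℝ) : ℂ) • Φ n‖ₑ ^ 2 =
      ∑ n ∈ Finset.range N, ‖Φ n‖ₑ ^ 2 := by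
  have h := lintegral_enorm_sq_Lp (∑ n ∈ Finset.range N, hermiteEmbed E n (Φ n))
  have e : ∀ᵐ x : ℝ, (∑ n ∈ Finset.range N, hermiteEmbed E n (Φ n)) x =
      ∑ n ∈ Finset.range N, ((hermiteFun n x : ℝ) : ℂ) • Φ n := by
    have h1 := Lp.coeFn_finsetSum (Finset.range N) (fun n => hermiteEmbed E n (Φ n))
    filter_upwards [h1, ae_all_iff.mpr fun n => coeFn_hermiteEmbed n (Φ n)] with x hx hx2
    rw [hx]
    simp [hx2]
  have e2 : ∀ᵐ x : ℝ, ‖(∑ n ∈ Finset.range N, hermiteEmbed E n (Φ n)) x‖ₑ ^ 2 =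
      ‖∑ n ∈ Finset.range N, ((hermiteFun n x : ℝ) : ℂ) • Φ n‖ₑ ^ 2 := by
    filter_upwards [e] with x hx
    rw [hx]
  rw [← lintegral_congr_ae e2, h]
  have h3 := (orthogonalFamily_hermiteEmbed (E := E)).norm_sum Φ (Finset.range N)
  rw [← ofReal_norm, ← ENNReal.ofReal_pow (norm_nonneg _), h3,
    ENNReal.ofReal_sum_of_nonneg fun _ _ => by positivity]
  refine Finset.sum_congr rfl fun n _ => ?_
  rw [ENNReal.ofReal_pow (norm_nonneg _), ofReal_norm]

/-- For truncated vectors multiplication by `x²` is two exact applications of `positionCoeff`. The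
bound does not depend on `N`, as Fatou's lemma will require. -/
theorem lintegral_sq_smul_sum_hermiteFun_le (Φ : ℕ → E) (N : ℕ) :
    ∫⁻ x : ℝ, ‖((x : ℂ) ^ 2) • ∑ n ∈ Finset.range N, ((hermiteFun n x : ℝ) : ℂ) • Φ n‖ₑ ^ 2 ≤
      4 * ∑' n : ℕ, ((n : ℝ≥0∞) + 1) ^ 2 * ‖Φ n‖ₑ ^ 2 := by
  set Ψ : ℕ → E := fun n => if n < N then Φ n else 0 with hΨ
  have hΨ0 : ∀ n, N ≤ n → Ψ n = 0 := fun n hn => by simp [hΨ, hn]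
  have hΨ1 : ∀ n, N + 1 ≤ n → positionCoeff Ψ n = 0 := fun n hn => by
    simp [positionCoeff, hΨ0 (n - 1) (by omega), hΨ0 (n + 1) (by omega)]
  have e : ∀ x : ℝ, ((x : ℂ) ^ 2) • ∑ n ∈ Finset.range N, ((hermiteFun n x : ℝ) : ℂ) • Φ n
      = ∑ n ∈ Finset.range (N + 1 + 1), ((hermiteFun n x : ℝ) : ℂ) •
        positionCoeff (positionCoeff Ψ) n := by
    intro x
    rw [smul_sum_hermiteFun _ _ hΨ1, smul_sum_hermiteFun _ _ hΨ0, smul_smul, ← sq]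
    congr 1
    refine Finset.sum_congr rfl fun n hn => ?_
    simp [hΨ, Finset.mem_range.mp hn]
  simp_rw [e]
  rw [lintegral_sum_hermiteFun]
  refine (ENNReal.sum_le_tsum _).trans ((tsum_positionCoeff_positionCoeff_le Ψ).trans ?_)
  gcongr with n
  by_cases hn : n < N <;> simp [hΨ, hn]

variable [CompleteSpace E]

/-- The position representation of the vectors of `ℓ²(ℕ; E)`. -/
def waveIsometry (E : Type*) [NormedAddCommGroup E] [InnerProductSpace ℂ E] [CompleteSpace E] :
    ModeTensor E →ₗᵢ[ℂ] Lp E 2 (volume : Measure ℝ) :=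
  (orthogonalFamily_hermiteEmbed (E := E)).linearIsometry

theorem hasSum_wave (Φ : ModeTensor E) :
    HasSum (fun n => hermiteEmbed E n (Φ n)) (waveIsometry E Φ) :=
  orthogonalFamily_hermiteEmbed.hasSum_linearIsometry Φ

/-- The fourth moment of the position is bounded by the second moment of the photon number. -/
theorem lintegral_sq_smul_wave_le (Φ : ModeTensor E) :
    ∫⁻ x : ℝ, ‖((x : ℂ) ^ 2) • waveIsometry E Φ x‖ₑ ^ 2 ≤
      4 * ∑' n : ℕ, ((n : ℝ≥0∞) + 1) ^ 2 * ‖Φ n‖ₑ ^ 2 := by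
  have h1 := (hasSum_wave Φ).tendsto_sum_nat
  obtain ⟨φ, hφ, h2⟩ := (tendstoInMeasure_of_tendsto_Lp h1).exists_seq_tendsto_ae
  have e : ∀ᵐ x : ℝ, ∀ N, (∑ n ∈ Finset.range N, hermiteEmbed E n (Φ n)) x =
      ∑ n ∈ Finset.range N, ((hermiteFun n x : ℝ) : ℂ) • Φ n := by
    refine ae_all_iff.mpr fun N => ?_
    have h1 := Lp.coeFn_finsetSum (Finset.range N) (fun n => hermiteEmbed E n (Φ n))
    filter_upwards [h1, ae_all_iff.mpr fun n => coeFn_hermiteEmbed n (Φ n)] with x hx hx2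
    rw [hx]
    simp [hx2]
  -- Fatou along a subsequence of the partial sums that converges almost everywhere; finiteness of
  -- the fourth moment is not known beforehand.
  calc ∫⁻ x : ℝ, ‖((x : ℂ) ^ 2) • waveIsometry E Φ x‖ₑ ^ 2
      ≤ ∫⁻ x : ℝ, Filter.liminf (fun N => ‖((x : ℂ) ^ 2) • ∑ n ∈ Finset.range (φ N),
          ((hermiteFun n x : ℝ) : ℂ) • Φ n‖ₑ ^ 2) Filter.atTop := by
        refine lintegral_mono_ae ?_
        filter_upwards [h2, e] with x hx hx2
        simp only [hx2] at hx
        have h3 := ENNReal.Tendsto.pow (n := 2) ((hx.const_smul ((x : ℂ) ^ 2)).enorm)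
        exact h3.liminf_eq.ge
    _ ≤ Filter.liminf (fun N => ∫⁻ x : ℝ, ‖((x : ℂ) ^ 2) • ∑ n ∈ Finset.range (φ N),
          ((hermiteFun n x : ℝ) : ℂ) • Φ n‖ₑ ^ 2) Filter.atTop := by
        refine lintegral_liminf_le fun N => ?_
        refine (Continuous.measurable ?_)
        refine ENNReal.continuous_pow 2 |>.comp (continuous_enorm.comp ?_)
        refine Continuous.smul (by fun_prop) (continuous_finsetSum _ fun n _ => ?_)
        have := continuous_hermiteFun n
        fun_prop
    _ ≤ _ := by
        refine Filter.liminf_le_of_frequently_le' (Filter.Frequently.of_forall fun N => ?_)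
        exact lintegral_sq_smul_sum_hermiteFun_le _ _

/-- A parity flip of the mode reflects the wave function. -/
theorem wave_parity (Φ Ψ : ModeTensor E) (h : ∀ n, Ψ n = ((-1 : ℂ) ^ n) • Φ n) :
    waveIsometry E Ψ =ᵐ[volume] fun x => waveIsometry E Φ (-x) := by
  have hmp := Measure.measurePreserving_neg (volume : Measure ℝ)
  let T : Lp E 2 (volume : Measure ℝ) →ₗᵢ[ℂ] Lp E 2 (volume : Measure ℝ) :=
    Lp.compMeasurePreservingₗᵢ ℂ (Neg.neg : ℝ → ℝ) hmp
  have h1 : HasSum (fun n => T (hermiteEmbed E n (Φ n))) (T (waveIsometry E Φ)) :=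
    (hasSum_wave Φ).mapL T.toContinuousLinearMap
  have h2 : ∀ n, T (hermiteEmbed E n (Φ n)) = hermiteEmbed E n (Ψ n) := by
    intro n
    change Lp.compMeasurePreserving _ hmp _ = _
    rw [hermiteEmbed_apply, Lp.toLp_compMeasurePreserving, hermiteEmbed_apply]
    refine MemLp.toLp_congr _ _ (Filter.Eventually.of_forall fun x => ?_)
    simp only [Function.comp, hermiteFun_neg, h n]
    rw [smul_smul]
    push_cast
    ring_nf
  simp_rw [h2] at h1
  rw [(hasSum_wave Ψ).unique h1]
  exact Lp.coeFn_compMeasurePreserving _ hmp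

end Wave

/-! ## Geometric mixtures of number states -/

section Geometric

theorem norm_fock (n : ℕ) : ‖fock n‖ = 1 := by
  simp [fock, lp.norm_single]

theorem inner_fock (n : ℕ) (φ : Mode) : ⟪fock n, φ⟫_ℂ = φ n := by
  rw [fock, lp.inner_single_left]
  simp

theorem fock_apply (n i : ℕ) : (fock n : Mode) i = if i = n then 1 else 0 := by
  simp [fock, lp.single_apply, Pi.single_apply]

/-- The density operator `∑ᵢ (1 - s) sⁱ |i⟩⟨i|`. -/
def geometricState (s : ℝ) : Mode →L[ℂ] Mode :=
  ∑' i : ℕ, (((1 - s) * s ^ i : ℝ) : ℂ) • InnerProductSpace.rankOne ℂ (fock i) (fock i)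

theorem summable_geometricWeight {s : ℝ} (h0 : 0 < s) (h1 : s < 1) : Summable fun i : ℕ => (1 - s)
    * s ^ i :=
  (summable_geometric_of_lt_one h0.le h1).mul_left _

theorem geometricWeight_nonneg {s : ℝ} (h0 : 0 < s) (h1 : s < 1) (i : ℕ) : 0 ≤ (1 - s) * s ^ i :=
  mul_nonneg (by linarith) (by positivity)

theorem hasSum_inner_geometricState {s : ℝ} (h0 : 0 < s) (h1 : s < 1) (φ ψ : Mode) :
    HasSum (fun i => (((1 - s) * s ^ i : ℝ) : ℂ) * (⟪φ, fock i⟫_ℂ * ⟪fock i, ψ⟫_ℂ))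
      ⟪φ, geometricState s ψ⟫_ℂ := by
  have hs : Summable fun i : ℕ =>
      (((1 - s) * s ^ i : ℝ) : ℂ) • InnerProductSpace.rankOne ℂ (fock i) (fock i) := by
    refine Summable.of_norm ?_
    refine (summable_geometricWeight h0 h1).congr fun i => ?_
    rw [norm_smul, InnerProductSpace.norm_rankOne, norm_fock, Complex.norm_real, Real.norm_eq_abs,
      abs_of_nonneg (geometricWeight_nonneg h0 h1 i)]
    simp
  have h := hs.hasSum.mapL ((innerSL ℂ φ).comp (ContinuousLinearMap.apply ℂ Mode ψ))
  refine (h.congr_fun ?_)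
  intro i
  simp [mul_comm]

theorem hasSum_inner_geometricState_self {s : ℝ} (h0 : 0 < s) (h1 : s < 1) (φ : Mode) :
    HasSum (fun i => (1 - s) * s ^ i * ‖⟪fock i, φ⟫_ℂ‖ ^ 2)
      (⟪φ, geometricState s φ⟫_ℂ).re := by
  have h := Complex.hasSum_re (hasSum_inner_geometricState h0 h1 φ φ)
  refine h.congr_fun fun i => ?_
  rw [← inner_conj_symm φ (fock i), Complex.conj_mul', Complex.re_ofReal_mul, ← Complex.ofReal_pow,
    Complex.ofReal_re]

theorem ofReal_inner_geometricState_self {s : ℝ} (h0 : 0 < s) (h1 : s < 1) (φ : Mode) :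
    ENNReal.ofReal (⟪φ, geometricState s φ⟫_ℂ).re =
      ∑' i, ENNReal.ofReal ((1 - s) * s ^ i) * ‖⟪fock i, φ⟫_ℂ‖ₑ ^ 2 := by
  have h := hasSum_inner_geometricState_self h0 h1 φ
  rw [← h.tsum_eq, ENNReal.ofReal_tsum_of_nonneg _ h.summable]
  · refine tsum_congr fun i => ?_
    rw [ENNReal.ofReal_mul (geometricWeight_nonneg h0 h1 i), ENNReal.ofReal_pow (norm_nonneg _),
      ofReal_norm]
  · exact fun i => mul_nonneg (geometricWeight_nonneg h0 h1 i) (by positivity)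

theorem geometricState_isPositive {s : ℝ} (h0 : 0 < s) (h1 : s < 1) : (geometricState s).IsPositive
    := by
  rw [ContinuousLinearMap.isPositive_iff_complex]
  intro φ
  have h := hasSum_inner_geometricState h0 h1 φ φ
  have h2 := hasSum_inner_geometricState_self h0 h1 φ
  have h3 : ⟪φ, geometricState s φ⟫_ℂ = ((⟪φ, geometricState s φ⟫_ℂ).re : ℂ) := by
    refine h.unique ((Complex.hasSum_ofReal.mpr h2).congr_fun fun i => ?_)
    rw [← inner_conj_symm φ (fock i), Complex.conj_mul']
    push_cast
    rfl
  have h4 : 0 ≤ (⟪φ, geometricState s φ⟫_ℂ).re := h2.nonneg fun i =>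
    mul_nonneg (geometricWeight_nonneg h0 h1 i) (by positivity)
  have h5 : ⟪geometricState s φ, φ⟫_ℂ = ⟪φ, geometricState s φ⟫_ℂ := by
    rw [← inner_conj_symm, h3, Complex.conj_ofReal]
  rw [h5]
  exact ⟨h3.symm, h4⟩

theorem inner_fock_geometricState {s : ℝ} (h0 : 0 < s) (h1 : s < 1) (n : ℕ) :
    (⟪fock n, geometricState s (fock n)⟫_ℂ).re = (1 - s) * s ^ n := by
  refine (hasSum_inner_geometricState_self h0 h1 (fock n)).unique ?_
  have := hasSum_ite_eq n ((1 - s) * s ^ n)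
  refine this.congr_fun fun i => ?_
  rw [inner_fock, fock_apply]
  split_ifs with h
  · simp [h]
  · simp

theorem geometricState_isDensity {s : ℝ} (h0 : 0 < s) (h1 : s < 1) : IsDensity (geometricState s)
    := by
  refine ⟨geometricState_isPositive h0 h1, ?_⟩
  simp_rw [inner_fock_geometricState h0 h1]
  rw [← ENNReal.ofReal_tsum_of_nonneg (geometricWeight_nonneg h0 h1)
    (summable_geometricWeight h0 h1), tsum_mul_left, tsum_geometric_of_lt_one h0.le h1,
    mul_inv_cancel₀ (by linarith), ENNReal.ofReal_one]

theorem photonMoment_geometricState_lt_top {s : ℝ} (h0 : 0 < s) (h1 : s < 1) (k : ℕ) : photonMoment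
    (geometricState s) k < ∞ := by
  unfold photonMoment
  simp_rw [inner_fock_geometricState h0 h1]
  have hs : Summable fun n : ℕ => (n : ℝ) ^ k * ((1 - s) * s ^ n) := by
    have := (summable_pow_mul_geometric_of_norm_lt_one k
      (by rwa [Real.norm_eq_abs, abs_of_pos h0] : ‖s‖ < 1)).mul_left (1 - s)
    exact this.congr fun n => by ring
  have e : ∀ n : ℕ, (n : ℝ≥0∞) ^ k * ENNReal.ofReal ((1 - s) * s ^ n) =
      ENNReal.ofReal ((n : ℝ) ^ k * ((1 - s) * s ^ n)) := by
    intro n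
    rw [ENNReal.ofReal_mul (p := (n : ℝ) ^ k) (by positivity), ENNReal.ofReal_pow (by positivity),
      ENNReal.ofReal_natCast]
  simp_rw [e]
  exact hs.tsum_ofReal_lt_top

/-! ### Output photon-number moments for geometric and number inputs -/

variable {E : Type*} [NormedAddCommGroup E] [InnerProductSpace ℂ E] [CompleteSpace E]

theorem inner_adjoint_fockTensor (U : Mode →ₗᵢ[ℂ] ModeTensor E) (i n : ℕ) (v : E) :
    ⟪fock i, ContinuousLinearMap.adjoint U.toContinuousLinearMap (fockTensor n v)⟫_ℂ =
      ⟪(U (fock i) : ModeTensor E) n, v⟫_ℂ := by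
  rw [ContinuousLinearMap.adjoint_inner_right, fockTensor, lp.inner_single_right]
  rfl

theorem tsum_enorm_inner_sq {E : Type*} [NormedAddCommGroup E] [InnerProductSpace ℂ E] {ι : Type*}
    (b : HilbertBasis ι ℂ E) (v : E) :
    ∑' j, ‖⟪v, b j⟫_ℂ‖ₑ ^ 2 = ‖v‖ₑ ^ 2 := by
  have h := Complex.hasSum_re (b.hasSum_inner_mul_inner v v)
  have e : ∀ j, (⟪v, b j⟫_ℂ * ⟪b j, v⟫_ℂ).re = ‖⟪v, b j⟫_ℂ‖ ^ 2 := by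
    intro j
    rw [← inner_conj_symm (b j) v, Complex.mul_conj', ← Complex.ofReal_pow, Complex.ofReal_re]
  simp_rw [e] at h
  have h2 : (⟪v, v⟫_ℂ).re = ‖v‖ ^ 2 := by
    rw [inner_self_eq_norm_sq_to_K]
    exact_mod_cast Complex.ofReal_re _
  rw [h2] at h
  rw [← ofReal_norm v, ← ENNReal.ofReal_pow (norm_nonneg _), ← h.tsum_eq,
    ENNReal.ofReal_tsum_of_nonneg (fun _ => by positivity) h.summable]
  refine tsum_congr fun j => ?_
  rw [ENNReal.ofReal_pow (norm_nonneg _), ofReal_norm]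

/-- The input is diagonal, so the output moment is the same mixture of the moments for number
inputs. Tonelli isolates the sum over the basis of `E`, which Parseval evaluates. -/
theorem outputPhotonMoment_geometricState {s : ℝ} (h0 : 0 < s) (h1 : s < 1)
    (U : Mode →ₗᵢ[ℂ] ModeTensor E) (k : ℕ) :
    outputPhotonMoment U (geometricState s) k = ∑' i, ENNReal.ofReal ((1 - s) * s ^ i) *
      ∑' n : ℕ, (n : ℝ≥0∞) ^ k * ‖(U (fock i) : ModeTensor E) n‖ₑ ^ 2 := by
  have hj : ∀ (n : ℕ) (v : E), jointDiag U (geometricState s) n v =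
      ∑' i, ENNReal.ofReal ((1 - s) * s ^ i) * ‖⟪(U (fock i) : ModeTensor E) n, v⟫_ℂ‖ₑ ^ 2 := by
    intro n v
    rw [jointDiag, ← ContinuousLinearMap.adjoint_inner_left,
      ofReal_inner_geometricState_self h0 h1]
    simp_rw [inner_adjoint_fockTensor]
  unfold outputPhotonMoment
  simp_rw [hj]
  have h2 : ∀ n : ℕ, ∑' j, ∑' i, ENNReal.ofReal ((1 - s) * s ^ i) *
      ‖⟪(U (fock i) : ModeTensor E) n, traceBasis E j⟫_ℂ‖ₑ ^ 2 =
      ∑' i, ENNReal.ofReal ((1 - s) * s ^ i) * ‖(U (fock i) : ModeTensor E) n‖ₑ ^ 2 := by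
    intro n
    rw [ENNReal.tsum_comm]
    simp_rw [ENNReal.tsum_mul_left, tsum_enorm_inner_sq]
  simp_rw [h2, ← ENNReal.tsum_mul_left]
  rw [ENNReal.tsum_comm]
  refine tsum_congr fun i => tsum_congr fun n => ?_
  ring

/-- The second moments of the photon number at the output for number states at the input grow
subexponentially. -/
theorem tsum_photonMoment_fock_lt_top {s : ℝ} (h0 : 0 < s) (h1 : s < 1)
    {U : Mode →ₗᵢ[ℂ] ModeTensor E} (hU : IsAdmissible U) :
    ∑' i : ℕ, ENNReal.ofReal (s ^ i) *
      ∑' n : ℕ, (n : ℝ≥0∞) ^ 2 * ‖(U (fock i) : ModeTensor E) n‖ₑ ^ 2 < ∞ := by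
  -- A single state with `s` arbitrarily close to `1` controls all number inputs at once.
  have h := hU.second _ (geometricState_isDensity h0 h1)
    (photonMoment_geometricState_lt_top h0 h1 2)
  rw [outputPhotonMoment_geometricState h0 h1] at h
  simp_rw [ENNReal.ofReal_mul (show 0 ≤ 1 - s by linarith), mul_assoc] at h
  rw [ENNReal.tsum_mul_left] at h
  have hne : ENNReal.ofReal (1 - s) ≠ 0 := by
    simp only [ne_eq, ENNReal.ofReal_eq_zero, not_le]
    linarith
  exact ENNReal.lt_top_of_mul_ne_top_right h.ne hne

end Geometric

/-! ## The conditional laws of the homodyne outcome -/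

section Conditional

variable {E : Type*} [NormedAddCommGroup E] [InnerProductSpace ℂ E]

/-- The phase rotation multiplying the component along `|n⟩` by `i^(k n)`. -/
def phaseTwist (E : Type*) [NormedAddCommGroup E] [InnerProductSpace ℂ E] (k : ℕ) :
    ModeTensor E →ₗᵢ[ℂ] ModeTensor E where
  toFun Φ := ⟨fun n => (Complex.I ^ (k * n)) • Φ n, by
    refine (lp.memℓp Φ).mono' fun n => ?_
    simp [norm_smul]⟩
  map_add' Φ Ψ := by
    ext n
    exact smul_add _ _ _
  map_smul' c Φ := by
    ext n
    exact smul_comm _ _ _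
  norm_map' Φ := by
    rw [lp.norm_eq_tsum_rpow (by simp), lp.norm_eq_tsum_rpow (by simp)]
    simp [norm_smul]

theorem phaseTwist_apply (k : ℕ) (Φ : ModeTensor E) (n : ℕ) :
    phaseTwist E k Φ n = (Complex.I ^ (k * n)) • Φ n := rfl

theorem coherent_apply (α : ℂ) (n : ℕ) : coherent α n = coherentAmp α n := rfl

theorem coherentAmp_mul_phase (α : ℂ) (k n : ℕ) :
    coherentAmp (α * (-Complex.I) ^ k) n = (-Complex.I) ^ (k * n) * coherentAmp α n := by
  simp only [coherentAmp, mul_pow, norm_mul, norm_pow, norm_neg, Complex.norm_I, one_pow, mul_one,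
    ← pow_mul]
  ring

variable [CompleteSpace E]

/-- The joint wave function of the output of the `k`-th branch of the symmetrized channel. -/
def branch (U : Mode →ₗᵢ[ℂ] ModeTensor E) (k : ℕ) :
    Mode →ₗᵢ[ℂ] Lp E 2 (volume : Measure ℝ) :=
  (waveIsometry E).comp ((phaseTwist E k).comp U)

/-- The wave function of the output of the `k`-th branch for the number state `|i⟩`, with the phase
from the rotation at the input. -/
def branchVec (U : Mode →ₗᵢ[ℂ] ModeTensor E) (k i : ℕ) : Lp E 2 (volume : Measure ℝ) :=
  ((-Complex.I) ^ (k * i)) • branch U k (fock i)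

/-- The wave function of the output of the `k`-th branch for the coherent state `|α⟩`. -/
def branchCoherent (U : Mode →ₗᵢ[ℂ] ModeTensor E) (k : ℕ) (α : ℂ) :
    Lp E 2 (volume : Measure ℝ) :=
  branch U k (coherent (α * (-Complex.I) ^ k))

theorem bobLaw_eq (U : Mode →ₗᵢ[ℂ] ModeTensor E) (α : ℂ) :
    bobLaw U α = ∑ k ∈ Finset.range 4, (1 / 4 : ℝ≥0∞) •
      (volume : Measure ℝ).withDensity fun x => ‖branchCoherent U k α x‖ₑ ^ 2 := by
  unfold bobLaw homodyneLaw
  refine Finset.sum_congr rfl fun k _ => ?_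
  congr 2
  ext x
  rw [ENNReal.ofReal_pow (norm_nonneg _), ofReal_norm]
  rfl

/-- The input rotation is a phase on each number state; placed in `branchVec`, it leaves the
amplitudes of `α` itself as coefficients in every branch. -/
theorem hasSum_branchCoherent (U : Mode →ₗᵢ[ℂ] ModeTensor E) (k : ℕ) (α : ℂ) :
    HasSum (fun i => coherentAmp α i • branchVec U k i) (branchCoherent U k α) := by
  have h := (lp.hasSum_single (p := 2) (by simp)
    (coherent (α * (-Complex.I) ^ k))).mapL (branch U k).toContinuousLinearMap
  refine h.congr_fun fun i => ?_
  have e : lp.single 2 i ((coherent (α * (-Complex.I) ^ k) : Mode) i)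
      = (coherentAmp (α * (-Complex.I) ^ k) i) • fock i := by
    rw [fock, ← lp.single_smul, smul_eq_mul, mul_one, coherent_apply]
  rw [e, map_smul, coherentAmp_mul_phase, branchVec, smul_smul, mul_comm]
  rfl

theorem norm_branchVec (U : Mode →ₗᵢ[ℂ] ModeTensor E) (k i : ℕ) : ‖branchVec U k i‖ = 1 := by
  simp [branchVec, norm_smul, norm_fock]

theorem norm_coherent (α : ℂ) : ‖coherent α‖ = 1 := by
  have h : ‖coherent α‖ ^ 2 = 1 := by
    have := lp.norm_rpow_eq_tsum (p := 2) (by simp) (coherent α)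
    simp only [ENNReal.toReal_ofNat, Real.rpow_ofNat] at this
    rw [this]
    have e : ∀ n, ‖coherent α n‖ ^ 2
      = Real.exp (-‖α‖ ^ 2 / 2) ^ 2 * ((‖α‖ ^ 2) ^ n / (n.factorial : ℝ)) := by
      intro n
      have h0 : (0 : ℝ) ≤ (n.factorial : ℝ) := by positivity
      simp only [coherent_apply, coherentAmp, norm_div, norm_mul, norm_pow,
        Complex.norm_real, Real.norm_eq_abs, div_pow, mul_pow, sq_abs, Real.sq_sqrt h0]
      ring
    simp_rw [e]
    rw [tsum_mul_left]
    have h3 := congrFun (Real.exp_eq_exp_ℝ.trans NormedSpace.exp_eq_tsum_div) (‖α‖ ^ 2)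
    rw [← h3, ← Real.exp_nat_mul, ← Real.exp_add]
    simp
    ring
  nlinarith [norm_nonneg (coherent α)]

theorem norm_branchCoherent (U : Mode →ₗᵢ[ℂ] ModeTensor E) (k : ℕ) (α : ℂ) :
    ‖branchCoherent U k α‖ = 1 := by
  simp [branchCoherent, norm_coherent]

theorem tsum_lintegral_branchVec_lt_top {U : Mode →ₗᵢ[ℂ] ModeTensor E} (hU : IsAdmissible U)
    {s : ℝ} (h0 : 0 < s) (h1 : s < 1) (k : ℕ) :
    ∑' i : ℕ, ENNReal.ofReal (s ^ i) * ∫⁻ x : ℝ, ‖((x : ℂ) ^ 2) • branchVec U k i x‖ₑ ^ 2 < ∞ := by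
  -- The constants come from `4 (n + 1)² ≤ 16 n² + 4` and the normalization of `U |i⟩`.
  have hb : ∀ i, ∫⁻ x : ℝ, ‖((x : ℂ) ^ 2) • branchVec U k i x‖ₑ ^ 2 ≤
      16 * ∑' n : ℕ, (n : ℝ≥0∞) ^ 2 * ‖(U (fock i) : ModeTensor E) n‖ₑ ^ 2 + 4 := by
    intro i
    have e : ∫⁻ x : ℝ, ‖((x : ℂ) ^ 2) • branchVec U k i x‖ₑ ^ 2 =
        ∫⁻ x : ℝ, ‖((x : ℂ) ^ 2) • waveIsometry E (phaseTwist E k (U (fock i))) x‖ₑ ^ 2 := by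
      refine lintegral_congr_ae ?_
      filter_upwards [Lp.coeFn_smul ((-Complex.I) ^ (k * i)) (branch U k (fock i))] with x hx
      rw [branchVec, hx, Pi.smul_apply, smul_comm, enorm_smul]
      have h6 : ‖(-Complex.I) ^ (k * i)‖ₑ = 1 := by simp [← ofReal_norm]
      rw [h6, one_mul]
      rfl
    have hn : ∑' n, ‖(U (fock i) : ModeTensor E) n‖ₑ ^ 2 = 1 := by
      have h2 : ‖(U (fock i) : ModeTensor E)‖ = 1 := by simp [norm_fock]
      have h3 := lp.hasSum_norm (p := 2) (by simp) (U (fock i))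
      simp only [ENNReal.toReal_ofNat, Real.rpow_ofNat, h2, one_pow] at h3
      have h4 := ENNReal.ofReal_tsum_of_nonneg (fun _ => by positivity) h3.summable
      rw [h3.tsum_eq, ENNReal.ofReal_one] at h4
      rw [h4]
      refine tsum_congr fun n => ?_
      rw [ENNReal.ofReal_pow (norm_nonneg _), ofReal_norm]
    rw [e]
    refine (lintegral_sq_smul_wave_le _).trans ?_
    calc 4 * ∑' n : ℕ, ((n : ℝ≥0∞) + 1) ^ 2 * ‖phaseTwist E k (U (fock i)) n‖ₑ ^ 2
        ≤ 4 * ∑' n : ℕ, (4 * ((n : ℝ≥0∞) ^ 2 * ‖(U (fock i) : ModeTensor E) n‖ₑ ^ 2) +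
          ‖(U (fock i) : ModeTensor E) n‖ₑ ^ 2) := by
          gcongr with n
          rw [phaseTwist_apply, enorm_smul]
          have h5 : ((n : ℝ≥0∞) + 1) ^ 2 ≤ 4 * (n : ℝ≥0∞) ^ 2 + 1 := by
            have : (n + 1) ^ 2 ≤ 4 * n ^ 2 + 1 := by
              rcases n with _ | n
              · norm_num
              · nlinarith
            exact_mod_cast this
          have h6 : ‖Complex.I ^ (k * n)‖ₑ = 1 := by simp [← ofReal_norm]
          rw [h6, one_mul, ← mul_assoc, ← add_one_mul]
          gcongr
      _ = _ := by
          rw [ENNReal.tsum_add, ENNReal.tsum_mul_left, hn, mul_add, ← mul_assoc]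
          norm_num
  have h := tsum_photonMoment_fock_lt_top h0 h1 hU
  have hs := (summable_geometric_of_lt_one h0.le h1).tsum_ofReal_lt_top
  calc ∑' i : ℕ, ENNReal.ofReal (s ^ i) * ∫⁻ x : ℝ, ‖((x : ℂ) ^ 2) • branchVec U k i x‖ₑ ^ 2
      ≤ ∑' i : ℕ, (16 * (ENNReal.ofReal (s ^ i) *
        ∑' n : ℕ, (n : ℝ≥0∞) ^ 2 * ‖(U (fock i) : ModeTensor E) n‖ₑ ^ 2) +
        4 * ENNReal.ofReal (s ^ i)) := by
        refine ENNReal.tsum_le_tsum fun i => ?_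
        refine (mul_le_mul_right (hb i) _).trans (le_of_eq ?_)
        ring
    _ < ∞ := by
        rw [ENNReal.tsum_add, ENNReal.tsum_mul_left, ENNReal.tsum_mul_left]
        exact ENNReal.add_lt_top.mpr ⟨ENNReal.mul_lt_top (by simp) h,
          ENNReal.mul_lt_top (by simp) hs⟩

/-- Sending `|-α⟩` instead of `|α⟩` reflects the outcome. -/
theorem bobLaw_neg (U : Mode →ₗᵢ[ℂ] ModeTensor E) (α : ℂ) :
    bobLaw U (-α) = (bobLaw U α).map (fun x => -x) := by
  have hI : (-Complex.I) ^ 2 = -1 := by rw [neg_sq, Complex.I_sq]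
  -- Two branches with the same rotated input whose output twists differ by the parity `(-1)ⁿ` have
  -- mirror-image laws. This is applied to branches two apart, so `α ↦ -α` permutes the four terms
  -- and reflects them.
  have hk : ∀ k j, (∀ n, Complex.I ^ (j * n) = (-1) ^ n * Complex.I ^ (k * n)) →
      -α * (-Complex.I) ^ j = α * (-Complex.I) ^ k →
      (volume : Measure ℝ).withDensity (fun x => ‖branchCoherent U j (-α) x‖ₑ ^ 2) =
      ((volume : Measure ℝ).withDensity (fun x => ‖branchCoherent U k α x‖ₑ ^ 2)).map
        (fun x => -x) := by
    intro k j hph hc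
    have hw := wave_parity (phaseTwist E k (U (coherent (α * (-Complex.I) ^ k))))
      (phaseTwist E j (U (coherent (α * (-Complex.I) ^ k)))) (fun n => by
        rw [phaseTwist_apply, phaseTwist_apply, smul_smul, hph])
    ext t ht
    rw [Measure.map_apply measurable_neg ht, withDensity_apply _ ht,
      withDensity_apply _ (measurable_neg ht)]
    have e : ∫⁻ x in t, ‖branchCoherent U j (-α) x‖ₑ ^ 2 =
        ∫⁻ x in t, ‖branchCoherent U k α (-x)‖ₑ ^ 2 := by
      refine lintegral_congr_ae (ae_restrict_of_ae ?_)
      filter_upwards [hw] with x hx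
      simp only [branchCoherent, hc]
      exact congrArg (fun v => ‖v‖ₑ ^ 2) hx
    rw [e]
    have hmp := Measure.measurePreserving_neg (volume : Measure ℝ)
    have := hmp.setLIntegral_comp_preimage_emb (MeasurableEquiv.neg ℝ).measurableEmbedding
      (fun x => ‖branchCoherent U k α x‖ₑ ^ 2) (Neg.neg ⁻¹' t)
    rw [← this]
    congr 2
    ext x
    simp
  have hI2 : ∀ n, Complex.I ^ (2 * n) = (-1) ^ n := fun n => by rw [pow_mul, Complex.I_sq]
  have hm1 : ∀ n : ℕ, ((-1 : ℂ) ^ n) * (-1) ^ n = 1 := fun n => by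
    rw [← mul_pow]
    simp
  have hup : ∀ k, (volume : Measure ℝ).withDensity (fun x => ‖branchCoherent U (k + 2) (-α) x‖ₑ ^ 2)
      = ((volume : Measure ℝ).withDensity (fun x => ‖branchCoherent U k α x‖ₑ ^ 2)).map
        (fun x => -x) := by
    refine fun k => hk _ _ (fun n => ?_) ?_
    · rw [add_mul, pow_add, hI2, mul_comm]
    · rw [pow_add, hI]
      ring
  have hdown : ∀ k, (volume : Measure ℝ).withDensity (fun x => ‖branchCoherent U k (-α) x‖ₑ ^ 2)
      = ((volume : Measure ℝ).withDensity (fun x => ‖branchCoherent U (k + 2) α x‖ₑ ^ 2)).map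
        (fun x => -x) := by
    refine fun k => hk _ _ (fun n => ?_) ?_
    · rw [add_mul, pow_add, hI2, mul_left_comm, hm1, mul_one]
    · rw [pow_add, hI]
      ring
  rw [bobLaw_eq, bobLaw_eq, ← Measure.mapₗ_apply_of_measurable measurable_neg, map_sum]
  simp only [Measure.mapₗ_apply_of_measurable measurable_neg, Measure.map_smul]
  simp only [Finset.sum_range_succ, Finset.sum_range_zero]
  rw [hdown 0, hdown 1, hup 0, hup 1]
  simp only [zero_add, Nat.reduceAdd]
  change _ = (1 / 4 : ℝ≥0∞) • Measure.map (fun x => -x) _ + (1 / 4 : ℝ≥0∞) • Measure.map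
      (fun x => -x) _
    + (1 / 4 : ℝ≥0∞) • Measure.map (fun x => -x) _ + (1 / 4 : ℝ≥0∞) • Measure.map (fun x => -x) _
  ac_rfl

end Conditional

/-! ## Coherent amplitudes under the modulations -/

section Amplitudes

theorem amplitude_eq (z : ℂ) : amplitude (z.re, z.im) = z / (Real.sqrt 2 : ℂ) := by
  rw [amplitude, mul_comm, Complex.re_add_im]

theorem amplitude_neg (z : ℝ × ℝ) : amplitude (-z) = -amplitude z := by
  simp only [amplitude, Prod.fst_neg, Prod.snd_neg, Complex.ofReal_neg]
  ring

theorem fst_eq_sqrt_two_mul_re_amplitude (z : ℝ × ℝ) : z.1 = Real.sqrt 2 * (amplitude z).re := by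
  have h2 : Real.sqrt 2 ≠ 0 := by positivity
  rw [amplitude, Complex.div_ofReal_re]
  simp
  field_simp

theorem continuous_amplitude : Continuous amplitude := by
  unfold amplitude
  fun_prop

theorem continuous_coherentAmp (n : ℕ) : Continuous fun α => coherentAmp α n := by
  unfold coherentAmp
  fun_prop

theorem continuous_coherentAmp_amplitude (n : ℕ) :
    Continuous fun z => coherentAmp (amplitude z) n :=
  (continuous_coherentAmp n).comp continuous_amplitude

theorem mul_coherentAmp (α : ℂ) (n : ℕ) :
    α * coherentAmp α n = (Real.sqrt (n + 1 : ℕ) : ℂ) * coherentAmp α (n + 1) := by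
  unfold coherentAmp
  rw [Nat.factorial_succ, Nat.cast_mul, Real.sqrt_mul (by positivity)]
  have h1 : (Real.sqrt (n + 1 : ℕ) : ℂ) ≠ 0 := by
    simp only [ne_eq, Complex.ofReal_eq_zero]
    positivity
  have h2 : (Real.sqrt (n.factorial : ℕ) : ℂ) ≠ 0 := by
    simp only [ne_eq, Complex.ofReal_eq_zero]
    positivity
  push_cast at h1 h2 ⊢
  field_simp
  ring

theorem norm_coherentAmp_sq (α : ℂ) (n : ℕ) : ‖coherentAmp α n‖ ^ 2 =
    Real.exp (-‖α‖ ^ 2) * ((‖α‖ ^ 2) ^ n / n.factorial) := by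
  have h0 : (0 : ℝ) ≤ (n.factorial : ℝ) := by positivity
  simp only [coherentAmp, norm_div, norm_mul, norm_pow,
    Complex.norm_real, Real.norm_eq_abs, div_pow, mul_pow, sq_abs, Real.sq_sqrt h0]
  rw [← Real.exp_nat_mul]
  push_cast
  ring_nf

theorem coherentAmp_rotate {u : ℂ} (hu : ‖u‖ = 1) (α : ℂ) (n : ℕ) :
    coherentAmp (u * α) n = u ^ n * coherentAmp α n := by
  simp only [coherentAmp, norm_mul, hu, one_mul, mul_pow]
  ring

theorem lintegral_fst_prod {μ ν : Measure ℝ} [SFinite μ] [IsProbabilityMeasure ν] {f : ℝ → ℝ≥0∞}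
    (hf : Measurable f) : ∫⁻ z, f z.1 ∂(μ.prod ν) = ∫⁻ x, f x ∂μ := by
  rw [lintegral_prod _ (by fun_prop)]
  simp

/-! ### The Gaussian modulation -/

variable {N : ℝ≥0}

/-- The density on `ℂ` depends on `‖z‖` only, which makes radial integrals and rotations available.
-/
theorem integral_gaussianModulation {F : Type*} [NormedAddCommGroup F] [NormedSpace ℝ F]
    (hN : 0 < N) (f : ℝ × ℝ → F) : ∫ z, f z ∂gaussianModulation N =
      ∫ z : ℂ, ((2 * Real.pi * N)⁻¹ * Real.exp (-‖z‖ ^ 2 / (2 * N))) • f (z.re, z.im) := by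
  unfold gaussianModulation
  rw [gaussianReal_of_var_ne_zero _ hN.ne', prod_withDensity (by fun_prop) (by fun_prop),
    integral_withDensity_eq_integral_toReal_smul (by fun_prop)
      (Filter.Eventually.of_forall fun z => by simp [gaussianPDF, ENNReal.mul_lt_top]),
    ← Measure.volume_eq_prod, ← (Complex.volume_preserving_equiv_real_prod).integral_comp
      Complex.measurableEquivRealProd.measurableEmbedding]
  refine integral_congr_ae (Filter.Eventually.of_forall fun z => ?_)
  simp only [Complex.measurableEquivRealProd_apply]
  congr 1
  rw [ENNReal.toReal_mul, gaussianPDF, gaussianPDF,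
    ENNReal.toReal_ofReal (gaussianPDFReal_nonneg _ _ _),
    ENNReal.toReal_ofReal (gaussianPDFReal_nonneg _ _ _), gaussianPDFReal, gaussianPDFReal]
  rw [mul_mul_mul_comm, ← Real.exp_add, ← mul_inv, Real.mul_self_sqrt (by positivity),
    Complex.sq_norm, Complex.normSq_apply]
  congr 2
  ring

theorem thermal_pos (hN : 0 < N) (n : ℕ) : 0 < thermal N n := by
  unfold thermal
  have : (0 : ℝ) < N := hN
  positivity

/-- A radial Gamma integral. With `|α|² = |z|²/2` the two exponentials combine to the rate `(N +
1)/(2N)`, whence the ratio `N/(N + 1)`. -/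
theorem integral_norm_coherentAmp_sq (hN : 0 < N) (n : ℕ) :
    ∫ z, ‖coherentAmp (amplitude z) n‖ ^ 2 ∂gaussianModulation N = thermal N n := by
  have hN' : (0 : ℝ) < N := hN
  rw [integral_gaussianModulation hN]
  have h2 : Real.sqrt 2 ^ 2 = 2 := Real.sq_sqrt (by norm_num)
  have e : ∀ z : ℂ, ((2 * Real.pi * N)⁻¹ * Real.exp (-‖z‖ ^ 2 / (2 * N))) •
      ‖coherentAmp (amplitude (z.re, z.im)) n‖ ^ 2 =
      ((2 * Real.pi * N)⁻¹ * (2 ^ n * n.factorial : ℝ)⁻¹) *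
        (‖z‖ ^ (2 * n : ℝ) * Real.exp (-((N + 1) / (2 * N)) * ‖z‖ ^ (2 : ℝ))) := by
    intro z
    have e1 : ‖z‖ ^ (2 * n : ℝ) = (‖z‖ ^ 2) ^ n := by
      rw [← pow_mul]
      exact_mod_cast Real.rpow_natCast ‖z‖ (2 * n)
    have e2 : ‖z‖ ^ (2 : ℝ) = ‖z‖ ^ 2 := by exact_mod_cast Real.rpow_natCast ‖z‖ 2
    rw [amplitude_eq, norm_coherentAmp_sq, norm_div, Complex.norm_real, Real.norm_eq_abs, div_pow,
      sq_abs, h2, e1, e2, div_pow, smul_eq_mul]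
    have e3 : Real.exp (-((N + 1) / (2 * N)) * ‖z‖ ^ 2) =
        Real.exp (-‖z‖ ^ 2 / (2 * N)) * Real.exp (-(‖z‖ ^ 2 / 2)) := by
      rw [← Real.exp_add]
      congr 1
      field_simp
      ring
    rw [e3]
    field_simp
  simp_rw [e]
  rw [integral_const_mul, Complex.integral_rpow_mul_exp_neg_mul_rpow (by norm_num)
    (by have : (0 : ℝ) ≤ n := by positivity
        linarith) (by positivity)]
  have e4 : ((2 * n : ℝ) + 2) / 2 = n + 1 := by ring
  have e5 : -((2 * n : ℝ) + 2) / 2 = -((n + 1 : ℕ) : ℝ) := by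
    push_cast
    ring
  rw [e4, e5, Real.Gamma_nat_eq_factorial, Real.rpow_neg (by positivity), Real.rpow_natCast,
      thermal,
    div_pow, div_pow, mul_pow]
  field_simp
  ring

theorem integrable_norm_coherentAmp_sq (hN : 0 < N) (n : ℕ) :
    Integrable (fun z => ‖coherentAmp (amplitude z) n‖ ^ 2) (gaussianModulation N) := by
  -- The integral of a non-integrable function is `0` by convention, whereas this one equals a
  -- positive thermal eigenvalue.
  by_contra h
  have h2 := integral_norm_coherentAmp_sq hN n
  rw [integral_undef h] at h2
  exact (thermal_pos hN n).ne h2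

theorem lintegral_enorm_coherentAmp_sq (hN : 0 < N) (n : ℕ) :
    ∫⁻ z, ‖coherentAmp (amplitude z) n‖ₑ ^ 2 ∂gaussianModulation N =
      ENNReal.ofReal (thermal N n) := by
  rw [← integral_norm_coherentAmp_sq hN, ofReal_integral_eq_lintegral_ofReal
    (integrable_norm_coherentAmp_sq hN n) (Filter.Eventually.of_forall fun _ => by positivity)]
  refine lintegral_congr fun z => ?_
  rw [ENNReal.ofReal_pow (norm_nonneg _), ofReal_norm]

/-- The average state of the Gaussian modulation is the thermal state. -/
theorem averageState_gaussianModulation (hN : 0 < N) (i j : ℕ) :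
    averageState (gaussianModulation N) i j = if i = j then (thermal N i : ℂ) else 0 := by
  split_ifs with hij
  · subst hij
    rw [← integral_norm_coherentAmp_sq hN, averageState, ← integral_complex_ofReal]
    refine integral_congr_ae (Filter.Eventually.of_forall fun z => ?_)
    simp only [Complex.star_def, Complex.mul_conj', Complex.ofReal_pow]
  · rw [averageState, integral_gaussianModulation hN]
    simp_rw [amplitude_eq]
    set G : ℂ → ℂ := fun z => ((2 * Real.pi * N)⁻¹ * Real.exp (-‖z‖ ^ 2 / (2 * N))) •
      (coherentAmp (z / (Real.sqrt 2 : ℂ)) i * star (coherentAmp (z / (Real.sqrt 2 : ℂ)) j)) with hG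
    have hsub : ((i : ℝ) - j) ≠ 0 := sub_ne_zero.mpr (by exact_mod_cast hij)
    -- A rotation by `π/(i - j)` preserves the measure and multiplies the integrand by `exp(iπ) =
    -- -1`, so the off-diagonal integral vanishes.
    set u : Circle := Circle.exp (Real.pi / ((i : ℝ) - j)) with hu
    have hun : ‖(u : ℂ)‖ = 1 := Circle.norm_coe u
    have hphase : (u : ℂ) ^ i * star ((u : ℂ) ^ j) = -1 := by
      have hs : star ((u : ℂ) ^ j) = Complex.exp (-(Real.pi / ((i : ℝ) - j) : ℝ) * Complex.I) ^ j
          := by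
        rw [Complex.star_def, map_pow, hu, Circle.coe_exp, ← Complex.exp_conj]
        simp
      rw [hs, hu, Circle.coe_exp, ← Complex.exp_nat_mul, ← Complex.exp_nat_mul, ← Complex.exp_add,
        ← Complex.exp_pi_mul_I]
      congr 1
      have hsub' : ((i : ℂ) - j) ≠ 0 := by exact_mod_cast hsub
      push_cast
      field_simp
      ring
    have hrot : ∀ z, G (rotation u z) = -G z := by
      intro z
      simp only [hG, rotation_apply, norm_mul, hun, one_mul, mul_div_assoc, coherentAmp_rotate hun,
        star_mul]
      rw [← smul_neg]
      congr 1
      linear_combination (coherentAmp (z / (Real.sqrt 2 : ℂ)) i *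
        star (coherentAmp (z / (Real.sqrt 2 : ℂ)) j)) * hphase
    have hmp := (rotation u).measurePreserving
    have h := hmp.integral_comp (rotation u).toHomeomorph.measurableEmbedding G
    simp_rw [hrot] at h
    rw [integral_neg] at h
    have h3 : (2 : ℂ) * ∫ z, G z = 0 := by linear_combination (-1 : ℂ) * h
    exact (mul_eq_zero.mp h3).resolve_left two_ne_zero

/-! ### Geometric decay of the second moments of the amplitudes -/

/-- The second moments of the coherent amplitudes decay geometrically. -/
def GeometricDecay (μ : Measure (ℝ × ℝ)) : Prop :=
  ∃ C s : ℝ, 0 ≤ C ∧ 0 < s ∧ s < 1 ∧ ∀ i j, ∫⁻ z, ‖coherentAmp (amplitude z) i‖ₑ *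
    ‖coherentAmp (amplitude z) j‖ₑ ∂μ ≤ ENNReal.ofReal (C * s ^ (i + j))

/-- Cauchy–Schwarz reduces the mixed moments to the diagonal ones, at the price of the rate `√s`. -/
theorem geometricDecay_of_sq {μ : Measure (ℝ × ℝ)} {C s : ℝ} (hC : 0 ≤ C) (h0 : 0 < s) (h1 : s < 1)
    (h : ∀ i, ∫⁻ z, ‖coherentAmp (amplitude z) i‖ₑ ^ 2 ∂μ ≤ ENNReal.ofReal (C * s ^ i)) :
    GeometricDecay μ := by
  refine ⟨C, Real.sqrt s, hC, by positivity, by rwa [Real.sqrt_lt' one_pos, one_pow], ?_⟩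
  intro i j
  have hm : ∀ i, AEMeasurable (fun z => ‖coherentAmp (amplitude z) i‖ₑ) μ := fun i =>
    (continuous_coherentAmp_amplitude i).enorm.aemeasurable
  have hH := ENNReal.lintegral_mul_le_Lp_mul_Lq μ (p := 2) (q := 2)
    (by rw [Real.holderConjugate_iff]; norm_num) (hm i) (hm j)
  refine hH.trans ?_
  have hb : ∀ i, (∫⁻ z, ‖coherentAmp (amplitude z) i‖ₑ ^ (2 : ℝ) ∂μ) ^ (1 / 2 : ℝ) ≤
      ENNReal.ofReal (Real.sqrt (C * s ^ i)) := by
    intro i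
    rw [Real.sqrt_eq_rpow, ← ENNReal.ofReal_rpow_of_nonneg (by positivity) (by norm_num)]
    gcongr
    simpa using h i
  refine (mul_le_mul' (hb i) (hb j)).trans ?_
  rw [← ENNReal.ofReal_mul (Real.sqrt_nonneg _), ← Real.sqrt_mul (by positivity)]
  refine ENNReal.ofReal_le_ofReal (le_of_eq ?_)
  rw [show C * s ^ i * (C * s ^ j) = C ^ 2 * s ^ (i + j) by ring, Real.sqrt_mul (by positivity),
    Real.sqrt_sq hC]
  congr 1
  refine Real.sqrt_eq_iff_eq_sq (by positivity) (by positivity) |>.mpr ?_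
  rw [← pow_mul, mul_comm (i + j), pow_mul, Real.sq_sqrt h0.le]

theorem geometricDecay_gaussianModulation (hN : 0 < N) : GeometricDecay (gaussianModulation N) := by
  have hN' : (0 : ℝ) < N := hN
  refine geometricDecay_of_sq (C := 1 / (N + 1)) (s := N / (N + 1)) (by positivity) (by positivity)
    (by rw [div_lt_one (by positivity)]; linarith) fun i => ?_
  rw [lintegral_enorm_coherentAmp_sq hN]
  rfl

/-! ### The discrete modulation -/

theorem lintegral_discreteModulation (m : ℕ) (N : ℝ≥0) {f : ℝ × ℝ → ℝ≥0∞} (hf : Measurable f)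
    (hm : 0 < m) : ∫⁻ z, f z ∂discreteModulation m N = ∑ l ∈ ghNodes m, ∑ l' ∈ ghNodes m,
      ENNReal.ofReal (ghWeight m l) * (ENNReal.ofReal (ghWeight m l') *
        f (Real.sqrt N * l, Real.sqrt N * l')) := by
  have := isProbabilityMeasure_gaussHermiteLaw m hm N
  rw [discreteModulation, lintegral_prod _ hf.aemeasurable,
    lintegral_gaussHermiteLaw m N _ hf.lintegral_prod_right']
  refine Finset.sum_congr rfl fun l _ => ?_
  rw [lintegral_gaussHermiteLaw m N _ (by fun_prop), Finset.mul_sum]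

theorem lintegral_discreteModulation_lt_top (m : ℕ) (N : ℝ≥0) {f : ℝ × ℝ → ℝ≥0∞}
    (hf : Measurable f) (hm : 0 < m) (hfin : ∀ z, f z < ∞) :
    ∫⁻ z, f z ∂discreteModulation m N < ∞ := by
  rw [lintegral_discreteModulation m N hf hm]
  refine ENNReal.sum_lt_top.mpr fun l _ => ENNReal.sum_lt_top.mpr fun l' _ => ?_
  exact ENNReal.mul_lt_top ENNReal.ofReal_lt_top (ENNReal.mul_lt_top ENNReal.ofReal_lt_top (hfin _))

/-- From `xⁱ/i! ≤ exp x` at `x = 2|α|²` one gets `|cᵢ|² ≤ exp(2|α|²) 2⁻ⁱ`, and the exponential has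
finite mean because the constellation is finite. -/
theorem geometricDecay_discreteModulation (m : ℕ) (N : ℝ≥0) (hm : 0 < m) :
    GeometricDecay (discreteModulation m N) := by
  have hfin := lintegral_discreteModulation_lt_top m N
    (f := fun z => ENNReal.ofReal (Real.exp (2 * ‖amplitude z‖ ^ 2)))
    (by have := continuous_amplitude
        fun_prop) hm (fun _ => ENNReal.ofReal_lt_top)
  refine geometricDecay_of_sq (s := 1 / 2) (C := (∫⁻ z, ENNReal.ofReal
    (Real.exp (2 * ‖amplitude z‖ ^ 2)) ∂discreteModulation m N).toReal) ENNReal.toReal_nonneg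
    (by norm_num) (by norm_num) fun i => ?_
  rw [ENNReal.ofReal_mul ENNReal.toReal_nonneg, ENNReal.ofReal_toReal hfin.ne,
    ← lintegral_mul_const' _ _ ENNReal.ofReal_ne_top]
  refine lintegral_mono fun z => ?_
  rw [← ofReal_norm, ← ENNReal.ofReal_pow (norm_nonneg _), ← ENNReal.ofReal_mul (Real.exp_nonneg _),
    norm_coherentAmp_sq]
  refine ENNReal.ofReal_le_ofReal ?_
  have h1 := Real.pow_div_factorial_le_exp (2 * ‖amplitude z‖ ^ 2) (by positivity) i
  have h2 : Real.exp (-‖amplitude z‖ ^ 2) ≤ 1 := Real.exp_le_one_iff.mpr (by simp)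
  calc Real.exp (-‖amplitude z‖ ^ 2) * ((‖amplitude z‖ ^ 2) ^ i / i.factorial)
      ≤ 1 * ((‖amplitude z‖ ^ 2) ^ i / i.factorial) := by gcongr
    _ = (2 * ‖amplitude z‖ ^ 2) ^ i / i.factorial * (1 / 2) ^ i := by
        rw [mul_pow, one_mul, div_mul_eq_mul_div, mul_right_comm, ← mul_pow]
        norm_num
    _ ≤ _ := by gcongr

end Amplitudes

/-! ## Quadratic forms in the coherent amplitudes -/

section Forms

/-- Again `xⁿ/n! ≤ exp x`, now at `x = 4|α|²`; the constant is generous. It makes forms converge at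
each fixed amplitude. -/
theorem norm_coherentAmp_le (α : ℂ) :
    ∃ K, 0 ≤ K ∧ ∀ n, ‖coherentAmp α n‖ ≤ K * (1 / 2) ^ n := by
  refine ⟨Real.exp (4 * ‖α‖ ^ 2), Real.exp_nonneg _, fun n => ?_⟩
  have h1 := Real.pow_div_factorial_le_exp (4 * ‖α‖ ^ 2) (by positivity) n
  have h2 : Real.exp (-‖α‖ ^ 2) ≤ 1 := Real.exp_le_one_iff.mpr (by simp)
  have h3 : (1 : ℝ) ≤ Real.exp (4 * ‖α‖ ^ 2) := Real.one_le_exp (by positivity)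
  refine le_of_sq_le_sq ?_ (by positivity)
  rw [norm_coherentAmp_sq]
  calc Real.exp (-‖α‖ ^ 2) * ((‖α‖ ^ 2) ^ n / n.factorial)
      ≤ 1 * ((‖α‖ ^ 2) ^ n / n.factorial) := by gcongr
    _ = (4 * ‖α‖ ^ 2) ^ n / n.factorial * ((1 / 2) ^ n) ^ 2 := by
        have e : (4 * ‖α‖ ^ 2) ^ n * ((1 / 2) ^ n) ^ 2 = (‖α‖ ^ 2) ^ n := by
          rw [← pow_mul (1 / 2 : ℝ), mul_comm n 2, pow_mul (1 / 2 : ℝ), ← mul_pow]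
          congr 1
          ring
        rw [one_mul, div_mul_eq_mul_div, e]
    _ ≤ Real.exp (4 * ‖α‖ ^ 2) * ((1 / 2) ^ n) ^ 2 := by gcongr
    _ ≤ (Real.exp (4 * ‖α‖ ^ 2) * Real.exp (4 * ‖α‖ ^ 2)) * ((1 / 2) ^ n) ^ 2 := by
        gcongr
        exact le_mul_of_one_le_left (Real.exp_nonneg _) h3
    _ = _ := by ring

/-- A matrix with subexponential growth. -/
def Subexponential (G : ℕ → ℕ → ℂ) : Prop :=
  ∀ s : ℝ, 0 < s → s < 1 → ∃ K, 0 ≤ K ∧ ∀ i j, ‖G i j‖ * s ^ (i + j) ≤ K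

theorem summable_pow_add {s : ℝ} (h0 : 0 < s) (h1 : s < 1) :
    Summable fun p : ℕ × ℕ => s ^ (p.1 + p.2) := by
  have h := summable_geometric_of_lt_one h0.le h1
  have := h.mul_of_nonneg h (fun _ => by positivity) (fun _ => by positivity)
  exact this.congr fun p => (pow_add _ _ _).symm

/-- Write `s = √s · √s`: one factor absorbs the growth, the other leaves a geometric series. -/
theorem Subexponential.summable {G : ℕ → ℕ → ℂ} (hG : Subexponential G) {s : ℝ} (h0 : 0 < s)
    (h1 : s < 1) : Summable fun p : ℕ × ℕ => ‖G p.1 p.2‖ * s ^ (p.1 + p.2) := by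
  have hs0 : 0 < Real.sqrt s := Real.sqrt_pos.mpr h0
  have hs1 : Real.sqrt s < 1 := by rwa [Real.sqrt_lt' one_pos, one_pow]
  obtain ⟨K, hK, h⟩ := hG _ hs0 hs1
  refine Summable.of_nonneg_of_le (fun p => by positivity) (fun p => ?_)
    ((summable_pow_add hs0 hs1).mul_left K)
  have e : s ^ (p.1 + p.2) = Real.sqrt s ^ (p.1 + p.2) * Real.sqrt s ^ (p.1 + p.2) := by
    rw [← mul_pow, Real.mul_self_sqrt h0.le]
  rw [e, ← mul_assoc]
  gcongr
  exact h _ _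

theorem Subexponential.summable_sq {G : ℕ → ℕ → ℂ} (hG : Subexponential G) {s : ℝ} (h0 : 0 < s)
    (h1 : s < 1) : Summable fun p : ℕ × ℕ => ‖G p.1 p.2‖ ^ 2 * s ^ (p.1 + p.2) := by
  have hs0 : 0 < Real.sqrt s := Real.sqrt_pos.mpr h0
  have hs1 : Real.sqrt s < 1 := by rwa [Real.sqrt_lt' one_pos, one_pow]
  obtain ⟨K, hK, h⟩ := hG _ hs0 hs1
  refine Summable.of_nonneg_of_le (fun p => by positivity) (fun p => ?_)
    ((hG.summable hs0 hs1).mul_left K)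
  have e : s ^ (p.1 + p.2) = Real.sqrt s ^ (p.1 + p.2) * Real.sqrt s ^ (p.1 + p.2) := by
    rw [← mul_pow, Real.mul_self_sqrt h0.le]
  rw [e]
  calc ‖G p.1 p.2‖ ^ 2 * (Real.sqrt s ^ (p.1 + p.2) * Real.sqrt s ^ (p.1 + p.2))
      = (‖G p.1 p.2‖ * Real.sqrt s ^ (p.1 + p.2)) * (‖G p.1 p.2‖ * Real.sqrt s ^ (p.1 + p.2)) := by
        ring
    _ ≤ _ := by
        gcongr
        exact h _ _

theorem Subexponential.sum {ι : Type*} (t : Finset ι) (G : ι → ℕ → ℕ → ℂ)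
    (hG : ∀ k ∈ t, Subexponential (G k)) : Subexponential fun i j => ∑ k ∈ t, G k i j := by
  classical
  induction t using Finset.induction_on with
  | empty =>
    intro s _ _
    exact ⟨0, le_rfl, by simp⟩
  | insert a t ha ih =>
    intro s h0 h1
    obtain ⟨K, hK, h⟩ := hG a (Finset.mem_insert_self _ _) s h0 h1
    obtain ⟨K', hK', h'⟩ := ih (fun k hk => hG k (Finset.mem_insert_of_mem hk)) s h0 h1
    refine ⟨K + K', by positivity, fun i j => ?_⟩
    beta_reduce
    rw [Finset.sum_insert ha]
    calc _ ≤ (‖G a i j‖ + ‖∑ k ∈ t, G k i j‖) * s ^ (i + j) := by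
          gcongr
          exact norm_add_le _ _
      _ ≤ _ := by
          rw [add_mul]
          exact add_le_add (h i j) (h' i j)

theorem Subexponential.const_mul {G : ℕ → ℕ → ℂ} (hG : Subexponential G) (a : ℂ) :
    Subexponential fun i j => a * G i j := by
  intro s h0 h1
  obtain ⟨K, hK, h⟩ := hG s h0 h1
  refine ⟨‖a‖ * K, by positivity, fun i j => ?_⟩
  rw [norm_mul, mul_assoc]
  gcongr
  exact h i j

/-- The quadratic form `∑ᵢⱼ conj(cᵢ) Gᵢⱼ cⱼ` in the coherent amplitudes. -/
def form (G : ℕ → ℕ → ℂ) (z : ℝ × ℝ) : ℂ :=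
  ∑' p : ℕ × ℕ, star (coherentAmp (amplitude z) p.1) * coherentAmp (amplitude z) p.2 * G p.1 p.2

theorem Subexponential.summable_form {G : ℕ → ℕ → ℂ} (hG : Subexponential G) (z : ℝ × ℝ) :
    Summable fun p : ℕ × ℕ => star (coherentAmp (amplitude z) p.1) *
      coherentAmp (amplitude z) p.2 * G p.1 p.2 := by
  obtain ⟨K, hK, h⟩ := norm_coherentAmp_le (amplitude z)
  refine Summable.of_norm_bounded ((hG.summable (s := 1 / 2) (by norm_num) (by norm_num)).mul_left
    (K * K)) fun p => ?_
  rw [norm_mul, norm_mul, norm_star, pow_add]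
  calc _ ≤ (K * (1 / 2) ^ p.1) * (K * (1 / 2) ^ p.2) * ‖G p.1 p.2‖ := by
        gcongr
        · exact h _
        · exact h _
    _ = _ := by ring

theorem Subexponential.hasSum_form {G : ℕ → ℕ → ℂ} (hG : Subexponential G) (z : ℝ × ℝ) :
    HasSum (fun p : ℕ × ℕ => star (coherentAmp (amplitude z) p.1) *
      coherentAmp (amplitude z) p.2 * G p.1 p.2) (form G z) :=
  (hG.summable_form z).hasSum

variable {μ : Measure (ℝ × ℝ)}

/-- Geometric decay beats subexponential growth. This justifies exchanging sum and expectation, and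
later bounds the fourth moment of `Q_B` before its integrability is known. -/
theorem tsum_lintegral_form_lt_top {G : ℕ → ℕ → ℂ} (hμ : GeometricDecay μ)
    (hG : Subexponential G) : ∑' p : ℕ × ℕ, ∫⁻ z, ‖star (coherentAmp (amplitude z) p.1) *
      coherentAmp (amplitude z) p.2 * G p.1 p.2‖ₑ ∂μ < ∞ := by
  obtain ⟨C, s, hC, h0, h1, h⟩ := hμ
  have hs := ((hG.summable h0 h1).mul_left C).tsum_ofReal_lt_top
  refine lt_of_le_of_lt (ENNReal.tsum_le_tsum fun p => ?_) hs
  have e : ∀ z, ‖star (coherentAmp (amplitude z) p.1) * coherentAmp (amplitude z) p.2 *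
      G p.1 p.2‖ₑ = ‖coherentAmp (amplitude z) p.1‖ₑ * ‖coherentAmp (amplitude z) p.2‖ₑ *
      ‖G p.1 p.2‖ₑ := by
    intro z
    rw [enorm_mul, enorm_mul, ← ofReal_norm (star _), norm_star, ofReal_norm]
  simp_rw [e]
  rw [lintegral_mul_const' _ _ enorm_ne_top]
  refine (mul_le_mul_left (h p.1 p.2) _).trans (le_of_eq ?_)
  rw [← ofReal_norm (G p.1 p.2), ← ENNReal.ofReal_mul (by positivity)]
  congr 1
  ring

theorem continuous_form_term (G : ℕ → ℕ → ℂ) (p : ℕ × ℕ) :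
    Continuous fun z => star (coherentAmp (amplitude z) p.1) *
      coherentAmp (amplitude z) p.2 * G p.1 p.2 := by
  have h1 := continuous_coherentAmp_amplitude p.1
  have h2 := continuous_coherentAmp_amplitude p.2
  exact (h1.star.mul h2).mul continuous_const

/-- The mean of a quadratic form in the coherent amplitudes is a linear functional of the average
state. -/
theorem hasSum_integral_form {G : ℕ → ℕ → ℂ} (hμ : GeometricDecay μ) (hG : Subexponential G) :
    HasSum (fun p : ℕ × ℕ => averageState μ p.2 p.1 * G p.1 p.2) (∫ z, form G z ∂μ) := by
  have hfin := tsum_lintegral_form_lt_top hμ hG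
  have hint : ∀ p : ℕ × ℕ, Integrable (fun z => star (coherentAmp (amplitude z) p.1) *
      coherentAmp (amplitude z) p.2 * G p.1 p.2) μ := fun p =>
    ⟨(continuous_form_term G p).aestronglyMeasurable,
      lt_of_le_of_lt (ENNReal.le_tsum p) hfin⟩
  have hsum : Summable fun p : ℕ × ℕ => ∫ z, ‖star (coherentAmp (amplitude z) p.1) *
      coherentAmp (amplitude z) p.2 * G p.1 p.2‖ ∂μ := by
    have h := ENNReal.summable_toReal hfin.ne
    refine h.congr fun p => ?_
    rw [integral_norm_eq_lintegral_enorm (hint p).1]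
  have h := hasSum_integral_of_summable_integral_norm hint hsum
  refine h.congr_fun fun p => ?_
  rw [integral_mul_const, averageState]
  congr 1
  refine integral_congr_ae (Filter.Eventually.of_forall fun z => ?_)
  exact mul_comm _ _

/-! ### The `χ²` bound -/

theorem tsum_enorm_coherentAmp_sq (α : ℂ) : ∑' n, ‖coherentAmp α n‖ₑ ^ 2 = 1 := by
  have h3 := lp.hasSum_norm (p := 2) (by simp) (coherent α)
  simp only [ENNReal.toReal_ofNat, Real.rpow_ofNat, norm_coherent, one_pow] at h3
  have h4 := ENNReal.ofReal_tsum_of_nonneg (fun _ => by positivity) h3.summable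
  rw [h3.tsum_eq, ENNReal.ofReal_one] at h4
  rw [h4]
  refine tsum_congr fun n => ?_
  rw [ENNReal.ofReal_pow (norm_nonneg _), ofReal_norm]
  rfl

theorem averageState_self (i : ℕ) :
    averageState μ i i = ((∫ z, ‖coherentAmp (amplitude z) i‖ ^ 2 ∂μ : ℝ) : ℂ) := by
  rw [averageState, ← integral_complex_ofReal]
  refine integral_congr_ae (Filter.Eventually.of_forall fun z => ?_)
  simp only [Complex.star_def, Complex.mul_conj', Complex.ofReal_pow]

theorem tsum_averageState_self [IsProbabilityMeasure μ] (hμ : GeometricDecay μ) :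
    ∑' i, ENNReal.ofReal (∫ z, ‖coherentAmp (amplitude z) i‖ ^ 2 ∂μ) = 1 := by
  obtain ⟨C, s, hC, h0, h1, h⟩ := hμ
  have hm : ∀ i, AEMeasurable (fun z => ‖coherentAmp (amplitude z) i‖ₑ ^ 2) μ := fun i =>
    ((continuous_coherentAmp_amplitude i).enorm.measurable.pow_const 2).aemeasurable
  have e : ∀ i, ENNReal.ofReal (∫ z, ‖coherentAmp (amplitude z) i‖ ^ 2 ∂μ) =
      ∫⁻ z, ‖coherentAmp (amplitude z) i‖ₑ ^ 2 ∂μ := by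
    intro i
    have hi : Integrable (fun z => ‖coherentAmp (amplitude z) i‖ ^ 2) μ := by
      refine ⟨((continuous_coherentAmp_amplitude i).norm.pow 2).aestronglyMeasurable, ?_⟩
      refine lt_of_le_of_lt (le_trans (le_of_eq ?_) (h i i)) ENNReal.ofReal_lt_top
      refine lintegral_congr fun z => ?_
      rw [enorm_pow, enorm_norm, sq]
    rw [ofReal_integral_eq_lintegral_ofReal hi (Filter.Eventually.of_forall fun _ => by positivity)]
    refine lintegral_congr fun z => ?_
    rw [ENNReal.ofReal_pow (norm_nonneg _), ofReal_norm]
  simp_rw [e]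
  rw [← lintegral_tsum hm]
  simp_rw [tsum_enorm_coherentAmp_sq]
  simp

theorem tsum_thermal (N : ℝ≥0) : ∑' n, ENNReal.ofReal (thermal N n) = 1 := by
  have hr0 : (0 : ℝ) ≤ N / (N + 1) := by positivity
  have hr1 : (N : ℝ) / (N + 1) < 1 := by
    rw [div_lt_one (by positivity)]
    linarith
  unfold thermal
  rw [← ENNReal.ofReal_tsum_of_nonneg (fun n => by positivity)
    ((summable_geometric_of_lt_one hr0 hr1).mul_left _), tsum_mul_left,
    tsum_geometric_of_lt_one hr0 hr1, ← ENNReal.ofReal_one]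
  congr 1
  field_simp
  ring

theorem tsum_diagonal (f : ℕ → ℝ≥0∞) : ∑' i, ∑' j, (if i = j then f i else 0) = ∑' i, f i := by
  refine tsum_congr fun i => ?_
  rw [tsum_eq_single i]
  · simp
  · intro j hj
    rw [if_neg hj.symm]

/-- The difference of the average state and the thermal state. -/
def stateDiff (μ : Measure (ℝ × ℝ)) (N : ℝ≥0) (i j : ℕ) : ℂ :=
  averageState μ i j - if i = j then (thermal N i : ℂ) else 0

/-- On the diagonal `(r - t)²/t = r²/t - 2r + t`, and both states have trace one, so replacing `ρ̄`
by `ρ̄ - θ` subtracts exactly `1`. -/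
theorem chiSq_eq_tsum_stateDiff [IsProbabilityMeasure μ] (hμ : GeometricDecay μ) {N : ℝ≥0}
    (hN : 0 < N) : chiSq (averageState μ) (thermal N) = ∑' i, ∑' j, ENNReal.ofReal
      (‖stateDiff μ N i j‖ ^ 2 / (Real.sqrt (thermal N i) * Real.sqrt (thermal N j))) := by
  set r : ℕ → ℝ := fun i => ∫ z, ‖coherentAmp (amplitude z) i‖ ^ 2 ∂μ with hr
  have hr0 : ∀ i, 0 ≤ r i := fun i => integral_nonneg fun _ => by positivity
  -- The cross term is moved to the other side so that only additions of extended nonnegative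
  -- numbers occur; the sums may be infinite, but only finite terms are cancelled.
  have hterm : ∀ i j, ENNReal.ofReal (‖stateDiff μ N i j‖ ^ 2 /
      (Real.sqrt (thermal N i) * Real.sqrt (thermal N j))) +
      (if i = j then ENNReal.ofReal (2 * r i) else 0) =
      ENNReal.ofReal (‖averageState μ i j‖ ^ 2 /
      (Real.sqrt (thermal N i) * Real.sqrt (thermal N j))) +
      (if i = j then ENNReal.ofReal (thermal N i) else 0) := by
    intro i j
    have ht := thermal_pos hN i
    by_cases hij : i = j
    · subst hij
      rw [if_pos rfl, if_pos rfl, ← ENNReal.ofReal_add (by positivity)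
          (by have := hr0 i; positivity),
        ← ENNReal.ofReal_add (by positivity) ht.le, stateDiff, if_pos rfl, averageState_self,
        ← Complex.ofReal_sub, Complex.norm_real, Complex.norm_real, Real.norm_eq_abs,
        Real.norm_eq_abs, sq_abs, sq_abs, Real.mul_self_sqrt ht.le]
      congr 1
      change (r i - _) ^ 2 / _ + _ = r i ^ 2 / _ + _
      field_simp
      ring
    · simp [stateDiff, hij]
  have hsum : (∑' i, ∑' j, ENNReal.ofReal (‖stateDiff μ N i j‖ ^ 2 /
      (Real.sqrt (thermal N i) * Real.sqrt (thermal N j)))) + 2 =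
      (∑' i, ∑' j, ENNReal.ofReal (‖averageState μ i j‖ ^ 2 /
      (Real.sqrt (thermal N i) * Real.sqrt (thermal N j)))) + 1 := by
    have h1 : ∑' i, ENNReal.ofReal (2 * r i) = 2 := by
      simp_rw [ENNReal.ofReal_mul zero_le_two]
      rw [ENNReal.tsum_mul_left, tsum_averageState_self hμ]
      simp
    rw [← h1, ← tsum_thermal N, ← tsum_diagonal (fun i => ENNReal.ofReal (2 * r i)),
      ← tsum_diagonal (fun i => ENNReal.ofReal (thermal N i)), ← ENNReal.tsum_add,
      ← ENNReal.tsum_add]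
    refine tsum_congr fun i => ?_
    rw [← ENNReal.tsum_add, ← ENNReal.tsum_add]
    exact tsum_congr fun j => hterm i j
  unfold chiSq
  rw [show (2 : ℝ≥0∞) = 1 + 1 from one_add_one_eq_two.symm, ← add_assoc] at hsum
  have h2 := (ENNReal.add_left_inj ENNReal.one_ne_top).mp hsum
  rw [← h2]
  exact ENNReal.add_sub_cancel_right ENNReal.one_ne_top

/-- The norm dual to `√χ²` on the matrices of quadratic forms. -/
def dualNorm (N : ℝ≥0) (G : ℕ → ℕ → ℂ) : ℝ :=
  Real.sqrt (∑' p : ℕ × ℕ, ‖G p.1 p.2‖ ^ 2 * (Real.sqrt (thermal N p.1) * Real.sqrt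
      (thermal N p.2)))

/-- The weight `√(tᵢ tⱼ)` is geometric in `i + j` with ratio `√(N/(N + 1)) < 1`. -/
theorem summable_dualNorm {N : ℝ≥0} (hN : 0 < N) {G : ℕ → ℕ → ℂ} (hG : Subexponential G) :
    Summable fun p : ℕ × ℕ =>
      ‖G p.1 p.2‖ ^ 2 * (Real.sqrt (thermal N p.1) * Real.sqrt (thermal N p.2)) := by
  have hN' : (0 : ℝ) < N := hN
  have hr1 : (N : ℝ) / (N + 1) < 1 := by
    rw [div_lt_one (by positivity)]
    linarith
  have hs0 : 0 < Real.sqrt ((N : ℝ) / (N + 1)) := by positivity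
  have hs1 : Real.sqrt ((N : ℝ) / (N + 1)) < 1 := by rwa [Real.sqrt_lt' one_pos, one_pow]
  refine ((hG.summable_sq hs0 hs1).mul_left ((1 : ℝ) / ((N : ℝ) + 1))).congr fun p => ?_
  have e : ∀ n : ℕ, Real.sqrt (thermal N n) =
      Real.sqrt ((1 : ℝ) / ((N : ℝ) + 1)) * Real.sqrt ((N : ℝ) / (N + 1)) ^ n := by
    intro n
    rw [thermal, Real.sqrt_mul (by positivity)]
    congr 1
    refine (Real.sqrt_eq_iff_eq_sq (by positivity) (by positivity)).mpr ?_
    rw [← pow_mul, mul_comm, pow_mul, Real.sq_sqrt (by positivity)]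
  rw [e, e, pow_add]
  have h := Real.mul_self_sqrt (show (0 : ℝ) ≤ (1 : ℝ) / ((N : ℝ) + 1) by positivity)
  linear_combination (-‖G p.1 p.2‖ ^ 2 * Real.sqrt ((N : ℝ) / (N + 1)) ^ p.1 *
    Real.sqrt ((N : ℝ) / (N + 1)) ^ p.2) * h

/-- Two modulations give means of a quadratic form that differ by at most `√χ²` times the dual
norm. -/
theorem norm_integral_form_sub_le [IsProbabilityMeasure μ] (hμ : GeometricDecay μ) {N : ℝ≥0}
    (hN : 0 < N) {G : ℕ → ℕ → ℂ} (hG : Subexponential G) {δ : ℝ} (hδ : 0 ≤ δ)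
    (hχ : (chiSq (averageState μ) (thermal N)) ^ (1 / 2 : ℝ) ≤ ENNReal.ofReal δ) :
    ‖∫ z, form G z ∂μ - ∫ z, form G z ∂gaussianModulation N‖ ≤ δ * dualNorm N G := by
  have h1 := (hasSum_integral_form hμ hG).sub
    (hasSum_integral_form (geometricDecay_gaussianModulation hN) hG)
  set q : ℕ × ℕ → ℝ := fun p => Real.sqrt (thermal N p.1) * Real.sqrt (thermal N p.2) with hq
  have hq0 : ∀ p, 0 < q p := fun p =>
    mul_pos (Real.sqrt_pos.mpr (thermal_pos hN _)) (Real.sqrt_pos.mpr (thermal_pos hN _))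
  have h2 : ∀ p : ℕ × ℕ, averageState μ p.2 p.1 * G p.1 p.2 -
      averageState (gaussianModulation N) p.2 p.1 * G p.1 p.2 =
      stateDiff μ N p.2 p.1 * G p.1 p.2 := by
    intro p
    rw [averageState_gaussianModulation hN, stateDiff, sub_mul]
  simp_rw [h2] at h1
  rw [← h1.tsum_eq]
  have hX : ∑' p : ℕ × ℕ, ENNReal.ofReal (‖stateDiff μ N p.2 p.1‖ / Real.sqrt (q p)) ^ (2 : ℝ) =
      chiSq (averageState μ) (thermal N) := by
    rw [chiSq_eq_tsum_stateDiff hμ hN, ENNReal.tsum_comm, ← ENNReal.tsum_prod]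
    refine tsum_congr fun p => ?_
    rw [ENNReal.rpow_ofNat, ← ENNReal.ofReal_pow (by positivity), div_pow,
      Real.sq_sqrt (hq0 p).le, mul_comm (Real.sqrt (thermal N p.2))]
  have hY : ∑' p : ℕ × ℕ, ENNReal.ofReal (Real.sqrt (q p) * ‖G p.1 p.2‖) ^ (2 : ℝ) =
      ENNReal.ofReal (dualNorm N G ^ 2) := by
    rw [dualNorm, Real.sq_sqrt (tsum_nonneg fun p => mul_nonneg (by positivity) (hq0 p).le),
      ENNReal.ofReal_tsum_of_nonneg (fun p => mul_nonneg (by positivity) (hq0 p).le)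
      (summable_dualNorm hN hG)]
    refine tsum_congr fun p => ?_
    rw [ENNReal.rpow_ofNat, ← ENNReal.ofReal_pow (by positivity), mul_pow,
      Real.sq_sqrt (hq0 p).le, mul_comm]
  -- Cauchy–Schwarz for sums, with `√q` divided out of the state difference and multiplied into the
  -- matrix. The transposed indices do no harm, because `q` is symmetric.
  have hCS := ENNReal.lintegral_mul_le_Lp_mul_Lq (Measure.count : Measure (ℕ × ℕ)) (p := 2) (q := 2)
    (by rw [Real.holderConjugate_iff]; norm_num)
    (f := fun p => ENNReal.ofReal (‖stateDiff μ N p.2 p.1‖ / Real.sqrt (q p)))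
    (g := fun p => ENNReal.ofReal (Real.sqrt (q p) * ‖G p.1 p.2‖))
    (by fun_prop) (by fun_prop)
  simp only [lintegral_count, Pi.mul_apply] at hCS
  rw [hX, hY] at hCS
  have hd0 : 0 ≤ dualNorm N G := Real.sqrt_nonneg _
  have hfinal : ‖∑' p : ℕ × ℕ, stateDiff μ N p.2 p.1 * G p.1 p.2‖ₑ ≤
      ENNReal.ofReal (δ * dualNorm N G) := by
    refine enorm_tsum_le_tsum_enorm.trans ?_
    calc ∑' p : ℕ × ℕ, ‖stateDiff μ N p.2 p.1 * G p.1 p.2‖ₑ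
        = ∑' p : ℕ × ℕ, ENNReal.ofReal (‖stateDiff μ N p.2 p.1‖ / Real.sqrt (q p)) *
          ENNReal.ofReal (Real.sqrt (q p) * ‖G p.1 p.2‖) := by
          refine tsum_congr fun p => ?_
          have := Real.sqrt_pos.mpr (hq0 p)
          rw [← ENNReal.ofReal_mul (by positivity), ← ofReal_norm, norm_mul]
          congr 1
          field_simp
      _ ≤ _ := hCS
      _ ≤ ENNReal.ofReal δ * ENNReal.ofReal (dualNorm N G) := by
          gcongr
          rw [ENNReal.ofReal_pow hd0, ← ENNReal.rpow_natCast, ← ENNReal.rpow_mul]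
          simp
      _ = _ := (ENNReal.ofReal_mul hδ).symm
  rw [← ofReal_norm] at hfinal
  exact (ENNReal.ofReal_le_ofReal_iff (by positivity)).mp hfinal

end Forms

/-! ## Moments of the homodyne outcome as quadratic forms -/

section Moments

variable {E : Type*} [NormedAddCommGroup E] [InnerProductSpace ℂ E]

theorem enorm_pow_smul_sq_le {b : ℕ} (hb : b ≤ 2) (x : ℝ) (v : E) :
    ‖((x : ℂ) ^ b) • v‖ₑ ^ 2 ≤ ‖v‖ₑ ^ 2 + ‖((x : ℂ) ^ 2) • v‖ₑ ^ 2 := by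
  have h : ‖((x : ℂ) ^ b) • v‖ ^ 2 ≤ ‖v‖ ^ 2 + ‖((x : ℂ) ^ 2) • v‖ ^ 2 := by
    rw [norm_smul, norm_smul, norm_pow, norm_pow, Complex.norm_real, mul_pow, mul_pow,
      ← one_add_mul]
    gcongr
    have h0 := norm_nonneg x
    interval_cases b
    · simp
      positivity
    · rw [pow_one]
      nlinarith [sq_nonneg (‖x‖ ^ 2 - 1), sq_nonneg ‖x‖]
    · simp
  have h' := ENNReal.ofReal_le_ofReal h
  rw [ENNReal.ofReal_add (by positivity) (by positivity), ENNReal.ofReal_pow (norm_nonneg _),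
    ENNReal.ofReal_pow (norm_nonneg _), ENNReal.ofReal_pow (norm_nonneg _)] at h'
  simpa [ofReal_norm] using h'

theorem aestronglyMeasurable_pow_smul (u : Lp E 2 (volume : Measure ℝ)) (b : ℕ) :
    AEStronglyMeasurable (fun x : ℝ => ((x : ℂ) ^ b) • u x) volume := by
  refine AEStronglyMeasurable.smul ?_ (Lp.aestronglyMeasurable u)
  exact Continuous.aestronglyMeasurable (by fun_prop)

theorem lintegral_pow_smul_sq_le {b : ℕ} (hb : b ≤ 2) (u : Lp E 2 (volume : Measure ℝ)) :
    ∫⁻ x : ℝ, ‖((x : ℂ) ^ b) • u x‖ₑ ^ 2 ≤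
      ‖u‖ₑ ^ 2 + ∫⁻ x : ℝ, ‖((x : ℂ) ^ 2) • u x‖ₑ ^ 2 := by
  rw [← lintegral_enorm_sq_Lp, ← lintegral_add_left (by
    exact (Lp.stronglyMeasurable u).enorm.pow_const 2)]
  exact lintegral_mono fun x => enorm_pow_smul_sq_le hb x _

theorem memLp_two_of_lintegral_lt_top {E : Type*} [NormedAddCommGroup E] {X : Type*}
    [MeasurableSpace X] {μ : Measure X} {f : X → E}
    (hf : AEStronglyMeasurable f μ) (h : ∫⁻ x, ‖f x‖ₑ ^ 2 ∂μ < ∞) : MemLp f 2 μ := by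
  refine ⟨hf, ?_⟩
  rw [eLpNorm_lt_top_iff_lintegral_rpow_enorm_lt_top (by simp) (by simp)]
  simpa using h

theorem inner_self_eq_ofReal_norm_sq (v : E) : ⟪v, v⟫_ℂ = ((‖v‖ ^ 2 : ℝ) : ℂ) := by
  rw [inner_self_eq_norm_sq_to_K]
  push_cast
  rfl

variable [CompleteSpace E]

theorem lintegral_sq_smul_branchVec_lt_top {U : Mode →ₗᵢ[ℂ] ModeTensor E} (hU : IsAdmissible U)
    (k i : ℕ) : ∫⁻ x : ℝ, ‖((x : ℂ) ^ 2) • branchVec U k i x‖ₑ ^ 2 < ∞ := by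
  have h := tsum_lintegral_branchVec_lt_top hU (s := 1 / 2) (by norm_num) (by norm_num) k
  have h2 := lt_of_le_of_lt (ENNReal.le_tsum i) h
  refine ENNReal.lt_top_of_mul_ne_top_right h2.ne ?_
  simp only [ne_eq, ENNReal.ofReal_eq_zero, not_le]
  positivity

theorem memLp_pow_smul_branchVec {U : Mode →ₗᵢ[ℂ] ModeTensor E} (hU : IsAdmissible U)
    (k i : ℕ) {b : ℕ} (hb : b ≤ 2) :
    MemLp (fun x : ℝ => ((x : ℂ) ^ b) • branchVec U k i x) 2 volume := by
  refine memLp_two_of_lintegral_lt_top (aestronglyMeasurable_pow_smul _ b) ?_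
  refine lt_of_le_of_lt (lintegral_pow_smul_sq_le hb _) (ENNReal.add_lt_top.mpr ⟨?_, ?_⟩)
  · exact ENNReal.pow_lt_top enorm_lt_top
  · exact lintegral_sq_smul_branchVec_lt_top hU k i

/-- The vector `x ↦ x^b Wᵢ(x)`, with `Wᵢ` the output wave function for the number state `|i⟩`. -/
def posVec {U : Mode →ₗᵢ[ℂ] ModeTensor E} (hU : IsAdmissible U) (k : ℕ) {b : ℕ} (hb : b ≤ 2)
    (i : ℕ) : Lp E 2 (volume : Measure ℝ) :=
  (memLp_pow_smul_branchVec hU k i hb).toLp _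

theorem coeFn_posVec {U : Mode →ₗᵢ[ℂ] ModeTensor E} (hU : IsAdmissible U)
    {b : ℕ} (hb : b ≤ 2) (k i : ℕ) :
    posVec hU k hb i =ᵐ[volume] fun x : ℝ => ((x : ℂ) ^ b) • branchVec U k i x :=
  (memLp_pow_smul_branchVec hU k i hb).coeFn_toLp

theorem enorm_posVec_sq {U : Mode →ₗᵢ[ℂ] ModeTensor E} (hU : IsAdmissible U)
    {b : ℕ} (hb : b ≤ 2) (k i : ℕ) :
    ‖posVec hU k hb i‖ₑ ^ 2 = ∫⁻ x : ℝ, ‖((x : ℂ) ^ b) • branchVec U k i x‖ₑ ^ 2 := by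
  rw [← lintegral_enorm_sq_Lp]
  refine lintegral_congr_ae ?_
  filter_upwards [coeFn_posVec hU hb k i] with x hx
  rw [hx]

/-- A single term of a convergent series of nonnegative terms is at most its sum; the series is
taken at `s²` because it contains squared norms. -/
theorem norm_posVec_le {U : Mode →ₗᵢ[ℂ] ModeTensor E} (hU : IsAdmissible U)
    {b : ℕ} (hb : b ≤ 2) (k : ℕ) {s : ℝ} (h0 : 0 < s) (h1 : s < 1) :
    ∃ K, 0 ≤ K ∧ ∀ i, ‖posVec hU k hb i‖ * s ^ i ≤ K := by
  have hs1 : s ^ 2 < 1 := by nlinarith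
  have hT := tsum_lintegral_branchVec_lt_top hU (s := s ^ 2) (by positivity) hs1 k
  set T := ∑' i : ℕ, ENNReal.ofReal ((s ^ 2) ^ i) *
    ∫⁻ x : ℝ, ‖((x : ℂ) ^ 2) • branchVec U k i x‖ₑ ^ 2 with hTdef
  refine ⟨Real.sqrt (1 + T.toReal), Real.sqrt_nonneg _, fun i => ?_⟩
  refine Real.le_sqrt_of_sq_le ?_
  have h : ENNReal.ofReal ((‖posVec hU k hb i‖ * s ^ i) ^ 2) ≤ 1 + T := by
    rw [mul_pow, ENNReal.ofReal_mul (by positivity), ENNReal.ofReal_pow (norm_nonneg _),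
      ofReal_norm, enorm_posVec_sq, mul_comm]
    calc ENNReal.ofReal ((s ^ i) ^ 2) * ∫⁻ x : ℝ, ‖((x : ℂ) ^ b) • branchVec U k i x‖ₑ ^ 2
        ≤ ENNReal.ofReal ((s ^ i) ^ 2) * (‖branchVec U k i‖ₑ ^ 2 +
          ∫⁻ x : ℝ, ‖((x : ℂ) ^ 2) • branchVec U k i x‖ₑ ^ 2) := by
          gcongr
          exact lintegral_pow_smul_sq_le hb _
      _ ≤ 1 + T := by
          rw [mul_add]
          gcongr
          · rw [← ofReal_norm, norm_branchVec, ENNReal.ofReal_one, one_pow, mul_one]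
            refine ENNReal.ofReal_le_one.mpr (pow_le_one₀ (by positivity) ?_)
            exact pow_le_one₀ h0.le h1.le
          · rw [pow_right_comm s i 2]
            exact ENNReal.le_tsum (f := fun i : ℕ => ENNReal.ofReal ((s ^ 2) ^ i) *
              ∫⁻ x : ℝ, ‖((x : ℂ) ^ 2) • branchVec U k i x‖ₑ ^ 2) i
  have h2 := ENNReal.toReal_mono (ENNReal.add_lt_top.mpr ⟨ENNReal.one_lt_top, hT⟩).ne h
  rwa [ENNReal.toReal_ofReal (by positivity), ENNReal.toReal_add ENNReal.one_ne_top hT.ne,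
    ENNReal.toReal_one] at h2

/-- The vector `x ↦ x^b W(x)`, with `W` the output wave function for a coherent state. -/
def posCoherent {U : Mode →ₗᵢ[ℂ] ModeTensor E} (hU : IsAdmissible U) (k : ℕ) {b : ℕ} (hb : b ≤ 2)
    (α : ℂ) : Lp E 2 (volume : Measure ℝ) :=
  ∑' i, coherentAmp α i • posVec hU k hb i

theorem hasSum_posCoherent {U : Mode →ₗᵢ[ℂ] ModeTensor E} (hU : IsAdmissible U)
    (k : ℕ) {b : ℕ} (hb : b ≤ 2) (α : ℂ) :
    HasSum (fun i => coherentAmp α i • posVec hU k hb i) (posCoherent hU k hb α) := by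
  obtain ⟨K, hK, h⟩ := norm_coherentAmp_le α
  -- Any rate strictly between `1/2` and `1` works; `1/2 = (3/4)(2/3)` leaves a geometric series of
  -- ratio `2/3`.
  obtain ⟨K', hK', h'⟩ := norm_posVec_le hU hb k (s := 3 / 4) (by norm_num) (by norm_num)
  refine (Summable.of_norm_bounded ((summable_geometric_of_lt_one (r := 2 / 3) (by norm_num)
    (by norm_num)).mul_left (K * K')) fun i => ?_).hasSum
  rw [norm_smul]
  have e : ((1 : ℝ) / 2) ^ i = (3 / 4) ^ i * (2 / 3) ^ i := by
    rw [← mul_pow]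
    norm_num
  calc ‖coherentAmp α i‖ * ‖posVec hU k hb i‖
      ≤ (K * (1 / 2) ^ i) * ‖posVec hU k hb i‖ := by
        gcongr
        exact h i
    _ = K * (‖posVec hU k hb i‖ * (3 / 4) ^ i) * (2 / 3) ^ i := by
        rw [e]
        ring
    _ ≤ K * K' * (2 / 3) ^ i := by
        gcongr
        exact h' i

/-- The identity is clear for partial sums; since both series converge in `L²`, closedness of
multiplication by `x^b` passes it to the limit. -/
theorem coeFn_posCoherent {U : Mode →ₗᵢ[ℂ] ModeTensor E} (hU : IsAdmissible U)
    (k : ℕ) {b : ℕ} (hb : b ≤ 2) (α : ℂ) :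
    posCoherent hU k hb α =ᵐ[volume] fun x : ℝ => ((x : ℂ) ^ b) • branchCoherent U k α x := by
  refine ae_eq_smul_of_tendsto (fun x : ℝ => (x : ℂ) ^ b)
    (hasSum_branchCoherent U k α).tendsto_sum_nat (hasSum_posCoherent hU k hb α).tendsto_sum_nat ?_
  intro n
  have h1 := Lp.coeFn_finsetSum (Finset.range n) (fun i => coherentAmp α i • posVec hU k hb i)
  have h2 := Lp.coeFn_finsetSum (Finset.range n) (fun i => coherentAmp α i • branchVec U k i)
  filter_upwards [h1, h2, ae_all_iff.mpr fun i => Lp.coeFn_smul (coherentAmp α i)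
      (posVec hU k hb i),
    ae_all_iff.mpr fun i => Lp.coeFn_smul (coherentAmp α i) (branchVec U k i),
    ae_all_iff.mpr fun i => coeFn_posVec hU hb k i] with x h1 h2 h3 h4 h5
  rw [h1, h2, Finset.sum_apply, Finset.sum_apply, Finset.smul_sum]
  refine Finset.sum_congr rfl fun i _ => ?_
  rw [h3, h4, Pi.smul_apply, Pi.smul_apply, h5, smul_comm]

/-- The matrix elements between number states of the power `a + b` of the position observable,
pulled back through the `k`-th branch. -/
def branchGram {U : Mode →ₗᵢ[ℂ] ModeTensor E} (hU : IsAdmissible U) {a b : ℕ} (ha : a ≤ 2)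
    (hb : b ≤ 2) (k i j : ℕ) : ℂ :=
  ⟪posVec hU k ha i, posVec hU k hb j⟫_ℂ

theorem subexponential_branchGram {U : Mode →ₗᵢ[ℂ] ModeTensor E} (hU : IsAdmissible U)
    {a b : ℕ} (ha : a ≤ 2) (hb : b ≤ 2) (k : ℕ) :
    Subexponential (branchGram hU ha hb k) := by
  intro s h0 h1
  obtain ⟨K, hK, h⟩ := norm_posVec_le hU ha k h0 h1
  obtain ⟨K', hK', h'⟩ := norm_posVec_le hU hb k h0 h1
  refine ⟨K * K', by positivity, fun i j => ?_⟩
  calc ‖branchGram hU ha hb k i j‖ * s ^ (i + j)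
      ≤ (‖posVec hU k ha i‖ * ‖posVec hU k hb j‖) * s ^ (i + j) := by
        gcongr
        exact norm_inner_le_norm _ _
    _ = (‖posVec hU k ha i‖ * s ^ i) * (‖posVec hU k hb j‖ * s ^ j) := by
        rw [pow_add]
        ring
    _ ≤ K * K' := by
        gcongr
        · exact h i
        · exact h' j

/-- The double series is absolutely summable, so it may be summed along rows and then over rows,
each sum being a continuous linear or antilinear image of `hasSum_posCoherent`. -/
theorem form_branchGram {U : Mode →ₗᵢ[ℂ] ModeTensor E} (hU : IsAdmissible U)
    {a b : ℕ} (ha : a ≤ 2) (hb : b ≤ 2) (k : ℕ) (z : ℝ × ℝ) :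
    form (branchGram hU ha hb k) z =
      ⟪posCoherent hU k ha (amplitude z), posCoherent hU k hb (amplitude z)⟫_ℂ := by
  have hsum := (subexponential_branchGram hU ha hb k).hasSum_form z
  have h1 : ∀ i, HasSum (fun j => star (coherentAmp (amplitude z) i) *
      coherentAmp (amplitude z) j * branchGram hU ha hb k i j)
      (star (coherentAmp (amplitude z) i) *
        ⟪posVec hU k ha i, posCoherent hU k hb (amplitude z)⟫_ℂ) := by
    intro i
    have h := ((hasSum_posCoherent hU k hb (amplitude z)).mapL
      (innerSL ℂ (posVec hU k ha i))).mul_left (star (coherentAmp (amplitude z) i))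
    refine h.congr_fun fun j => ?_
    simp only [innerSL_apply_apply, inner_smul_right, branchGram]
    ring
  have h2 := HasSum.prod_fiberwise hsum h1
  have h3 : HasSum (fun i => star (coherentAmp (amplitude z) i) *
        ⟪posVec hU k ha i, posCoherent hU k hb (amplitude z)⟫_ℂ)
      ⟪posCoherent hU k ha (amplitude z), posCoherent hU k hb (amplitude z)⟫_ℂ := by
    have h := ((hasSum_posCoherent hU k ha (amplitude z)).mapL
      (innerSL ℂ (posCoherent hU k hb (amplitude z)))).star
    simp only [innerSL_apply_apply, Complex.star_def, inner_conj_symm] at h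
    refine h.congr_fun fun i => ?_
    rw [inner_smul_left]
    rfl
  exact h2.unique h3

/-- A power is split as `x^a · x^b` between the two arguments, which reaches order four although
only `x²` times the wave function is known to be square integrable. -/
theorem inner_posCoherent {U : Mode →ₗᵢ[ℂ] ModeTensor E} (hU : IsAdmissible U)
    {a b : ℕ} (ha : a ≤ 2) (hb : b ≤ 2) (k : ℕ) (α : ℂ) :
    (fun x : ℝ => ((x ^ (a + b) * ‖branchCoherent U k α x‖ ^ 2 : ℝ) : ℂ)) =ᵐ[volume]
      fun x => ⟪posCoherent hU k ha α x, posCoherent hU k hb α x⟫_ℂ := by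
  filter_upwards [coeFn_posCoherent hU k ha α, coeFn_posCoherent hU k hb α] with x h1 h2
  rw [h1, h2, inner_smul_left, inner_smul_right, inner_self_eq_ofReal_norm_sq, map_pow,
    Complex.conj_ofReal]
  push_cast
  ring

theorem integrable_pow_mul_branchCoherent {U : Mode →ₗᵢ[ℂ] ModeTensor E} (hU : IsAdmissible U)
    {a b : ℕ} (ha : a ≤ 2) (hb : b ≤ 2) (k : ℕ) (α : ℂ) :
    Integrable (fun x : ℝ => x ^ (a + b) * ‖branchCoherent U k α x‖ ^ 2) := by
  have h := (L2.integrable_inner (𝕜 := ℂ) (posCoherent hU k ha α) (posCoherent hU k hb α)).congr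
    (inner_posCoherent hU ha hb k α).symm
  exact h.re

theorem integral_pow_mul_branchCoherent {U : Mode →ₗᵢ[ℂ] ModeTensor E} (hU : IsAdmissible U)
    {a b : ℕ} (ha : a ≤ 2) (hb : b ≤ 2) (k : ℕ) (z : ℝ × ℝ) :
    ((∫ x : ℝ, x ^ (a + b) * ‖branchCoherent U k (amplitude z) x‖ ^ 2 : ℝ) : ℂ) =
      form (branchGram hU ha hb k) z := by
  rw [form_branchGram, L2.inner_def, ← integral_complex_ofReal]
  exact integral_congr_ae (inner_posCoherent hU ha hb k _)

/-! ### Measurability and moments of the conditional law -/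

theorem measurable_branchDensity (U : Mode →ₗᵢ[ℂ] ModeTensor E) (k : ℕ) (α : ℂ) :
    Measurable fun x : ℝ => ‖branchCoherent U k α x‖ₑ ^ 2 :=
  (Lp.stronglyMeasurable _).enorm.pow_const 2

theorem stronglyMeasurable_branchCoherent (U : Mode →ₗᵢ[ℂ] ModeTensor E) (k : ℕ) :
    StronglyMeasurable fun z => branchCoherent U k (amplitude z) := by
  refine stronglyMeasurable_of_tendsto (f := fun n z => ∑ i ∈ Finset.range n,
    coherentAmp (amplitude z) i • branchVec U k i) Filter.atTop (fun n => ?_)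
    (tendsto_pi_nhds.mpr fun z => (hasSum_branchCoherent U k (amplitude z)).tendsto_sum_nat)
  refine Continuous.stronglyMeasurable (continuous_finsetSum _ fun i _ => ?_)
  exact (continuous_coherentAmp_amplitude i).smul continuous_const

/-- The mass of a set `t` is the squared norm of the restriction to `t`, a continuous function of
the `L²` vector; no jointly measurable representative of the density is needed. -/
theorem measurable_branchLaw (U : Mode →ₗᵢ[ℂ] ModeTensor E) (k : ℕ) :
    Measurable fun z => (volume : Measure ℝ).withDensity
      fun x => ‖branchCoherent U k (amplitude z) x‖ₑ ^ 2 := by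
  refine Measure.measurable_of_measurable_coe _ fun t ht => ?_
  have e : (fun z => (volume : Measure ℝ).withDensity
      (fun x => ‖branchCoherent U k (amplitude z) x‖ₑ ^ 2) t) =
      fun z => ‖LpToLpRestrictCLM ℝ E ℂ volume 2 t (branchCoherent U k (amplitude z))‖ₑ ^ 2 := by
    ext z
    rw [withDensity_apply _ ht, ← lintegral_enorm_sq_Lp]
    refine lintegral_congr_ae ?_
    filter_upwards [LpToLpRestrictCLM_coeFn ℂ t (branchCoherent U k (amplitude z))] with x hx
    rw [hx]
  rw [e]
  exact ((ContinuousLinearMap.continuous _).comp_stronglyMeasurable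
    (stronglyMeasurable_branchCoherent U k)).enorm.pow_const 2

theorem measurable_bobLaw (U : Mode →ₗᵢ[ℂ] ModeTensor E) :
    Measurable fun z => bobLaw U (amplitude z) := by
  refine Measure.measurable_of_measurable_coe _ fun t ht => ?_
  simp only [bobLaw_eq, Measure.finsetSum_apply, Measure.smul_apply]
  refine Finset.measurable_fun_sum _ fun k _ => ?_
  exact ((Measure.measurable_coe ht).comp (measurable_branchLaw U k)).const_mul (1 / 4)

theorem lintegral_bobLaw (U : Mode →ₗᵢ[ℂ] ModeTensor E) (α : ℂ) (f : ℝ → ℝ≥0∞) :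
    ∫⁻ y, f y ∂bobLaw U α =
      ∑ k ∈ Finset.range 4, (1 / 4 : ℝ≥0∞) * ∫⁻ x, ‖branchCoherent U k α x‖ₑ ^ 2 * f x := by
  rw [bobLaw_eq, lintegral_finsetSum_measure]
  refine Finset.sum_congr rfl fun k _ => ?_
  rw [lintegral_smul_measure, lintegral_withDensity_eq_lintegral_mul_non_measurable _
    (measurable_branchDensity U k α)
    (Filter.Eventually.of_forall fun x => ENNReal.pow_lt_top enorm_lt_top)]
  rfl

theorem isProbabilityMeasure_bobLaw (U : Mode →ₗᵢ[ℂ] ModeTensor E) (α : ℂ) :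
    IsProbabilityMeasure (bobLaw U α) := by
  constructor
  rw [← lintegral_one, lintegral_bobLaw]
  simp_rw [mul_one, lintegral_enorm_sq_Lp, ← ofReal_norm, norm_branchCoherent]
  simp only [ENNReal.ofReal_one, one_pow, mul_one, Finset.sum_const, Finset.card_range,
      nsmul_eq_mul]
  rw [one_div]
  exact ENNReal.mul_inv_cancel (by norm_num) (by norm_num)

theorem bobLaw_absolutelyContinuous (U : Mode →ₗᵢ[ℂ] ModeTensor E) (α : ℂ) :
    bobLaw U α ≪ volume := by
  intro t ht
  rw [bobLaw_eq, Measure.finsetSum_apply]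
  refine Finset.sum_eq_zero fun k _ => ?_
  rw [Measure.smul_apply, withDensity_absolutelyContinuous _ _ ht, smul_zero]

/-- The matrix elements between number states of the power `a + b` of the position observable,
pulled back through the symmetrized channel. -/
def posGram {U : Mode →ₗᵢ[ℂ] ModeTensor E} (hU : IsAdmissible U) {a b : ℕ} (ha : a ≤ 2)
    (hb : b ≤ 2) (i j : ℕ) : ℂ :=
  (1 / 4 : ℂ) * ∑ k ∈ Finset.range 4, branchGram hU ha hb k i j

theorem subexponential_posGram {U : Mode →ₗᵢ[ℂ] ModeTensor E} (hU : IsAdmissible U)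
    {a b : ℕ} (ha : a ≤ 2) (hb : b ≤ 2) :
    Subexponential (posGram hU ha hb) :=
  (Subexponential.sum _ _ fun k _ => subexponential_branchGram hU ha hb k).const_mul _

theorem form_posGram {U : Mode →ₗᵢ[ℂ] ModeTensor E} (hU : IsAdmissible U)
    {a b : ℕ} (ha : a ≤ 2) (hb : b ≤ 2) (z : ℝ × ℝ) :
    form (posGram hU ha hb) z =
      (1 / 4 : ℂ) * ∑ k ∈ Finset.range 4, form (branchGram hU ha hb k) z := by
  have h := (hasSum_sum fun k (_ : k ∈ Finset.range 4) =>
    (subexponential_branchGram hU ha hb k).hasSum_form z).mul_left (1 / 4 : ℂ)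
  rw [← h.tsum_eq]
  refine tsum_congr fun p => ?_
  rw [posGram, ← Finset.mul_sum]
  ring

theorem integral_pow_bobLaw {U : Mode →ₗᵢ[ℂ] ModeTensor E} (hU : IsAdmissible U)
    {a b : ℕ} (ha : a ≤ 2) (hb : b ≤ 2) (z : ℝ × ℝ) :
    ((∫ y, y ^ (a + b) ∂bobLaw U (amplitude z) : ℝ) : ℂ) = form (posGram hU ha hb) z := by
  have hfin : ∀ k, ∀ᵐ x : ℝ, ‖branchCoherent U k (amplitude z) x‖ₑ ^ 2 < ∞ := fun k =>
    Filter.Eventually.of_forall fun x => ENNReal.pow_lt_top enorm_lt_top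
  have e : ∀ k, (fun x : ℝ => (‖branchCoherent U k (amplitude z) x‖ₑ ^ 2).toReal • x ^ (a + b)) =
      fun x : ℝ => x ^ (a + b) * ‖branchCoherent U k (amplitude z) x‖ ^ 2 := by
    intro k
    ext x
    rw [ENNReal.toReal_pow, toReal_enorm, smul_eq_mul, mul_comm]
  rw [bobLaw_eq, integral_finsetSum_measure]
  · rw [form_posGram, Finset.mul_sum]
    push_cast
    refine Finset.sum_congr rfl fun k _ => ?_
    rw [integral_smul_measure, integral_withDensity_eq_integral_toReal_smul
      (measurable_branchDensity U k _) (hfin k), e, ← integral_pow_mul_branchCoherent hU ha hb]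
    simp
  · intro k _
    refine Integrable.smul_measure ?_ (by simp)
    rw [integrable_withDensity_iff_integrable_smul' (measurable_branchDensity U k _) (hfin k), e]
    exact integrable_pow_mul_branchCoherent hU ha hb k _

/-- In each branch the fourth moment is `‖x² W‖²`, the form with `a = b = 2`, and it is dominated by
the absolute values of its double series. -/
theorem lintegral_fourth_bobLaw_lt_top {U : Mode →ₗᵢ[ℂ] ModeTensor E} (hU : IsAdmissible U)
    {μ : Measure (ℝ × ℝ)} (hμ : GeometricDecay μ) :
    ∫⁻ z, ∫⁻ y, ‖y‖ₑ ^ 4 ∂bobLaw U (amplitude z) ∂μ < ∞ := by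
  have hk : ∀ k, ∫⁻ z, (∫⁻ x : ℝ, ‖branchCoherent U k (amplitude z) x‖ₑ ^ 2 * ‖x‖ₑ ^ 4) ∂μ < ∞ := by
    intro k
    have h := tsum_lintegral_form_lt_top hμ
      (subexponential_branchGram hU le_rfl le_rfl k)
    refine lt_of_le_of_lt ?_ h
    rw [← lintegral_tsum fun p => (continuous_form_term _ p).enorm.aemeasurable]
    refine lintegral_mono fun z => ?_
    refine le_trans (le_of_eq ?_) enorm_tsum_le_tsum_enorm
    change _ = ‖form (branchGram hU le_rfl le_rfl k) z‖ₑ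
    rw [form_branchGram, inner_self_eq_ofReal_norm_sq]
    have e1 : ‖((‖posCoherent hU k le_rfl (amplitude z)‖ ^ 2 : ℝ) : ℂ)‖ₑ =
        ‖posCoherent hU k (le_refl 2) (amplitude z)‖ₑ ^ 2 := by
      rw [← ofReal_norm, Complex.norm_real, norm_pow, norm_norm,
        ENNReal.ofReal_pow (norm_nonneg _), ofReal_norm]
    refine Eq.trans ?_ e1.symm
    rw [← lintegral_enorm_sq_Lp]
    refine lintegral_congr_ae ?_
    filter_upwards [coeFn_posCoherent hU k le_rfl (amplitude z)] with x hx
    rw [hx, enorm_smul, mul_pow, enorm_pow, ← pow_mul, mul_comm]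
    congr 2
    rw [← ofReal_norm, ← ofReal_norm, Complex.norm_real]
  simp_rw [lintegral_bobLaw]
  have hm : ∀ k, Measurable fun z =>
      ∫⁻ x : ℝ, ‖branchCoherent U k (amplitude z) x‖ₑ ^ 2 * ‖x‖ₑ ^ 4 := by
    intro k
    have h := (Measure.measurable_lintegral (f := fun x : ℝ => ‖x‖ₑ ^ 4) (by fun_prop)).comp
      (measurable_branchLaw U k)
    convert h using 2 with z
    exact (lintegral_withDensity_eq_lintegral_mul _ (measurable_branchDensity U k _)
      (by fun_prop)).symm
  rw [lintegral_finsetSum _ fun k _ => (hm k).const_mul _]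
  refine ENNReal.sum_lt_top.mpr fun k _ => ?_
  rw [lintegral_const_mul _ (hm k)]
  exact ENNReal.mul_lt_top (by simp) (hk k)

end Moments

/-! ## The annihilation operator on quadratic forms -/

section Annihilate

/-- The matrix of the quadratic form multiplied by the amplitude `α`: the coherent states are
eigenvectors of the annihilation operator. -/
def annihilate (G : ℕ → ℕ → ℂ) (i j : ℕ) : ℂ := (Real.sqrt j : ℂ) * G i (j - 1)

/-- Half of the exponential weight absorbs the factor `√j`, since `j tʲ` is bounded for `t = √s`. -/
theorem Subexponential.annihilate {G : ℕ → ℕ → ℂ} (hG : Subexponential G) :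
    Subexponential (annihilate G) := by
  intro s h0 h1
  have ht0 : 0 < Real.sqrt s := Real.sqrt_pos.mpr h0
  have ht1 : Real.sqrt s < 1 := by rwa [Real.sqrt_lt' one_pos, one_pow]
  set t := Real.sqrt s
  obtain ⟨K, hK, h⟩ := hG t ht0 ht1
  have hsum := summable_pow_mul_geometric_of_norm_lt_one 1
    (by rwa [Real.norm_eq_abs, abs_of_pos ht0] : ‖t‖ < 1)
  refine ⟨K * ∑' n : ℕ, (n : ℝ) ^ 1 * t ^ n, mul_nonneg hK (tsum_nonneg fun n => by positivity),
    fun i j => ?_⟩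
  have hj : (j : ℝ) * t ^ j ≤ ∑' n : ℕ, (n : ℝ) ^ 1 * t ^ n := by
    simpa using hsum.le_tsum j fun n _ => by positivity
  have hsq : Real.sqrt j ≤ j := by
    rw [Real.sqrt_le_left (by positivity)]
    exact_mod_cast Nat.le_self_pow two_ne_zero j
  have e : s ^ (i + j) = t ^ (i + j) * t ^ (i + j) := by
    rw [← mul_pow, Real.mul_self_sqrt h0.le]
  rw [CVQKD.annihilate, norm_mul, Complex.norm_real, Real.norm_eq_abs,
    abs_of_nonneg (Real.sqrt_nonneg _), e]
  calc Real.sqrt j * ‖G i (j - 1)‖ * (t ^ (i + j) * t ^ (i + j))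
      = (‖G i (j - 1)‖ * t ^ (i + j)) * (Real.sqrt j * t ^ (i + j)) := by ring
    _ ≤ (‖G i (j - 1)‖ * t ^ (i + (j - 1))) * (j * t ^ j) := by
        gcongr ?_ * ?_
        · exact mul_le_mul_of_nonneg_left
            (pow_le_pow_of_le_one ht0.le ht1.le (by omega)) (norm_nonneg _)
        · exact mul_le_mul hsq (pow_le_pow_of_le_one ht0.le ht1.le (by omega)) (by positivity)
            (by positivity)
    _ ≤ _ := by
        gcongr
        exact h _ _

/-- Shifting the second index matches `α cⱼ = √(j + 1) cⱼ₊₁`. Column `0` lies outside the range of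
the shift and vanishes through `√0`, which also makes the truncated `j - 1` irrelevant. -/
theorem form_annihilate {G : ℕ → ℕ → ℂ} (hG : Subexponential G) (z : ℝ × ℝ) :
    form (annihilate G) z = amplitude z * form G z := by
  have h := (hG.hasSum_form z).mul_left (amplitude z)
  refine HasSum.tsum_eq ?_
  have hinj : Function.Injective fun p : ℕ × ℕ => (p.1, p.2 + 1) := by
    rintro ⟨a, b⟩ ⟨c, d⟩ h
    simpa using h
  rw [← hinj.hasSum_iff]
  · refine h.congr_fun fun p => ?_
    simp only [Function.comp, annihilate, Nat.add_sub_cancel]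
    have := mul_coherentAmp (amplitude z) p.2
    linear_combination (-(star (coherentAmp (amplitude z) p.1)) * G p.1 p.2) * this
  · rintro ⟨i, j⟩ hp
    rcases j with _ | j
    · simp [annihilate]
    · exact absurd ⟨(i, j), rfl⟩ hp

theorem Subexponential.conjTranspose {G : ℕ → ℕ → ℂ} (hG : Subexponential G) :
    Subexponential fun i j => star (G j i) := by
  intro s h0 h1
  obtain ⟨K, hK, h⟩ := hG s h0 h1
  refine ⟨K, hK, fun i j => ?_⟩
  rw [norm_star, add_comm i j]
  exact h j i

theorem Subexponential.hasSum_form_star {G : ℕ → ℕ → ℂ} (hG : Subexponential G) (z : ℝ × ℝ) :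
    HasSum (fun p : ℕ × ℕ => star (coherentAmp (amplitude z) p.1) *
      coherentAmp (amplitude z) p.2 * star (G p.2 p.1)) (star (form G z)) := by
  have h := (hG.hasSum_form z).star
  rw [← (Equiv.prodComm ℕ ℕ).hasSum_iff]
  refine h.congr_fun fun p => ?_
  simp only [Function.comp, Equiv.prodComm_apply, Prod.fst_swap, Prod.snd_swap, star_mul, star_star]
  ring

theorem Subexponential.add {G H : ℕ → ℕ → ℂ} (hG : Subexponential G) (hH : Subexponential H) :
    Subexponential fun i j => G i j + H i j := by
  intro s h0 h1
  obtain ⟨K, hK, h⟩ := hG s h0 h1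
  obtain ⟨K', hK', h'⟩ := hH s h0 h1
  refine ⟨K + K', by positivity, fun i j => ?_⟩
  calc ‖G i j + H i j‖ * s ^ (i + j) ≤ (‖G i j‖ + ‖H i j‖) * s ^ (i + j) := by
        gcongr
        exact norm_add_le _ _
    _ ≤ _ := by
        rw [add_mul]
        exact add_le_add (h i j) (h' i j)

variable {E : Type*} [NormedAddCommGroup E] [InnerProductSpace ℂ E] [CompleteSpace E]

/-- The matrix of the quadratic form `z ↦ E[Q_A Q_B | z]`. -/
def crossGram {U : Mode →ₗᵢ[ℂ] ModeTensor E} (hU : IsAdmissible U) (i j : ℕ) : ℂ :=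
  ((Real.sqrt 2)⁻¹ : ℂ) * (annihilate (posGram hU (Nat.zero_le 2) one_le_two) i j +
    star (annihilate (posGram hU (Nat.zero_le 2) one_le_two) j i))

theorem subexponential_crossGram {U : Mode →ₗᵢ[ℂ] ModeTensor E} (hU : IsAdmissible U) :
    Subexponential (crossGram hU) := by
  have h := (subexponential_posGram hU (Nat.zero_le 2) one_le_two).annihilate
  exact (h.add h.conjTranspose).const_mul _

/-- Here `Q_A = (α + ᾱ)/√2`. The conditional mean of `Q_B` is real, so multiplying it by `ᾱ` gives
the conjugate of the form for `α`, that is, the form of the adjoint matrix. -/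
theorem form_crossGram {U : Mode →ₗᵢ[ℂ] ModeTensor E} (hU : IsAdmissible U) (z : ℝ × ℝ) :
    form (crossGram hU) z = ((z.1 * ∫ y, y ∂bobLaw U (amplitude z) : ℝ) : ℂ) := by
  have hG := subexponential_posGram hU (Nat.zero_le 2) one_le_two
  have h := ((hG.annihilate.hasSum_form z).add (hG.annihilate.hasSum_form_star z)).mul_left
    ((Real.sqrt 2)⁻¹ : ℂ)
  have h1 := integral_pow_bobLaw hU (Nat.zero_le 2) one_le_two z
  simp only [zero_add, pow_one] at h1
  have h2 : form (crossGram hU) z = ((Real.sqrt 2)⁻¹ : ℂ) *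
      (form (annihilate (posGram hU (Nat.zero_le 2) one_le_two)) z +
      star (form (annihilate (posGram hU (Nat.zero_le 2) one_le_two)) z)) := by
    rw [← h.tsum_eq]
    refine tsum_congr fun p => ?_
    rw [crossGram]
    ring
  rw [h2, form_annihilate hG, ← h1, star_mul, Complex.star_def,
    Complex.conj_ofReal, mul_comm (amplitude z), ← mul_add, Complex.add_conj,
    fst_eq_sqrt_two_mul_re_amplitude z]
  have hs : (Real.sqrt 2 : ℂ) ≠ 0 := by
    simp only [ne_eq, Complex.ofReal_eq_zero]
    positivity
  have hs2 : (Real.sqrt 2 : ℂ) ^ 2 = 2 := by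
    rw [← Complex.ofReal_pow, Real.sq_sqrt (by norm_num)]
    norm_num
  push_cast
  field_simp
  rw [hs2]
  ring

end Annihilate

/-! ## The joint law -/

section Joint

variable {E : Type*} [NormedAddCommGroup E] [InnerProductSpace ℂ E] [CompleteSpace E]

/-- The homodyne outcome as a Markov kernel from the modulation. -/
def bobKernel (U : Mode →ₗᵢ[ℂ] ModeTensor E) : Kernel (ℝ × ℝ) ℝ :=
  ⟨fun z => bobLaw U (amplitude z), measurable_bobLaw U⟩

instance isMarkovKernel_bobKernel (U : Mode →ₗᵢ[ℂ] ModeTensor E) : IsMarkovKernel (bobKernel U) :=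
  ⟨fun z => isProbabilityMeasure_bobLaw U (amplitude z)⟩

/-- The Markov kernel from the modulation to the joint outcome. -/
def jointKernel (U : Mode →ₗᵢ[ℂ] ModeTensor E) : Kernel (ℝ × ℝ) (ℝ × ℝ) :=
  (Kernel.deterministic Prod.fst measurable_fst) ×ₖ bobKernel U

instance isMarkovKernel_jointKernel (U : Mode →ₗᵢ[ℂ] ModeTensor E) :
    IsMarkovKernel (jointKernel U) := by
  unfold jointKernel
  infer_instance

theorem jointKernel_apply (U : Mode →ₗᵢ[ℂ] ModeTensor E) (z : ℝ × ℝ) :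
    jointKernel U z = (bobLaw U (amplitude z)).map fun y => (z.1, y) := by
  have := isProbabilityMeasure_bobLaw U (amplitude z)
  rw [jointKernel, Kernel.prod_apply, Kernel.deterministic_apply]
  exact Measure.dirac_prod z.1

theorem jointLaw_eq (μ : Measure (ℝ × ℝ)) (U : Mode →ₗᵢ[ℂ] ModeTensor E) :
    jointLaw μ U = μ.bind (jointKernel U) := by
  unfold jointLaw
  congr 1
  ext1 z
  exact (jointKernel_apply U z).symm

theorem lintegral_jointKernel (U : Mode →ₗᵢ[ℂ] ModeTensor E) (z : ℝ × ℝ) {f : ℝ × ℝ → ℝ≥0∞}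
    (hf : Measurable f) :
    ∫⁻ w, f w ∂jointKernel U z = ∫⁻ y, f (z.1, y) ∂bobLaw U (amplitude z) := by
  rw [jointKernel_apply, lintegral_map hf (by fun_prop)]

theorem lintegral_jointLaw (μ : Measure (ℝ × ℝ)) (U : Mode →ₗᵢ[ℂ] ModeTensor E)
    {f : ℝ × ℝ → ℝ≥0∞} (hf : Measurable f) :
    ∫⁻ w, f w ∂jointLaw μ U = ∫⁻ z, ∫⁻ y, f (z.1, y) ∂bobLaw U (amplitude z) ∂μ := by
  rw [jointLaw_eq, Measure.lintegral_bind (jointKernel U).measurable.aemeasurable hf.aemeasurable]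
  simp_rw [lintegral_jointKernel U _ hf]

theorem integral_jointLaw (μ : Measure (ℝ × ℝ)) [SFinite μ] (U : Mode →ₗᵢ[ℂ] ModeTensor E)
    {f : ℝ × ℝ → ℝ} (hfc : Continuous f) (hf : Integrable f (jointLaw μ U)) :
    ∫ w, f w ∂jointLaw μ U = ∫ z, ∫ y, f (z.1, y) ∂bobLaw U (amplitude z) ∂μ := by
  rw [jointLaw_eq] at hf ⊢
  rw [Measure.comp_eq_comp_const_apply] at hf ⊢
  rw [Kernel.integral_comp hf, Kernel.const_apply]
  refine integral_congr_ae (Filter.Eventually.of_forall fun z => ?_)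
  simp only [jointKernel_apply]
  rw [integral_map (by fun_prop) hfc.aestronglyMeasurable]

/-- The properties of a modulation on which the comparison depends. -/
structure IsModulation (μ : Measure (ℝ × ℝ)) : Prop where
  isProbabilityMeasure : IsProbabilityMeasure μ
  geometricDecay : GeometricDecay μ
  map_neg : μ.map (fun z => -z) = μ
  fourth : ∫⁻ z, ‖z.1‖ₑ ^ 4 ∂μ < ∞

/-! ### Integrability, symmetry and positivity under a modulation -/

variable {μ : Measure (ℝ × ℝ)}

theorem IsModulation.isProbabilityMeasure_jointLaw (hμ : IsModulation μ)
    (U : Mode →ₗᵢ[ℂ] ModeTensor E) : IsProbabilityMeasure (jointLaw μ U) := by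
  have := hμ.isProbabilityMeasure
  rw [jointLaw_eq]
  infer_instance

theorem memLp_four {X : Type*} [MeasurableSpace X] {P : Measure X} {f : X → ℝ}
    (hf : Measurable f) (h : ∫⁻ w, ‖f w‖ₑ ^ 4 ∂P < ∞) : MemLp f 4 P := by
  refine ⟨hf.aestronglyMeasurable, ?_⟩
  rw [eLpNorm_lt_top_iff_lintegral_rpow_enorm_lt_top (by simp) (by simp)]
  simpa using h

theorem IsModulation.memLp_fst (hμ : IsModulation μ) (U : Mode →ₗᵢ[ℂ] ModeTensor E) :
    MemLp Prod.fst 4 (jointLaw μ U) := by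
  refine memLp_four measurable_fst ?_
  rw [lintegral_jointLaw μ U (by fun_prop)]
  have e : ∀ z : ℝ × ℝ, ∫⁻ _, ‖z.1‖ₑ ^ 4 ∂bobLaw U (amplitude z) = ‖z.1‖ₑ ^ 4 := by
    intro z
    have := isProbabilityMeasure_bobLaw U (amplitude z)
    simp
  simp_rw [e]
  exact hμ.fourth

theorem IsModulation.memLp_snd (hμ : IsModulation μ) {U : Mode →ₗᵢ[ℂ] ModeTensor E}
    (hU : IsAdmissible U) : MemLp Prod.snd 4 (jointLaw μ U) := by
  refine memLp_four measurable_snd ?_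
  rw [lintegral_jointLaw μ U (by fun_prop)]
  exact lintegral_fourth_bobLaw_lt_top hU hμ.geometricDecay

theorem IsModulation.integrable_monomial (hμ : IsModulation μ) {U : Mode →ₗᵢ[ℂ] ModeTensor E}
    (hU : IsAdmissible U) {a b : ℕ} (hab : a + b ≤ 4) :
    Integrable (fun w : ℝ × ℝ => w.1 ^ a * w.2 ^ b) (jointLaw μ U) := by
  have := hμ.isProbabilityMeasure_jointLaw U
  have h1 : Integrable (fun w : ℝ × ℝ => ‖w.1‖ ^ 4) (jointLaw μ U) :=
    (hμ.memLp_fst U).integrable_norm_pow (p := 4) (by norm_num)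
  have h2 : Integrable (fun w : ℝ × ℝ => ‖w.2‖ ^ 4) (jointLaw μ U) :=
    (hμ.memLp_snd hU).integrable_norm_pow (p := 4) (by norm_num)
  refine ((integrable_const (1 : ℝ)).add (h1.add h2)).mono' (by fun_prop)
    (Filter.Eventually.of_forall fun w => ?_)
  simp only [Pi.add_apply, norm_mul, norm_pow]
  set M := max 1 (max ‖w.1‖ ‖w.2‖) with hM
  have hM1 : 1 ≤ M := le_max_left _ _
  have hx : ‖w.1‖ ≤ M := (le_max_left _ _).trans (le_max_right _ _)
  have hy : ‖w.2‖ ≤ M := (le_max_right _ _).trans (le_max_right _ _)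
  calc ‖w.1‖ ^ a * ‖w.2‖ ^ b ≤ M ^ a * M ^ b := by gcongr
    _ = M ^ (a + b) := (pow_add _ _ _).symm
    _ ≤ M ^ 4 := pow_le_pow_right₀ hM1 hab
    _ ≤ 1 + (‖w.1‖ ^ 4 + ‖w.2‖ ^ 4) := by
        have p1 : 0 ≤ ‖w.1‖ ^ 4 := by positivity
        have p2 : 0 ≤ ‖w.2‖ ^ 4 := by positivity
        rcases max_choice 1 (max ‖w.1‖ ‖w.2‖) with h | h
        · rw [hM, h, one_pow]
          linarith
        · rcases max_choice ‖w.1‖ ‖w.2‖ with h' | h'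
          · rw [hM, h, h']
            linarith
          · rw [hM, h, h']
            linarith

/-- Evenness of the modulation is combined with `bobLaw_neg`, which reflects the outcome when the
amplitude is reflected. -/
theorem IsModulation.map_neg_jointLaw (hμ : IsModulation μ) (U : Mode →ₗᵢ[ℂ] ModeTensor E) :
    (jointLaw μ U).map (fun w => -w) = jointLaw μ U := by
  refine Measure.ext_of_lintegral _ fun f hf => ?_
  rw [lintegral_map hf measurable_neg, lintegral_jointLaw μ U hf,
    lintegral_jointLaw μ U (f := fun w => f (-w)) (by fun_prop)]
  have hF : Measurable fun z => ∫⁻ y, f (z.1, y) ∂bobLaw U (amplitude z) := by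
    simp_rw [← lintegral_jointKernel U _ hf]
    exact hf.lintegral_kernel
  conv_rhs => rw [← hμ.map_neg, lintegral_map hF measurable_neg]
  refine lintegral_congr fun z => ?_
  rw [amplitude_neg, bobLaw_neg, lintegral_map (by fun_prop) measurable_neg]
  rfl

/-- Applied to the coordinates it shows that both means vanish, so that central moments are raw
moments. -/
theorem IsModulation.integral_odd (hμ : IsModulation μ) (U : Mode →ₗᵢ[ℂ] ModeTensor E)
    {f : ℝ × ℝ → ℝ} (hf : Continuous f) (hodd : ∀ w, f (-w) = -f w) :
    ∫ w, f w ∂jointLaw μ U = 0 := by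
  have h : ∫ w, f w ∂jointLaw μ U = -∫ w, f w ∂jointLaw μ U := by
    conv_lhs => rw [← hμ.map_neg_jointLaw U, integral_map (by fun_prop) hf.aestronglyMeasurable]
    simp_rw [hodd]
    rw [integral_neg]
  linarith

theorem IsModulation.centralMoment₂_eq (hμ : IsModulation μ) (U : Mode →ₗᵢ[ℂ] ModeTensor E)
    (a b : ℕ) : centralMoment₂ (jointLaw μ U) a b = ∫ w, w.1 ^ a * w.2 ^ b ∂jointLaw μ U := by
  unfold centralMoment₂
  rw [hμ.integral_odd U continuous_fst (fun _ => rfl),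
    hμ.integral_odd U continuous_snd (fun _ => rfl)]
  simp

theorem IsModulation.γ₂₂_eq_integral_form (hμ : IsModulation μ) {U : Mode →ₗᵢ[ℂ] ModeTensor E}
    (hU : IsAdmissible U) : (γ₂₂ (jointLaw μ U) : ℂ) =
      ∫ z, form (posGram hU (Nat.zero_le 2) le_rfl) z ∂μ := by
  have := hμ.isProbabilityMeasure
  rw [γ₂₂, hμ.centralMoment₂_eq, integral_jointLaw μ U (by fun_prop)
    (hμ.integrable_monomial hU (by norm_num)), ← integral_complex_ofReal]
  refine integral_congr_ae (Filter.Eventually.of_forall fun z => ?_)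
  simp only [← integral_pow_bobLaw, pow_zero, one_mul, zero_add]

theorem IsModulation.γ₁₂_eq_integral_form (hμ : IsModulation μ) {U : Mode →ₗᵢ[ℂ] ModeTensor E}
    (hU : IsAdmissible U) : (γ₁₂ (jointLaw μ U) : ℂ) = ∫ z, form (crossGram hU) z ∂μ := by
  have := hμ.isProbabilityMeasure
  rw [γ₁₂, hμ.centralMoment₂_eq, integral_jointLaw μ U (by fun_prop)
    (hμ.integrable_monomial hU (by norm_num)), ← integral_complex_ofReal]
  refine integral_congr_ae (Filter.Eventually.of_forall fun z => ?_)
  simp only [form_crossGram, pow_one]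
  rw [integral_const_mul]

theorem IsModulation.ofReal_γ₁₁ (hμ : IsModulation μ) {U : Mode →ₗᵢ[ℂ] ModeTensor E}
    (hU : IsAdmissible U) :
    ENNReal.ofReal (γ₁₁ (jointLaw μ U)) = ∫⁻ z, ENNReal.ofReal (z.1 ^ 2) ∂μ := by
  have hi := hμ.integrable_monomial hU (a := 2) (b := 0) (by norm_num)
  simp only [pow_zero, mul_one] at hi
  rw [γ₁₁, hμ.centralMoment₂_eq]
  simp only [pow_zero, mul_one]
  rw [ofReal_integral_eq_lintegral_ofReal hi (Filter.Eventually.of_forall fun w => sq_nonneg _),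
    lintegral_jointLaw μ U (by fun_prop)]
  refine lintegral_congr fun z => ?_
  have := isProbabilityMeasure_bobLaw U (amplitude z)
  simp

theorem IsModulation.γ₁₁_nonneg (hμ : IsModulation μ) (U : Mode →ₗᵢ[ℂ] ModeTensor E) :
    0 ≤ γ₁₁ (jointLaw μ U) := by
  rw [γ₁₁, hμ.centralMoment₂_eq]
  exact integral_nonneg fun w => by positivity

/-- Every conditional law of `Q_B` has a density and hence no atom at `0`. The denominators of `c₁`
and `c₂` are positive for this reason. -/
theorem ae_snd_ne_zero_jointLaw (μ : Measure (ℝ × ℝ)) (U : Mode →ₗᵢ[ℂ] ModeTensor E) :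
    ∀ᵐ w ∂jointLaw μ U, w.2 ≠ 0 := by
  have hms : MeasurableSet {w : ℝ × ℝ | w.2 = 0} := measurable_snd (measurableSet_singleton 0)
  have h : jointLaw μ U {w : ℝ × ℝ | w.2 = 0} = 0 := by
    rw [← lintegral_indicator_one hms, lintegral_jointLaw μ U (measurable_one.indicator hms)]
    refine lintegral_eq_zero_of_ae_eq_zero (Filter.Eventually.of_forall fun z => ?_)
    have h0 := bobLaw_absolutelyContinuous U (amplitude z)
      (measure_singleton (μ := (volume : Measure ℝ)) 0)
    refine lintegral_eq_zero_of_ae_eq_zero ?_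
    filter_upwards [measure_eq_zero_iff_ae_notMem.mp h0] with y hy
    simpa [Set.indicator_apply] using hy
  filter_upwards [measure_eq_zero_iff_ae_notMem.mp h] with w hw
  exact hw

theorem IsModulation.fourthMoment_pos (hμ : IsModulation μ) {U : Mode →ₗᵢ[ℂ] ModeTensor E}
    (hU : IsAdmissible U) : 0 < centralMoment₂ (jointLaw μ U) 0 4 := by
  have := hμ.isProbabilityMeasure_jointLaw U
  rw [hμ.centralMoment₂_eq, integral_pos_iff_support_of_nonneg (fun w => by positivity)
    (hμ.integrable_monomial hU (by norm_num))]
  have h : (Function.support fun w : ℝ × ℝ => w.1 ^ 0 * w.2 ^ 4) =ᵐ[jointLaw μ U] Set.univ := by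
    rw [Filter.eventuallyEq_univ]
    filter_upwards [ae_snd_ne_zero_jointLaw μ U] with w hw
    simpa using hw
  rw [measure_congr h]
  simp

theorem IsModulation.mixedMoment_pos (hμ : IsModulation μ) {U : Mode →ₗᵢ[ℂ] ModeTensor E}
    (hU : IsAdmissible U) (h11 : 0 < γ₁₁ (jointLaw μ U)) :
    0 < centralMoment₂ (jointLaw μ U) 2 2 := by
  rw [γ₁₁, hμ.centralMoment₂_eq, integral_pos_iff_support_of_nonneg (fun w => by positivity)
    (hμ.integrable_monomial hU (by norm_num))] at h11
  rw [hμ.centralMoment₂_eq, integral_pos_iff_support_of_nonneg (fun w => by positivity)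
    (hμ.integrable_monomial hU (by norm_num))]
  refine h11.trans_le (measure_mono_ae ?_)
  filter_upwards [ae_snd_ne_zero_jointLaw μ U] with w hw h
  have h' : w.1 ^ 2 * w.2 ^ 0 ≠ 0 := h
  have h1 : w.1 ≠ 0 := by
    rintro h0
    simp [h0] at h'
  exact mul_ne_zero (pow_ne_zero _ h1) (pow_ne_zero _ hw)

/-- Nonnegativity of the variance; it provides the trivial bounds on `γ₂₂` and `γ₁₂`. -/
theorem abs_integral_le_sqrt_integral_sq {X : Type*} [MeasurableSpace X] {P : Measure X}
    [IsProbabilityMeasure P] {f : X → ℝ} (hf : MemLp f 2 P) :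
    |∫ w, f w ∂P| ≤ Real.sqrt (∫ w, f w ^ 2 ∂P) := by
  refine Real.abs_le_sqrt ?_
  have h := variance_nonneg f P
  rw [variance_eq_sub hf] at h
  simpa using h

theorem IsModulation.abs_γ₂₂_le (hμ : IsModulation μ) {U : Mode →ₗᵢ[ℂ] ModeTensor E}
    (hU : IsAdmissible U) :
    |γ₂₂ (jointLaw μ U)| ≤ Real.sqrt (centralMoment₂ (jointLaw μ U) 0 4) := by
  have := hμ.isProbabilityMeasure_jointLaw U
  rw [γ₂₂, hμ.centralMoment₂_eq, hμ.centralMoment₂_eq]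
  have e : ∀ w : ℝ × ℝ, w.1 ^ 0 * w.2 ^ 4 = (w.1 ^ 0 * w.2 ^ 2) ^ 2 := fun w => by ring
  simp_rw [e]
  refine abs_integral_le_sqrt_integral_sq ((memLp_two_iff_integrable_sq (by fun_prop)).mpr ?_)
  simp_rw [← e]
  exact hμ.integrable_monomial hU (by norm_num)

theorem IsModulation.abs_γ₁₂_le (hμ : IsModulation μ) {U : Mode →ₗᵢ[ℂ] ModeTensor E}
    (hU : IsAdmissible U) :
    |γ₁₂ (jointLaw μ U)| ≤ Real.sqrt (centralMoment₂ (jointLaw μ U) 2 2) := by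
  have := hμ.isProbabilityMeasure_jointLaw U
  rw [γ₁₂, hμ.centralMoment₂_eq, hμ.centralMoment₂_eq]
  have e : ∀ w : ℝ × ℝ, w.1 ^ 2 * w.2 ^ 2 = (w.1 ^ 1 * w.2 ^ 1) ^ 2 := fun w => by ring
  simp_rw [e]
  refine abs_integral_le_sqrt_integral_sq ((memLp_two_iff_integrable_sq (by fun_prop)).mpr ?_)
  simp_rw [← e]
  exact hμ.integrable_monomial hU (by norm_num)

end Joint

/-! ## The two modulations -/

section Modulations

theorem map_neg_prod {μ : Measure ℝ} [SFinite μ] (h : μ.map (fun x => -x) = μ) :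
    (μ.prod μ).map (fun z => -z) = μ.prod μ := by
  have h2 := Measure.map_prod_map μ μ measurable_neg measurable_neg
  conv_rhs => rw [← h]
  exact h2.symm

theorem isModulation_discreteModulation {m : ℕ} (hm : 0 < m) (N : ℝ≥0) :
    IsModulation (discreteModulation m N) := by
  have := isProbabilityMeasure_gaussHermiteLaw m hm N
  refine ⟨?_, geometricDecay_discreteModulation m N hm,
    map_neg_prod (map_neg_gaussHermiteLaw m N), ?_⟩
  · unfold discreteModulation
    infer_instance
  · exact lintegral_discreteModulation_lt_top m N (by fun_prop) hm
      fun z => ENNReal.pow_lt_top enorm_lt_top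

theorem isModulation_gaussianModulation {N : ℝ≥0} (hN : 0 < N) :
    IsModulation (gaussianModulation N) := by
  refine ⟨?_, geometricDecay_gaussianModulation hN, map_neg_prod ?_, ?_⟩
  · unfold gaussianModulation
    infer_instance
  · rw [gaussianReal_map_neg, neg_zero]
  · rw [gaussianModulation, lintegral_fst_prod (f := fun x => ‖x‖ₑ ^ 4) (by fun_prop)]
    have h := memLp_id_gaussianReal (μ := 0) (v := N) 4
    have h2 := (eLpNorm_lt_top_iff_lintegral_rpow_enorm_lt_top (p := 4) (by simp) (by simp)).mp h.2
    simpa using h2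

theorem lintegral_sq_discreteModulation {m : ℕ} (hm : 2 ≤ m) (N : ℝ≥0) :
    ∫⁻ z, ENNReal.ofReal (z.1 ^ 2) ∂discreteModulation m N = N := by
  have := isProbabilityMeasure_gaussHermiteLaw m (by omega) N
  rw [discreteModulation, lintegral_fst_prod (f := fun x => ENNReal.ofReal (x ^ 2)) (by fun_prop),
    lintegral_sq_gaussHermiteLaw m hm]

theorem lintegral_sq_gaussianModulation (N : ℝ≥0) :
    ∫⁻ z, ENNReal.ofReal (z.1 ^ 2) ∂gaussianModulation N = N := by
  rw [gaussianModulation, lintegral_fst_prod (f := fun x => ENNReal.ofReal (x ^ 2)) (by fun_prop)]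
  have hL := memLp_id_gaussianReal (μ := 0) (v := N) 2
  have h := variance_eq_sub hL
  rw [variance_id_gaussianReal] at h
  simp only [Pi.pow_apply, id_eq, integral_id_gaussianReal] at h
  have hi : Integrable (fun x : ℝ => x ^ 2) (gaussianReal 0 N) := hL.integrable_sq
  rw [← ofReal_integral_eq_lintegral_ofReal hi
    (Filter.Eventually.of_forall fun x => sq_nonneg _)]
  rw [show ∫ x, x ^ 2 ∂gaussianReal 0 N = (N : ℝ) by linarith, ENNReal.ofReal_coe_nnreal]

end Modulations

/-- The right-hand side is `ε (S + T + D)`. For `ε ≤ 1` the quadratic bound suffices because `ε² D ≤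
ε D`; for `ε ≥ 1` the trivial bound `S + T` does. -/
theorem abs_sub_le_of_quadratic_bound {x y S T D ε : ℝ} (hS : 0 < S) (hx : |x| ≤ S) (hy : |y| ≤ T)
    (hD : 0 ≤ D) (hε : 0 ≤ ε) (h : |x - y| ≤ ε ^ 2 * D) :
    |x - y| ≤ ε * (1 + (T + D) / S) * S := by
  have hT : 0 ≤ T := (abs_nonneg y).trans hy
  have e : ε * (1 + (T + D) / S) * S = ε * (S + T + D) := by
    field_simp
    ring
  rw [e]
  rcases le_total ε 1 with h1 | h1
  · nlinarith [mul_nonneg hε hD, mul_nonneg hε hT, mul_nonneg hε hS.le,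
      mul_nonneg (mul_nonneg hε hD) (sub_nonneg.mpr h1)]
  · have h2 : |x - y| ≤ S + T := (abs_sub x y).trans (add_le_add hx hy)
    nlinarith [mul_nonneg (sub_nonneg.mpr h1) (add_nonneg (add_nonneg hS.le hT) hD)]

end CVQKD

end

open CVQKD in
theorem proposition1
    {E : Type*} [NormedAddCommGroup E] [InnerProductSpace ℂ E] [CompleteSpace E]
    [TopologicalSpace.SeparableSpace E]
    (m : ℕ) (hm : 2 ≤ m) (N : ℝ≥0) (hN : 0 < N)
    (U : Mode →ₗᵢ[ℂ] ModeTensor E) (hU : IsAdmissible U)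
    (P PG : Measure (ℝ × ℝ))
    (hP : P = jointLaw (discreteModulation m N) U)
    (hPG : PG = jointLaw (gaussianModulation N) U) :
    (IsProbabilityMeasure P ∧ MemLp Prod.fst 4 P ∧ MemLp Prod.snd 4 P) ∧
    (IsProbabilityMeasure PG ∧ MemLp Prod.fst 4 PG ∧ MemLp Prod.snd 4 PG) ∧
    γ₁₁ P = γ₁₁ PG ∧
    ∃ c₁ c₂ : ℝ, 0 < c₁ ∧ 0 < c₂ ∧
      Real.sqrt (centralMoment₂ PG 0 4) ≤ c₁ * Real.sqrt (centralMoment₂ P 0 4) ∧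
      Real.sqrt (centralMoment₂ PG 2 2) ≤ c₂ * Real.sqrt (centralMoment₂ P 2 2) ∧
      ∀ ε : ℝ, 0 ≤ ε →
        (chiSq (averageState (discreteModulation m N)) (thermal N)) ^ (1 / 2 : ℝ)
          ≤ ENNReal.ofReal (ε ^ 2) →
        |γ₂₂ P - γ₂₂ PG| ≤ ε * (1 + c₁) * Real.sqrt (centralMoment₂ P 0 4) ∧
        |γ₁₂ P - γ₁₂ PG| ≤ ε * (1 + c₂) * Real.sqrt (centralMoment₂ P 2 2) := by
  have hμ := isModulation_discreteModulation (show 0 < m by omega) N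
  have hG := isModulation_gaussianModulation hN
  have hprob := hμ.isProbabilityMeasure
  have h11 : γ₁₁ P = γ₁₁ PG := by
    have h1 := hμ.ofReal_γ₁₁ hU
    have h2 := hG.ofReal_γ₁₁ hU
    rw [lintegral_sq_discreteModulation hm, ← lintegral_sq_gaussianModulation, ← h2] at h1
    rw [hP, hPG]
    exact (ENNReal.ofReal_eq_ofReal_iff (hμ.γ₁₁_nonneg U) (hG.γ₁₁_nonneg U)).mp h1
  have h11pos : 0 < γ₁₁ PG := by
    rw [hPG, ← ENNReal.ofReal_pos, hG.ofReal_γ₁₁ hU, lintegral_sq_gaussianModulation]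
    exact_mod_cast hN
  have hS1 : 0 < Real.sqrt (centralMoment₂ P 0 4) :=
    Real.sqrt_pos.mpr (hP ▸ hμ.fourthMoment_pos hU)
  have hT1 : 0 < Real.sqrt (centralMoment₂ PG 0 4) :=
    Real.sqrt_pos.mpr (hPG ▸ hG.fourthMoment_pos hU)
  have hS2 : 0 < Real.sqrt (centralMoment₂ P 2 2) :=
    Real.sqrt_pos.mpr (hP ▸ hμ.mixedMoment_pos hU (hP ▸ h11 ▸ h11pos))
  have hT2 : 0 < Real.sqrt (centralMoment₂ PG 2 2) :=
    Real.sqrt_pos.mpr (hPG ▸ hG.mixedMoment_pos hU (hPG ▸ h11pos))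
  set D₁ := dualNorm N (posGram hU (Nat.zero_le 2) le_rfl)
  set D₂ := dualNorm N (crossGram hU)
  have hD1 : 0 ≤ D₁ := Real.sqrt_nonneg _
  have hD2 : 0 ≤ D₂ := Real.sqrt_nonneg _
  -- The choice `c = (T + D) / S` makes `c S = T + D`, which dominates `T` and is also what the
  -- covariance bounds need. Neither constant involves `ε`.
  refine ⟨?_, ?_, h11, (Real.sqrt (centralMoment₂ PG 0 4) + D₁) / Real.sqrt (centralMoment₂ P 0 4),
    (Real.sqrt (centralMoment₂ PG 2 2) + D₂) / Real.sqrt (centralMoment₂ P 2 2),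
    by positivity, by positivity, ?_, ?_, ?_⟩
  · rw [hP]
    exact ⟨hμ.isProbabilityMeasure_jointLaw U, hμ.memLp_fst U, hμ.memLp_snd hU⟩
  · rw [hPG]
    exact ⟨hG.isProbabilityMeasure_jointLaw U, hG.memLp_fst U, hG.memLp_snd hU⟩
  · rw [div_mul_cancel₀ _ hS1.ne']
    linarith
  · rw [div_mul_cancel₀ _ hS2.ne']
    linarith
  · intro ε hε hχ
    constructor
    · refine abs_sub_le_of_quadratic_bound hS1 (hP ▸ hμ.abs_γ₂₂_le hU) (hPG ▸ hG.abs_γ₂₂_le hU)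
        hD1 hε ?_
      have h := norm_integral_form_sub_le hμ.geometricDecay hN
        (subexponential_posGram hU (Nat.zero_le 2) le_rfl) (sq_nonneg ε) hχ
      rwa [← hμ.γ₂₂_eq_integral_form hU, ← hG.γ₂₂_eq_integral_form hU, ← hP, ← hPG,
        ← Complex.ofReal_sub, Complex.norm_real] at h
    · refine abs_sub_le_of_quadratic_bound hS2 (hP ▸ hμ.abs_γ₁₂_le hU) (hPG ▸ hG.abs_γ₁₂_le hU)
        hD2 hε ?_
      have h := norm_integral_form_sub_le hμ.geometricDecay hN
        (subexponential_crossGram hU) (sq_nonneg ε) hχ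
      rwa [← hμ.γ₁₂_eq_integral_form hU, ← hG.γ₁₂_eq_integral_form hU, ← hP, ← hPG,
        ← Complex.ofReal_sub, Complex.norm_real] at h
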